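/- Let $G$ be a torsion-free group (the identity is its only element of finite order) and let $H\le G$ be a subgroup such that $G$ is hyperbolic relative to $H$. Let $\mathbb{Z}[G/H]$ be the permutation $\mathbb{Z}G$-module on the set of left cosets of $H$, let $\epsilon\colon\mathbb{Z}[G/H]\to\mathbb{Z}$ be the $\mathbb{Z}G$-linear map that sends every coset to $1$, and let $\Delta_{G/H}=\ker\epsilon$. Then there are an $n\ge 0$ and an exact sequence of $\mathbb{Z}G$-modules $$0\to F_n\to\cdots\to F_1\to F_0\to\Delta_{G/H}\to 0$$ in which every $F_i$ is free and finitely generated; in particular, $\Delta_{G/H}$ is of type $FP$ over $\mathbb{Z}G$ (it has a finite-length resolution by finitely generated projective $\mathbb{Z}G$-modules). Consequently, the relative cohomological dimension $$\mathrm{cd}_{\mathbb{Z}}(G,H)=\sup\{\,i \mid H^i(G,H;M)\neq 0\text{ for some }\mathbb{Z}G\text{-module }M\,\},\qquad H^i(G,H;M):=\mathrm{Ext}^{i-1}_{\mathbb{Z}G}(\Delta_{G/H},M),$$ is finite, i.e. less than $+\infty$. Here relative hyperbolicity is meant as follows. Let $S$ be a finite generating set of $G$ that contains a generating set of $H$,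 let $\Gamma=\Gamma(G,S)$ be the Cayley graph with word metric $d_S$, and let the coned-off Cayley graph $\hat\Gamma$ be obtained from $\Gamma$ by adding for each left coset $gH$ a cone vertex $v(gH)$ and an edge of length $\tfrac12$ from $v(gH)$ to each element of $gH$; $\hat d$ is its path metric, edges of $\Gamma$ having length $1$. For an edge path $c$ in $\Gamma$, let $\hat c$ be the path in $\hat\Gamma$ obtained by replacing each maximal subpath of $c$ that has at least one edge and all of whose vertices lie in one coset $gH$ by the path of length $1$ with the same endpoints through $v(gH)$; the path $c$ enters (penetrates) $gH$ if there is such a subpath, whose first and last vertices are the entry and exit points. The path $c$ is a $T$-relative quasi-geodesic if $T^{-1}|t-t'|\le\hat d(\hat c(t),\hat c(t'))\le T|t-t'|$ for all vertices $\hat c(t),\hat c(t')$ of $\hat c$, parametrized by arc length; such a path enters each coset at most once. Then $G$ is hyperbolic relative to $H$ if for some such $S$ the graph $\hat\Gamma$ is Gromov hyperbolic and bounded coset penetration holds: for every $T>0$ there is an $r$ such that for all $T$-relative quasi-geodesics $c_1,c_2$ in $\Gamma$ with the same initial and the same terminal vertex, (1) if $c_1$ enters a coset and its entry and exit points there are more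 than $r$ apart in $d_S$, then $c_2$ enters the same coset; and (2) if $c_1$ and $c_2$ enter the same coset, then their entry points are at $d_S$-distance at most $r$, and so are their exit points. -/

import Mathlib

universe u

noncomputable section

namespace RelHyp

/-! ### Coned-off Cayley graphs -/

section ConedOff

variable {G : Type u} [Group G]

/-- The coned-off Cayley graph of `(G, H)` with respect to `S`: the Cayley graph of `G`
(vertices `Sum.inl g`, edges between `g` and `g * s`), together with a cone vertex `Sum.inr q`
for every left coset `q` of `H`, joined to every element of `q`. -/
def conedOffGraph (H : Subgroup G) (S : Set G) : SimpleGraph (G ⊕ (G ⧸ H)) where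
  Adj
    | .inl x, .inl y => (SimpleGraph.mulCayley S).Adj x y
    | .inl x, .inr q => (x : G ⧸ H) = q
    | .inr q, .inl x => (x : G ⧸ H) = q
    | .inr _, .inr _ => False
  symm := ⟨by
    rintro (x | q) (y | q') h
    · exact SimpleGraph.Adj.symm h
    · exact h
    · exact h
    · exact h⟩
  loopless := ⟨by
    rintro (x | q) h
    · exact (SimpleGraph.mulCayley S).irrefl h
    · exact h⟩

/-- Edges of the Cayley graph have length `1`, edges at a cone vertex have length `1/2`. -/
def edgeLength {H : Subgroup G} : G ⊕ (G ⧸ H) → G ⊕ (G ⧸ H) → ℝ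
  | .inl _, .inl _ => 1
  | _, _ => 1 / 2

/-- The length of an edge path in the coned-off graph, given by its list of vertices. -/
def pathLength {H : Subgroup G} : List (G ⊕ (G ⧸ H)) → ℝ
  | [] => 0
  | [_] => 0
  | x :: y :: l => edgeLength x y + pathLength (y :: l)

/-- The path metric `d̂` of the coned-off Cayley graph, on its vertices. -/
def conedOffDist (H : Subgroup G) (S : Set G) (x y : G ⊕ (G ⧸ H)) : ℝ :=
  ⨅ w : (conedOffGraph H S).Walk x y, pathLength w.support

/-- The Gromov product `(x | y)_w` for a distance function `d`. -/
def gromovProduct {X : Type u} (d : X → X → ℝ) (w x y : X) : ℝ :=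
  (d x w + d y w - d x y) / 2

/-- Gromov hyperbolicity of a distance function. -/
def IsGromovHyperbolic {X : Type u} (d : X → X → ℝ) : Prop :=
  ∃ δ : ℝ, 0 ≤ δ ∧ ∀ w x y z : X,
    min (gromovProduct d w x y) (gromovProduct d w y z) - δ ≤ gromovProduct d w x z

/-! ### Relative quasi-geodesics and bounded coset penetration

Edge paths in the Cayley graph are handled through their lists of vertices. -/

open Classical in
/-- The decomposition of a path into its maximal subpaths all of whose vertices lie in one left
coset of `H`. -/
def cosetRuns (H : Subgroup G) (c : List G) : List (List G) :=
  c.splitBy fun x y => decide ((x : G ⧸ H) = (y : G ⧸ H))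

/-- What replaces a maximal subpath in a coset `q`: a single vertex is kept, and a subpath with at
least one edge, from `x` to `y`, becomes the path of length `1` from `x` to `y` through the cone
vertex of `q`. -/
def coneRun (H : Subgroup G) : List G → List (G ⊕ (G ⧸ H))
  | [] => []
  | [x] => [.inl x]
  | x :: y :: l => [.inl x, .inr (x : G ⧸ H), .inl ((y :: l).getLast (List.cons_ne_nil y l))]

/-- The image `ĉ` in the coned-off graph of a path `c` in the Cayley graph. -/
def coneOffPath (H : Subgroup G) (c : List G) : List (G ⊕ (G ⧸ H)) :=
  (cosetRuns H c).flatMap (coneRun H)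

/-- `c` is a `T`-relative quasi-geodesic: `ĉ`, parametrized by arc length, satisfies
`T⁻¹ |t - t'| ≤ d̂ (ĉ t) (ĉ t') ≤ T |t - t'|`. Here `t`, `t'` run over the parameters of the vertices
of `ĉ`; the parameter of the vertex number `i` is the length of the initial segment of `ĉ` that
ends there. -/
def IsRelQuasiGeodesic (H : Subgroup G) (S : Set G) (T : ℝ) (c : List G) : Prop :=
  ∀ i j : Fin (coneOffPath H c).length,
    let t := pathLength ((coneOffPath H c).take ((i : ℕ) + 1))
    let t' := pathLength ((coneOffPath H c).take ((j : ℕ) + 1))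
    T⁻¹ * |t - t'| ≤ conedOffDist H S ((coneOffPath H c).get i) ((coneOffPath H c).get j) ∧
      conedOffDist H S ((coneOffPath H c).get i) ((coneOffPath H c).get j) ≤ T * |t - t'|

/-- The path `c` enters (penetrates) the coset `q` at `x` and exits it at `y`: some maximal subpath
of `c` with vertices in `q` has at least one edge and goes from `x` to `y`. Equivalently, `ĉ`
passes from `x` to `y` through the cone vertex of `q`. For a relative quasi-geodesic there is at
most one such subpath for each `q`. -/
def Penetrates (H : Subgroup G) (c : List G) (q : G ⧸ H) (x y : G) : Prop :=
  ∃ p ∈ cosetRuns H c, 2 ≤ p.length ∧ p.head? = some x ∧ p.getLast? = some y ∧ (x : G ⧸ H) = q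

/-- Bounded coset penetration; distances between elements of `G` are in the word metric of `S`. -/
def BoundedCosetPenetration (H : Subgroup G) (S : Set G) : Prop :=
  ∀ T : ℝ, 0 < T → ∃ r : ℝ, ∀ (a b : G) (c₁ c₂ : (SimpleGraph.mulCayley S).Walk a b),
    IsRelQuasiGeodesic H S T c₁.support → IsRelQuasiGeodesic H S T c₂.support →
    (∀ (q : G ⧸ H) (x y : G), Penetrates H c₁.support q x y →
        r < ((SimpleGraph.mulCayley S).dist x y : ℝ) →
        ∃ x' y' : G, Penetrates H c₂.support q x' y') ∧
    (∀ (q : G ⧸ H) (x y x' y' : G),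
        Penetrates H c₁.support q x y → Penetrates H c₂.support q x' y' →
        ((SimpleGraph.mulCayley S).dist x x' : ℝ) ≤ r ∧
        ((SimpleGraph.mulCayley S).dist y y' : ℝ) ≤ r)

/-- `G` is hyperbolic relative to `H`: for some finite generating set `S` of `G` that contains a
generating set of `H`, the coned-off Cayley graph is Gromov hyperbolic and bounded coset penetration
holds. -/
def IsHyperbolicRelativeTo (G : Type u) [Group G] (H : Subgroup G) : Prop :=
  ∃ S : Set G, S.Finite ∧ Subgroup.closure S = ⊤ ∧ Subgroup.closure (S ∩ (H : Set G)) = H ∧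
    IsGromovHyperbolic (conedOffDist H S) ∧ BoundedCosetPenetration H S

end ConedOff

/-! ### Finite resolutions -/

/-- There is an exact sequence `0 → F n → ⋯ → F 1 → F 0 → M → 0` of `R`-modules in which every
`F i` is finitely generated and free. -/
def HasFiniteFreeResolution (R : Type u) [Ring R] (M : Type u) [AddCommGroup M] [Module R M] :
    Prop :=
  ∃ (n : ℕ) (F : ℕ → ModuleCat.{u} R) (d : ∀ i, F (i + 1) →ₗ[R] F i) (ε : F 0 →ₗ[R] M),
    (∀ i, Module.Free R (F i) ∧ Module.Finite R (F i)) ∧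
    (∀ i, n < i → Subsingleton (F i)) ∧
    Function.Surjective ε ∧ Function.Exact (d 0) ε ∧ ∀ i, Function.Exact (d (i + 1)) (d i)

/-- The `R`-module `M` is of type `FP`: there is an exact sequence
`0 → P n → ⋯ → P 1 → P 0 → M → 0` of `R`-modules in which every `P i` is finitely generated and
projective. -/
def IsTypeFP (R : Type u) [Ring R] (M : Type u) [AddCommGroup M] [Module R M] : Prop :=
  ∃ (n : ℕ) (P : ℕ → ModuleCat.{u} R) (d : ∀ i, P (i + 1) →ₗ[R] P i) (ε : P 0 →ₗ[R] M),
    (∀ i, Module.Projective R (P i) ∧ Module.Finite R (P i)) ∧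
    (∀ i, n < i → Subsingleton (P i)) ∧
    Function.Surjective ε ∧ Function.Exact (d 0) ε ∧ ∀ i, Function.Exact (d (i + 1)) (d i)

/-! ### Relative cohomology of a group pair -/

section Cohomology

variable {G : Type u} [Group G] (H : Subgroup G)

/-- The `ℤG`-module `ℤ[G/H]` on the set of left cosets. -/
abbrev CosetModule : Type u := (Representation.ofMulAction ℤ G (G ⧸ H)).asModule

/-- The sum of the coefficients, as a `ℤ`-linear map on `ℤ[G/H]`. -/
def coeffSum : MonoidAlgebra ℤ (G ⧸ H) →ₗ[ℤ] ℤ :=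
  Finsupp.linearCombination ℤ (fun _ : G ⧸ H => (1 : ℤ)) ∘ₗ
    (MonoidAlgebra.coeffLinearEquiv ℤ).toLinearMap

/-- The augmentation `ℤ[G/H] → ℤ`, which sends every coset to `1`, as a morphism of `ℤG`-modules to
the trivial module `ℤ`. -/
def augmentation :
    CosetModule H →ₗ[MonoidAlgebra ℤ G] (Representation.trivial ℤ G ℤ).asModule :=
  Representation.IntertwiningMap.equivLinearMapAsModule _ _
    { toLinearMap := coeffSum H
      isIntertwining' := fun g => by ext x; simp [coeffSum] }

/-- The `ℤG`-module `Δ_{G/H}`, the kernel of the augmentation `ℤ[G/H] → ℤ`. -/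
abbrev Delta : Submodule (MonoidAlgebra ℤ G) (CosetModule H) := LinearMap.ker (augmentation H)

/-- The relative cohomology `H^i(G, H; M) = Ext_{ℤG}^{i-1}(Δ_{G/H}, M)`, which is zero
for `i = 0`. -/
def RelCohomology (M : ModuleCat.{u} (MonoidAlgebra ℤ G)) : ℕ → Type u
  | 0 => PUnit
  | i + 1 => CategoryTheory.Abelian.Ext (ModuleCat.of (MonoidAlgebra ℤ G) (Delta H)) M i

/-- The cohomological dimension of the pair `(G, H)`, the supremum of all `i` such that
`H^i(G, H; M)` is nonzero for some `ℤG`-module `M`; it is `⊥` if there are none, and `⊤` if these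
`i` are unbounded. -/
def relCohomologicalDimension : WithBot ℕ∞ :=
  sSup {n | ∃ i : ℕ, n = (i : WithBot ℕ∞) ∧
    ∃ M : ModuleCat.{u} (MonoidAlgebra ℤ G), Nontrivial (RelCohomology H M i)}

end Cohomology

end RelHyp

end

noncomputable section
namespace RelHyp

/-! ### The coned-off metric in half units, with values in the natural numbers. -/

section ConeDist

open SimpleGraph

variable {G : Type u} [Group G]

/-! ### Connectivity of Cayley graphs -/

/-! The group acts on a Rips complex whose vertices are the cosets of `H`. Vertex stabilizers are
conjugates of `H` and may be infinite, but simplices with at least two vertices behave as for a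
hyperbolic group. What is needed is a hyperbolic distance on `G ⧸ H` that is proper on pairs. The
coned-off metric does not serve, since it forgets all distances inside a coset; the cusped graph,
with a combinatorial horoball glued to each coset, records them logarithmically.

Hyperbolicity of the cusped graph is derived as follows. Bounded coset penetration yields fineness
of the coned-off graph (`exists_fineness_bound`). With thin triangles this shows that two vertices
have close projections to a coset unless a geodesic between them meets its cone vertex
(`exists_proj_bound`). Geodesics of the coned-off graph therefore lift coherently to the cusped
graph, each cone vertex being replaced by a path up, across and down the horoball. The lifts form
thin triangles, and the guessing-geodesics criterion `exists_fourPoint_of_guess` gives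
`exists_cusped_fourPoint`.

Let `D` be the distance between horoballs. Points at a large height `t` over two different cosets
are at distance `2 * t + D` up to a bounded error, so `D` inherits the four point inequality. It
satisfies no triangle inequality, because travel inside a horoball costs nothing. Still, distinct
cosets have a finite common stabilizer and finitely many common neighbours, and pairs of bounded
distance form finitely many orbits (`isProperHyperbolic_cosetDist`).

Rips' argument, pushing the farthest vertex towards a base point, makes the Rips complex of `D`
acyclic (`exists_contract_eq`). Torsion-freeness makes the action on simplices with at least two
vertices free (`eq_one_of_smul_eq`); there are finitely many orbits of them, and their size is
bounded. The chain modules on `k ≥ 2` vertices are thus free of finite rank and eventually zero, and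
the chains on one vertex are `ℤ[G/H]`. Acyclicity there says that the boundaries are exactly `Δ`, so
the complex truncated at `k = 2` is the resolution (`hasFiniteFreeResolution_delta`). The chains
live in the exterior algebra of `ℤ[G/H]`, where the boundary is contraction with the augmentation. A
finite resolution makes `Ext` vanish in high degrees, which bounds the dimension. -/

lemma exists_walk_coset (H : Subgroup G) (S : Set G)
    (hH : Subgroup.closure (S ∩ (H : Set G)) = H) (x : G) {h : G} (hh : h ∈ H) :
    ∃ w : (mulCayley S).Walk x (x * h), ∀ z ∈ w.support, (z : G ⧸ H) = (x : G ⧸ H) := by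
  rw [← hH] at hh
  induction hh using Subgroup.closure_induction_right generalizing x with
  | one => exact ⟨Walk.nil.copy rfl (mul_one x).symm, by simp⟩
  | mul_right a ha s hs ih =>
    obtain ⟨w, hw⟩ := ih x
    have haH : a ∈ H := by rw [← hH]; exact ha
    by_cases h1 : s = 1
    · subst h1
      exact ⟨w.copy rfl (by simp), by simpa using hw⟩
    have hadj : (mulCayley S).Adj (x * a) (x * (a * s)) := by
      rw [mulCayley_adj]
      refine ⟨fun h => h1 ?_, Or.inl ?_⟩
      · simpa [← mul_assoc] using h
      · simpa [mul_assoc] using hs.1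
    refine ⟨w.concat hadj, fun z hz => ?_⟩
    rw [Walk.support_concat] at hz
    simp only [List.mem_append, List.mem_singleton] at hz
    rcases hz with hz | rfl
    · exact hw z hz
    · rw [eq_comm, QuotientGroup.eq]
      simpa [← mul_assoc] using H.mul_mem haH hs.2
  | mul_inv_cancel a ha s hs ih =>
    obtain ⟨w, hw⟩ := ih x
    have haH : a ∈ H := by rw [← hH]; exact ha
    by_cases h1 : s = 1
    · subst h1
      exact ⟨w.copy rfl (by simp), by simpa using hw⟩
    have hadj : (mulCayley S).Adj (x * a) (x * (a * s⁻¹)) := by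
      rw [mulCayley_adj]
      refine ⟨fun h => h1 ?_, Or.inr ?_⟩
      · simpa [← mul_assoc] using h
      · simpa [mul_assoc] using hs.1
    refine ⟨w.concat hadj, fun z hz => ?_⟩
    rw [Walk.support_concat] at hz
    simp only [List.mem_append, List.mem_singleton] at hz
    rcases hz with hz | rfl
    · exact hw z hz
    · rw [eq_comm, QuotientGroup.eq]
      simpa [← mul_assoc] using H.mul_mem haH (H.inv_mem hs.2)

lemma exists_walk_of_mk_eq {H : Subgroup G} {S : Set G}
    (hH : Subgroup.closure (S ∩ (H : Set G)) = H) {x y : G} (hxy : (x : G ⧸ H) = (y : G ⧸ H)) :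
    ∃ w : (mulCayley S).Walk x y, ∀ z ∈ w.support, (z : G ⧸ H) = (x : G ⧸ H) := by
  obtain ⟨w, hw⟩ := exists_walk_coset H S hH x (QuotientGroup.eq.1 hxy)
  exact ⟨w.copy rfl (by simp), by simpa using hw⟩

lemma mulCayley_connected {S : Set G} (hS : Subgroup.closure S = ⊤) :
    (mulCayley S).Connected := by
  have := exists_walk_coset (⊤ : Subgroup G) S (by simpa using hS)
  refine ⟨fun x y => ?_⟩
  obtain ⟨w, -⟩ := this x (h := x⁻¹ * y) trivial
  exact ⟨w.copy rfl (by simp)⟩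

/-- Left multiplication as a graph isomorphism of the Cayley graph. -/
def mulCayleyIso (S : Set G) (g : G) : mulCayley S ≃g mulCayley S where
  toEquiv := Equiv.mulLeft g
  map_rel_iff' := by simp

lemma mulCayley_dist_mul_left (S : Set G) (g x y : G) :
    (mulCayley S).dist (g * x) (g * y) = (mulCayley S).dist x y := by
  have key : ∀ g x y : G, (mulCayley S).Reachable x y →
      (mulCayley S).dist (g * x) (g * y) ≤ (mulCayley S).dist x y := by
    intro g x y h
    obtain ⟨w, hw⟩ := h.exists_walk_length_eq_dist
    rw [← hw, ← Walk.length_map (mulCayleyIso S g).toHom w]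
    exact SimpleGraph.dist_le _
  by_cases h : (mulCayley S).Reachable x y
  · refine le_antisymm (key g x y h) ?_
    have h' : (mulCayley S).Reachable (g * x) (g * y) := h.map (mulCayleyIso S g).toHom
    simpa using key g⁻¹ _ _ h'
  · have h' : ¬ (mulCayley S).Reachable (g * x) (g * y) := by
      intro hr
      apply h
      simpa [mulCayleyIso] using hr.map (mulCayleyIso S g⁻¹).toHom
    rw [dist_eq_zero_of_not_reachable h, dist_eq_zero_of_not_reachable h']

lemma conedOffGraph_connected (H : Subgroup G) {S : Set G} (hS : Subgroup.closure S = ⊤) :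
    (conedOffGraph H S).Connected := by
  have h1 : ∀ x y : G, (conedOffGraph H S).Reachable (.inl x) (.inl y) := fun x y =>
    ((mulCayley_connected hS).preconnected x y).map
      (⟨Sum.inl, fun h => h⟩ : mulCayley S →g conedOffGraph H S)
  have h2 : ∀ u : G ⊕ (G ⧸ H), (conedOffGraph H S).Reachable (.inl 1) u := by
    rintro (x | q)
    · exact h1 1 x
    · induction q using QuotientGroup.induction_on with
      | H x =>
        refine (h1 1 x).trans (Adj.reachable ?_)
        exact (rfl : (x : G ⧸ H) = x)
  have : Nonempty (G ⊕ (G ⧸ H)) := ⟨.inl 1⟩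
  exact ⟨fun u v => (h2 u).symm.trans (h2 v)⟩

/-! ### The path metric of the coned-off graph in half units -/

/-- Twice the length of an edge of the coned-off graph. -/
def edgeWeight {H : Subgroup G} : G ⊕ (G ⧸ H) → G ⊕ (G ⧸ H) → ℕ
  | .inl _, .inl _ => 2
  | _, _ => 1

lemma edgeWeight_comm {H : Subgroup G} (u v : G ⊕ (G ⧸ H)) : edgeWeight u v = edgeWeight v u := by
  rcases u with x | q <;> rcases v with y | q' <;> rfl

lemma one_le_edgeWeight {H : Subgroup G} (u v : G ⊕ (G ⧸ H)) : 1 ≤ edgeWeight u v := by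
  rcases u with x | q <;> rcases v with y | q' <;> simp [edgeWeight]

lemma edgeWeight_le_two {H : Subgroup G} (u v : G ⊕ (G ⧸ H)) : edgeWeight u v ≤ 2 := by
  rcases u with x | q <;> rcases v with y | q' <;> simp [edgeWeight]

lemma edgeLength_eq {H : Subgroup G} (u v : G ⊕ (G ⧸ H)) :
    edgeLength u v = (edgeWeight u v : ℝ) / 2 := by
  rcases u with x | q <;> rcases v with y | q' <;> simp [edgeWeight, edgeLength]

/-- Twice the length of a walk in the coned-off graph. -/
def walkWeight {H : Subgroup G} {S : Set G} : ∀ {u v : G ⊕ (G ⧸ H)},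
    (conedOffGraph H S).Walk u v → ℕ
  | _, _, .nil => 0
  | _, _, .cons (u := u) (v := v) _ p => edgeWeight u v + walkWeight p

lemma pathLength_support {H : Subgroup G} {S : Set G} {u v : G ⊕ (G ⧸ H)}
    (w : (conedOffGraph H S).Walk u v) : pathLength w.support = (walkWeight w : ℝ) / 2 := by
  induction w with
  | nil => simp [pathLength, walkWeight]
  | @cons a b c h p ih =>
    rw [Walk.support_cons, ← Walk.cons_tail_support, pathLength, Walk.cons_tail_support, ih, walkWeight,
      edgeLength_eq]
    push_cast
    ring

lemma walkWeight_append {H : Subgroup G} {S : Set G} {u v z : G ⊕ (G ⧸ H)}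
    (p : (conedOffGraph H S).Walk u v) (p' : (conedOffGraph H S).Walk v z) :
    walkWeight (p.append p') = walkWeight p + walkWeight p' := by
  induction p with
  | nil => simp [walkWeight]
  | cons h p ih => simp [walkWeight, ih, add_assoc]

lemma walkWeight_reverse {H : Subgroup G} {S : Set G} {u v : G ⊕ (G ⧸ H)}
    (p : (conedOffGraph H S).Walk u v) : walkWeight p.reverse = walkWeight p := by
  induction p with
  | nil => simp [walkWeight]
  | @cons a b c h p ih =>
    simp [walkWeight, walkWeight_append, ih, edgeWeight_comm b a, add_comm]

/-- Twice the path metric of the coned-off graph. -/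
def coneDist (H : Subgroup G) (S : Set G) (u v : G ⊕ (G ⧸ H)) : ℕ :=
  ⨅ w : (conedOffGraph H S).Walk u v, walkWeight w

lemma coneDist_le {H : Subgroup G} {S : Set G} {u v : G ⊕ (G ⧸ H)}
    (w : (conedOffGraph H S).Walk u v) : coneDist H S u v ≤ walkWeight w :=
  ciInf_le (OrderBot.bddBelow _) w

lemma exists_walkWeight_eq {H : Subgroup G} {S : Set G} (hS : Subgroup.closure S = ⊤)
    (u v : G ⊕ (G ⧸ H)) : ∃ w : (conedOffGraph H S).Walk u v, walkWeight w = coneDist H S u v := by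
  have : Nonempty ((conedOffGraph H S).Walk u v) := (conedOffGraph_connected H hS).preconnected u v
  exact ciInf_mem (fun w : (conedOffGraph H S).Walk u v => walkWeight w)

/-- Weights of walks are natural numbers, so the infimum is attained. This allows all later
estimates to be integer arithmetic in half units. -/
lemma conedOffDist_eq {H : Subgroup G} {S : Set G} (hS : Subgroup.closure S = ⊤)
    (u v : G ⊕ (G ⧸ H)) : conedOffDist H S u v = (coneDist H S u v : ℝ) / 2 := by
  obtain ⟨w₀, hw₀⟩ := exists_walkWeight_eq hS u v
  have : Nonempty ((conedOffGraph H S).Walk u v) := ⟨w₀⟩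
  refine le_antisymm ?_ ?_
  · refine (ciInf_le ⟨0, ?_⟩ w₀).trans ?_
    · rintro _ ⟨w, rfl⟩
      simp only [pathLength_support]
      positivity
    · simp only [pathLength_support, hw₀, le_refl]
  · refine le_ciInf fun w => ?_
    rw [pathLength_support]
    have : (coneDist H S u v : ℝ) ≤ walkWeight w := by exact_mod_cast coneDist_le w
    linarith

@[simp] lemma coneDist_self (H : Subgroup G) (S : Set G) (u : G ⊕ (G ⧸ H)) :
    coneDist H S u u = 0 :=
  Nat.le_zero.1 (coneDist_le (S := S) (Walk.nil : (conedOffGraph H S).Walk u u))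

lemma coneDist_adj_le {H : Subgroup G} {S : Set G} {u v : G ⊕ (G ⧸ H)}
    (h : (conedOffGraph H S).Adj u v) : coneDist H S u v ≤ edgeWeight u v := by
  simpa [walkWeight] using coneDist_le h.toWalk

lemma coneDist_comm {H : Subgroup G} {S : Set G} (hS : Subgroup.closure S = ⊤)
    (u v : G ⊕ (G ⧸ H)) : coneDist H S u v = coneDist H S v u := by
  have key : ∀ u v : G ⊕ (G ⧸ H), coneDist H S u v ≤ coneDist H S v u := by
    intro u v
    obtain ⟨w, hw⟩ := exists_walkWeight_eq hS v u
    rw [← hw, ← walkWeight_reverse]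
    exact coneDist_le _
  exact le_antisymm (key u v) (key v u)

lemma coneDist_triangle {H : Subgroup G} {S : Set G} (hS : Subgroup.closure S = ⊤)
    (u v z : G ⊕ (G ⧸ H)) : coneDist H S u z ≤ coneDist H S u v + coneDist H S v z := by
  obtain ⟨w, hw⟩ := exists_walkWeight_eq hS u v
  obtain ⟨w', hw'⟩ := exists_walkWeight_eq hS v z
  rw [← hw, ← hw', ← walkWeight_append]
  exact coneDist_le _

/-- Peeling off the first edge of a minimal walk; inductions along geodesics use this in place of a
stored path. -/
lemma exists_step {H : Subgroup G} {S : Set G} (hS : Subgroup.closure S = ⊤)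
    {u v : G ⊕ (G ⧸ H)} (huv : u ≠ v) :
    ∃ u', (conedOffGraph H S).Adj u u' ∧ coneDist H S u u' = edgeWeight u u' ∧
      coneDist H S u v = edgeWeight u u' + coneDist H S u' v := by
  obtain ⟨w, hw⟩ := exists_walkWeight_eq hS u v
  cases w with
  | nil => exact absurd rfl huv
  | @cons _ b _ h p =>
    have h1 := coneDist_adj_le h
    have h2 := coneDist_le p
    have h3 := coneDist_triangle hS u b v
    simp only [walkWeight] at hw
    exact ⟨b, h, by omega, by omega⟩

lemma eq_of_coneDist_eq_zero {H : Subgroup G} {S : Set G} (hS : Subgroup.closure S = ⊤)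
    {u v : G ⊕ (G ⧸ H)} (h : coneDist H S u v = 0) : u = v := by
  by_contra hne
  obtain ⟨b, -, -, h3⟩ := exists_step hS hne
  have := one_le_edgeWeight u b
  omega

lemma exists_fourPoint {H : Subgroup G} {S : Set G} (hS : Subgroup.closure S = ⊤)
    (hyp : IsGromovHyperbolic (conedOffDist H S)) :
    ∃ K : ℕ, ∀ w x y z : G ⊕ (G ⧸ H), coneDist H S x z + coneDist H S w y ≤
      max (coneDist H S x y + coneDist H S w z) (coneDist H S y z + coneDist H S w x) + K := by
  obtain ⟨δ, hδ, h⟩ := hyp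
  -- The Gromov product contributes a factor `1/2` and the half units another one, so `δ` becomes `4
  -- * δ`.
  obtain ⟨K, hK⟩ := exists_nat_ge (4 * δ)
  refine ⟨K, fun w x y z => ?_⟩
  have h1 := h w x y z
  simp only [gromovProduct, conedOffDist_eq hS] at h1
  rw [coneDist_comm hS w y, coneDist_comm hS w z, coneDist_comm hS w x]
  have h3 : (coneDist H S x z + coneDist H S y w : ℝ) ≤
      max (coneDist H S x y + coneDist H S z w) (coneDist H S y z + coneDist H S x w) + K := by
    push_cast
    have hl := le_max_left (coneDist H S x y + coneDist H S z w : ℝ)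
      (coneDist H S y z + coneDist H S x w)
    have hr := le_max_right (coneDist H S x y + coneDist H S z w : ℝ)
      (coneDist H S y z + coneDist H S x w)
    rcases min_le_iff.1 (sub_le_iff_le_add.1 h1) with h2 | h2 <;> linarith
  exact_mod_cast h3

end ConeDist
end RelHyp
end

noncomputable section
namespace RelHyp

/-! ### Bounded coset penetration implies fineness of the coned-off graph. -/

section Fineness

open SimpleGraph

variable {G : Type u} [Group G] {H : Subgroup G} {S : Set G}

/-! ### Paths in the coned-off graph and chains of blocks

A block is a pair of elements of the same left coset; a chain of blocks describes a path in the
coned-off graph which crosses the coset of each nontrivial block through its cone vertex. -/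

open Classical in
/-- The path in the coned-off graph described by a block. -/
def blockPath (H : Subgroup G) (p : G × G) : List (G ⊕ (G ⧸ H)) :=
  if p.1 = p.2 then [.inl p.1] else [.inl p.1, .inr (p.1 : G ⧸ H), .inl p.2]

lemma head?_blockPath (p : G × G) : (blockPath H p).head? = some (.inl p.1) := by
  unfold blockPath; split_ifs <;> rfl

lemma getLast?_blockPath (p : G × G) : (blockPath H p).getLast? = some (.inl p.2) := by
  unfold blockPath
  split_ifs with h
  · simp [h]
  · rfl

lemma length_blockPath_le (p : G × G) : (blockPath H p).length ≤ 3 := by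
  unfold blockPath; split_ifs <;> simp

lemma nodup_blockPath (p : G × G) : (blockPath H p).Nodup := by
  unfold blockPath; split_ifs with h <;> simp [h]

lemma isChain_blockPath {p : G × G} (hp : (p.1 : G ⧸ H) = (p.2 : G ⧸ H)) :
    (blockPath H p).IsChain (conedOffGraph H S).Adj := by
  unfold blockPath
  split_ifs with h
  · simp
  · simp only [List.isChain_cons_cons, List.IsChain.singleton, and_true]
    exact ⟨rfl, hp.symm⟩

lemma isChain_flatMap_blockPath {L : List (G × G)}
    (hL : ∀ p ∈ L, (p.1 : G ⧸ H) = (p.2 : G ⧸ H))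
    (hc : L.IsChain fun p p' => (mulCayley S).Adj p.2 p'.1) :
    (L.flatMap (blockPath H)).IsChain (conedOffGraph H S).Adj := by
  induction L with
  | nil => simp
  | cons p L ih =>
    rw [List.flatMap_cons, List.isChain_append]
    refine ⟨isChain_blockPath (hL p (by simp)), ih (fun p' hp' => hL p' (by simp [hp'])) hc.tail,
      ?_⟩
    intro x hx y hy
    cases L with
    | nil => simp at hy
    | cons p' L =>
      rw [getLast?_blockPath, Option.mem_some_iff] at hx
      rw [List.flatMap_cons, List.head?_append, head?_blockPath] at hy
      simp only [Option.some_or, Option.mem_some_iff] at hy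
      subst hx hy
      rw [List.isChain_cons_cons] at hc
      exact hc.1

lemma head?_support {V : Type*} {Γ : SimpleGraph V} {x y : V} (w : Γ.Walk x y) :
    w.support.head? = some x := by
  cases w <;> rfl

lemma coneRun_eq {l : List G} (hl : 2 ≤ l.length) {x y : G} (hx : l.head? = some x)
    (hy : l.getLast? = some y) : coneRun H l = [.inl x, .inr (x : G ⧸ H), .inl y] := by
  match l, hl with
  | a :: b :: l, _ =>
    rw [List.getLast?_cons_cons, List.getLast?_eq_getLast_of_ne_nil (by simp)] at hy
    simp only [List.head?_cons, Option.some_inj] at hx hy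
    simp only [coneRun, hx, hy]

/-- The coset hypothesis stands inside the existential so that `choose` gives a run for every pair.
A trivial block must receive the constant run, because a closed run with edges would be coned off.
-/
lemma exists_blockRun (hH : Subgroup.closure (S ∩ (H : Set G)) = H) (p : G × G) :
    ∃ r : List G, (p.1 : G ⧸ H) = (p.2 : G ⧸ H) →
      (∃ w : (mulCayley S).Walk p.1 p.2, w.support = r) ∧
      (∀ z ∈ r, (z : G ⧸ H) = (p.1 : G ⧸ H)) ∧ coneRun H r = blockPath H p ∧
      (2 ≤ r.length → p.1 ≠ p.2) ∧ (p.1 ≠ p.2 → 2 ≤ r.length) := by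
  by_cases hp : (p.1 : G ⧸ H) = (p.2 : G ⧸ H)
  swap
  · exact ⟨[], fun h => absurd h hp⟩
  by_cases h : p.1 = p.2
  · refine ⟨[p.1], fun _ => ⟨⟨Walk.nil.copy rfl h, by simp⟩, by simp, ?_, by simp, by simp [h]⟩⟩
    simp [coneRun, blockPath, h]
  · obtain ⟨x, y⟩ := p
    obtain ⟨w, hw⟩ := exists_walk_of_mk_eq hH hp
    have hlen : 2 ≤ w.support.length := by
      cases w with
      | nil => exact absurd rfl h
      | cons hadj p => simp
    refine ⟨w.support, fun _ => ⟨⟨w, rfl⟩, hw, ?_, fun _ => h, fun _ => hlen⟩⟩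
    rw [blockPath, if_neg h]
    refine coneRun_eq hlen (head?_support w) ?_
    rw [List.getLast?_eq_getLast_of_ne_nil (by simp)]
    simp

/-- A chain of blocks in which consecutive cosets differ comes from a path of the Cayley graph. -/
lemma exists_walk_of_blocks (hH : Subgroup.closure (S ∩ (H : Set G)) = H) (p : G × G)
    (L : List (G × G)) (hL : ∀ p' ∈ p :: L, (p'.1 : G ⧸ H) = (p'.2 : G ⧸ H))
    (hc : (p :: L).IsChain fun p p' => (mulCayley S).Adj p.2 p'.1)
    (hc' : (p :: L).IsChain fun p p' => (p.1 : G ⧸ H) ≠ (p'.1 : G ⧸ H)) {b : G}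
    (hb : ((p :: L).getLast (List.cons_ne_nil p L)).2 = b) :
    ∃ c : (mulCayley S).Walk p.1 b, coneOffPath H c.support = (p :: L).flatMap (blockPath H) ∧
      ∀ (q : G ⧸ H) (x y : G), Penetrates H c.support q x y ↔
        (x, y) ∈ p :: L ∧ x ≠ y ∧ (x : G ⧸ H) = q := by
  choose run hrun using exists_blockRun (S := S) hH
  have hwalk : ∃ c : (mulCayley S).Walk p.1 b, c.support = ((p :: L).map run).flatten := by
    clear hc'
    induction L generalizing p with
    | nil =>
      obtain ⟨⟨w, hw⟩, -⟩ := hrun p (hL p (by simp))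
      simp only [List.getLast_singleton] at hb
      exact ⟨w.copy rfl hb, by simp [hw]⟩
    | cons p' L ih =>
      rw [List.isChain_cons_cons] at hc
      obtain ⟨c, hcs⟩ := ih p' (fun x hx => hL x (List.mem_cons_of_mem _ hx)) hc.2
        (by simpa using hb)
      obtain ⟨⟨w, hw⟩, -⟩ := hrun p (hL p (by simp))
      refine ⟨w.append (Walk.cons hc.1 c), ?_⟩
      rw [Walk.support_append, Walk.support_cons, List.tail_cons, hw, hcs, List.map_cons (a := p),
        List.flatten_cons]
  obtain ⟨c, hcs⟩ := hwalk
  have hhead : ∀ p' ∈ p :: L, (run p').head? = some p'.1 := by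
    intro p' hp'
    obtain ⟨⟨w, hw⟩, -⟩ := hrun p' (hL p' hp')
    rw [← hw, head?_support]
  have hlast : ∀ p' ∈ p :: L, (run p').getLast? = some p'.2 := by
    intro p' hp'
    obtain ⟨⟨w, hw⟩, -⟩ := hrun p' (hL p' hp')
    rw [← hw, List.getLast?_eq_getLast_of_ne_nil (by simp)]
    simp
  have hne : ∀ p' ∈ p :: L, run p' ≠ [] := by
    intro p' hp' h
    have := hhead p' hp'
    simp [h] at this
  -- Each run stays in one coset and `hc'` separates consecutive runs, so they are the maximal ones
  -- found by `splitBy`.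
  have hruns : cosetRuns H c.support = (p :: L).map run := by
    rw [cosetRuns, List.splitBy_eq_iff]
    refine ⟨hcs, ?_, ?_, ?_⟩
    · intro hmem
      obtain ⟨p', hp', h⟩ := List.mem_map.1 hmem
      exact hne p' hp' h
    · intro m hm
      obtain ⟨p', hp', rfl⟩ := List.mem_map.1 hm
      have hz := (hrun p' (hL p' hp')).2.1
      refine List.Pairwise.isChain ?_
      refine List.pairwise_iff_forall_sublist.2 fun {x y} hs => ?_
      have hx := hz x (hs.subset (by simp))
      have hy := hz y (hs.subset (by simp))
      simp [hx, hy]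
    · rw [List.isChain_map]
      refine hc'.imp_of_mem_imp fun p₁ p₂ h₁ h₂ h => ⟨hne p₁ h₁, hne p₂ h₂, ?_⟩
      have e₁ : (run p₁).getLast (hne p₁ h₁) = p₁.2 := by
        have := hlast p₁ h₁
        rwa [List.getLast?_eq_getLast_of_ne_nil (hne p₁ h₁), Option.some_inj] at this
      have e₂ : (run p₂).head (hne p₂ h₂) = p₂.1 := by
        have := hhead p₂ h₂
        rwa [List.head?_eq_some_head (hne p₂ h₂), Option.some_inj] at this
      rw [e₁, e₂, ← hL p₁ h₁]
      simpa using h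
  refine ⟨c, ?_, ?_⟩
  · rw [coneOffPath, hruns, List.flatMap_map]
    exact List.flatMap_congr fun p' hp' => (hrun p' (hL p' hp')).2.2.1
  · intro q x y
    rw [Penetrates, hruns]
    constructor
    · rintro ⟨m, hm, hlen, hx, hy, hq⟩
      obtain ⟨p', hp', rfl⟩ := List.mem_map.1 hm
      rw [hhead p' hp', Option.some_inj] at hx
      rw [hlast p' hp', Option.some_inj] at hy
      subst hx hy
      exact ⟨hp', (hrun p' (hL p' hp')).2.2.2.1 hlen, hq⟩
    · rintro ⟨hmem, hxy, hq⟩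
      exact ⟨run (x, y), List.mem_map_of_mem hmem, (hrun _ (hL _ hmem)).2.2.2.2 hxy,
        hhead _ hmem, hlast _ hmem, hq⟩

/-! ### Embedded paths of bounded length are relative quasi-geodesics -/

lemma pathLength_take_succ (l : List (G ⊕ (G ⧸ H))) (k : ℕ) (hk : k + 1 < l.length) :
    pathLength (l.take (k + 2)) = pathLength (l.take (k + 1)) + edgeLength l[k] l[k + 1] := by
  induction l generalizing k with
  | nil => simp at hk
  | cons x l ih =>
    cases l with
    | nil => simp at hk
    | cons y l =>
      cases k with
      | zero => simp [pathLength]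
      | succ k =>
        have := ih k (by simpa using hk)
        simp only [List.take_succ_cons, pathLength, List.getElem_cons_succ] at this ⊢
        rw [this]
        ring

lemma conedOffDist_le_of_isChain (hS : Subgroup.closure S = ⊤) {l : List (G ⊕ (G ⧸ H))}
    (hl : l.IsChain (conedOffGraph H S).Adj) {i j : ℕ} (hij : i ≤ j) (hj : j < l.length) :
    conedOffDist H S l[i] l[j] ≤
        pathLength (l.take (j + 1)) - pathLength (l.take (i + 1)) ∧
      ((j : ℝ) - i) / 2 ≤ pathLength (l.take (j + 1)) - pathLength (l.take (i + 1)) ∧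
      pathLength (l.take (j + 1)) - pathLength (l.take (i + 1)) ≤ (j : ℝ) - i := by
  induction j, hij using Nat.le_induction with
  | base => simp [conedOffDist_eq hS]
  | succ j hij ih =>
    obtain ⟨h1, h2, h3⟩ := ih (by omega)
    have hadj : (conedOffGraph H S).Adj l[j] l[j + 1] := List.isChain_iff_getElem.1 hl j hj
    rw [pathLength_take_succ l j hj, edgeLength_eq]
    have h4 : (coneDist H S l[i] l[j + 1] : ℝ) ≤
        coneDist H S l[i] l[j] + coneDist H S l[j] l[j + 1] := by
      exact_mod_cast coneDist_triangle hS _ _ _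
    have h5 : (coneDist H S l[j] l[j + 1] : ℝ) ≤ edgeWeight l[j] l[j + 1] := by
      exact_mod_cast coneDist_adj_le hadj
    have h6 : (1 : ℝ) ≤ edgeWeight l[j] l[j + 1] := by exact_mod_cast one_le_edgeWeight _ _
    have h7 : (edgeWeight l[j] l[j + 1] : ℝ) ≤ 2 := by exact_mod_cast edgeWeight_le_two _ _
    rw [conedOffDist_eq hS] at h1 ⊢
    push_cast
    refine ⟨?_, ?_, ?_⟩ <;> linarith

/-- Distinct vertices are at distance at least `1/2`, while a path with at most `n` vertices has
length at most `n`. Hence mere injectivity gives the lower bound with constant `2 * n`; the upper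
bound holds for every path. -/
lemma isRelQuasiGeodesic_of_nodup (hS : Subgroup.closure S = ⊤) {c : List G}
    (hc : (coneOffPath H c).IsChain (conedOffGraph H S).Adj) (hn : (coneOffPath H c).Nodup)
    {n : ℕ} (hlen : (coneOffPath H c).length ≤ n) (hpos : 0 < n) :
    IsRelQuasiGeodesic H S (2 * n) c := by
  have hn1 : (1 : ℝ) ≤ n := by exact_mod_cast hpos
  have key : ∀ i j : Fin (coneOffPath H c).length, (i : ℕ) ≤ j →
      (2 * n : ℝ)⁻¹ * (pathLength ((coneOffPath H c).take ((j : ℕ) + 1)) -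
        pathLength ((coneOffPath H c).take ((i : ℕ) + 1))) ≤
          conedOffDist H S ((coneOffPath H c).get i) ((coneOffPath H c).get j) ∧
      conedOffDist H S ((coneOffPath H c).get i) ((coneOffPath H c).get j) ≤
        2 * n * (pathLength ((coneOffPath H c).take ((j : ℕ) + 1)) -
          pathLength ((coneOffPath H c).take ((i : ℕ) + 1))) ∧
      0 ≤ pathLength ((coneOffPath H c).take ((j : ℕ) + 1)) -
          pathLength ((coneOffPath H c).take ((i : ℕ) + 1)) := by
    intro i j hij
    obtain ⟨h1, h2, h3⟩ := conedOffDist_le_of_isChain hS hc hij j.2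
    simp only [List.get_eq_getElem]
    set D := pathLength ((coneOffPath H c).take ((j : ℕ) + 1)) -
          pathLength ((coneOffPath H c).take ((i : ℕ) + 1)) with hD
    have hij' : (i : ℝ) ≤ j := by exact_mod_cast hij
    have hD0 : 0 ≤ D := by linarith
    refine ⟨?_, by nlinarith, hD0⟩
    rcases hij.eq_or_lt with h | h
    · have : D ≤ 0 := by rw [h] at h3; linarith
      have : D = 0 := le_antisymm this hD0
      rw [this, conedOffDist_eq hS, mul_zero]
      positivity
    · have hne : (coneOffPath H c)[(i : ℕ)] ≠ (coneOffPath H c)[(j : ℕ)] := by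
        rw [Ne, hn.getElem_inj_iff]
        omega
      have hd : 1 ≤ coneDist H S (coneOffPath H c)[(i : ℕ)] (coneOffPath H c)[(j : ℕ)] := by
        rw [Nat.one_le_iff_ne_zero]
        exact fun h0 => hne (eq_of_coneDist_eq_zero hS h0)
      have hd' : (1 : ℝ) ≤ coneDist H S (coneOffPath H c)[(i : ℕ)] (coneOffPath H c)[(j : ℕ)] := by
        exact_mod_cast hd
      have hjn : (j : ℝ) ≤ n := by exact_mod_cast (j.2.le.trans hlen)
      have hi0 : (0 : ℝ) ≤ (i : ℕ) := by positivity
      rw [conedOffDist_eq hS, inv_mul_le_iff₀ (by positivity)]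
      nlinarith
  intro i j
  dsimp only
  rcases le_total (i : ℕ) j with h | h
  · obtain ⟨h1, h2, h3⟩ := key i j h
    rw [abs_sub_comm, abs_of_nonneg h3]
    exact ⟨h1, h2⟩
  · obtain ⟨h1, h2, h3⟩ := key j i h
    rw [abs_of_nonneg h3, conedOffDist_eq hS, coneDist_comm hS, ← conedOffDist_eq hS]
    exact ⟨h1, h2⟩

/-! ### Fineness of the coned-off graph -/

lemma exists_split_of_not_pairwise {α : Type*} {R : α → α → Prop} {l : List α}
    (h : ¬ l.Pairwise R) : ∃ l₁ a l₂ b l₃, l = l₁ ++ a :: (l₂ ++ b :: l₃) ∧ ¬ R a b := by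
  induction l with
  | nil => simp at h
  | cons x l ih =>
    rw [List.pairwise_cons, not_and_or] at h
    rcases h with h | h
    · push Not at h
      obtain ⟨y, hy, hxy⟩ := h
      obtain ⟨l₂, l₃, rfl⟩ := List.append_of_mem hy
      exact ⟨[], x, l₂, y, l₃, rfl, hxy⟩
    · obtain ⟨l₁, a, l₂, b, l₃, rfl, hab⟩ := ih h
      exact ⟨x :: l₁, a, l₂, b, l₃, rfl, hab⟩

/-- Compare a path from `a` to `b` inside the coset `q` with the path given by the blocks. If both
are embedded after coning off, they are relative quasi-geodesics, and the second does not penetrate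
`q`, so bounded coset penetration bounds the distance. Splitting at visits to `q` and shortcutting
repeated cosets reduces to this case; the factor `L.length + 1` is additive under splitting. -/
lemma exists_dist_le_of_blocks (hS : Subgroup.closure S = ⊤)
    (hH : Subgroup.closure (S ∩ (H : Set G)) = H) (bcp : BoundedCosetPenetration H S) (n : ℕ) :
    ∃ ρ : ℕ, ∀ (q : G ⧸ H) (L : List (G × G)) (a b : G), L.length ≤ n →
      (a : G ⧸ H) = q → (b : G ⧸ H) = q →
      (∀ p ∈ L, (p.1 : G ⧸ H) = (p.2 : G ⧸ H) ∧ ((p.1 : G ⧸ H) = q → p.1 = p.2)) →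
      ((a, a) :: (L ++ [(b, b)])).IsChain (fun p p' => (mulCayley S).Adj p.2 p'.1) →
      (mulCayley S).dist a b ≤ (L.length + 1) * ρ := by
  -- There are at most `n + 2` blocks, counting the two ends, and each has at most three vertices in
  -- the coned-off graph.
  obtain ⟨r, hr⟩ := bcp (2 * (3 * (n + 2) : ℕ)) (by positivity)
  obtain ⟨ρ₀, hρ₀⟩ := exists_nat_ge r
  -- The summand `1` covers an empty chain, where `a` and `b` are joined by an edge.
  refine ⟨ρ₀ + 1, fun q L => ?_⟩
  induction hm : L.length using Nat.strong_induction_on generalizing L with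
  | _ m ih =>
  subst hm
  intro a b hn ha hb hL hc
  -- split at an interior block in the coset `q`
  by_cases h1 : ∃ p ∈ L, (p.1 : G ⧸ H) = q
  · obtain ⟨p, hp, hpq⟩ := h1
    have hpp := (hL p hp).2 hpq
    obtain ⟨L₁, L₂, rfl⟩ := List.append_of_mem hp
    obtain ⟨x, y⟩ := p
    obtain rfl : x = y := hpp
    have hc' : ((a, a) :: L₁ ++ (x, x) :: (L₂ ++ [(b, b)])).IsChain
        (fun p p' => (mulCayley S).Adj p.2 p'.1) := by simpa using hc
    rw [List.isChain_split] at hc'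
    simp only [List.length_append, List.length_cons] at hn ⊢
    have e₁ := ih L₁.length (by simp) L₁ rfl a x (by omega) ha hpq
      (fun p hp => hL p (by simp [hp])) (by simpa using hc'.1)
    have e₂ := ih L₂.length (by simp; omega) L₂ rfl x b (by omega) hpq hb
      (fun p hp => hL p (by simp [hp])) hc'.2
    have e₃ := (mulCayley_connected hS).dist_triangle (u := a) (v := x) (w := b)
    nlinarith
  push Not at h1
  -- shorten between two blocks in the same coset
  by_cases h2 : L.Pairwise fun p p' => (p.1 : G ⧸ H) ≠ (p'.1 : G ⧸ H)
  swap
  · obtain ⟨L₁, p, L₂, p', L₃, rfl, hpp⟩ := exists_split_of_not_pairwise h2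
    rw [not_not] at hpp
    have hc' : ((a, a) :: L₁ ++ p :: (L₂ ++ p' :: (L₃ ++ [(b, b)]))).IsChain
        (fun p p' => (mulCayley S).Adj p.2 p'.1) := by simpa using hc
    rw [List.isChain_split] at hc'
    have hc₂ : (p :: L₂ ++ p' :: (L₃ ++ [(b, b)])).IsChain
        (fun p p' => (mulCayley S).Adj p.2 p'.1) := by simpa using hc'.2
    rw [List.isChain_split] at hc₂
    -- A single block can cross the repeated coset, from the entry of the first visit to the exit of
    -- the second. That coset is not `q`, so the new block may be nontrivial.
    have hnew : ((a, a) :: L₁ ++ (p.1, p'.2) :: (L₃ ++ [(b, b)])).IsChain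
        (fun p p' => (mulCayley S).Adj p.2 p'.1) := by
      rw [List.isChain_split]
      constructor
      · have h := hc'.1
        rw [List.isChain_append] at h ⊢
        exact ⟨h.1, by simp, fun x hx y hy => by
          simp only [List.head?_cons, Option.mem_some_iff] at hy
          subst hy
          exact h.2.2 x hx p (by simp)⟩
      · have h := hc₂.2
        rw [List.isChain_cons] at h ⊢
        exact h
    have hp := hL p (by simp)
    have hp' := hL p' (by simp)
    have hpq := h1 p (by simp)
    simp only [List.length_append, List.length_cons] at hn ⊢
    have e := ih (L₁ ++ (p.1, p'.2) :: L₃).length (by simp) _ rfl a b (by simp; omega) ha hb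
      (fun x hx => by
        simp only [List.mem_append, List.mem_cons] at hx
        rcases hx with hx | rfl | hx
        · exact hL x (by simp [hx])
        · exact ⟨by simpa [hpp] using hp'.1, fun h => absurd h hpq⟩
        · exact hL x (by simp [hx])) (by simpa using hnew)
    refine e.trans (Nat.mul_le_mul_right _ ?_)
    simp only [List.length_append, List.length_cons]
    omega
  by_cases hab : a = b
  · subst hab; simp
  rcases L.eq_nil_or_concat with rfl | hne
  · simp only [List.nil_append, List.isChain_cons_cons, List.IsChain.singleton, and_true] at hc
    have : (mulCayley S).dist a b = 1 := dist_eq_one_iff_adj.2 hc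
    rw [this]
    simp
  have hne : L ≠ [] := by
    rintro rfl
    simp at hne
  have hblocks : ∀ p ∈ (a, a) :: (L ++ [(b, b)]), (p.1 : G ⧸ H) = (p.2 : G ⧸ H) := by
    intro p hp
    simp only [List.mem_cons, List.mem_append, List.not_mem_nil, or_false] at hp
    rcases hp with rfl | hp | rfl
    · rfl
    · exact (hL p hp).1
    · rfl
  have hdiff : ((a, a) :: (L ++ [(b, b)])).IsChain
      fun p p' => (p.1 : G ⧸ H) ≠ (p'.1 : G ⧸ H) := by
    rw [List.isChain_cons]
    constructor
    · intro y hy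
      have hy' : y ∈ L := by
        rw [List.head?_append_of_ne_nil _ hne] at hy
        exact List.mem_of_mem_head? hy
      exact fun h => h1 y hy' (h ▸ ha)
    · rw [List.isChain_append]
      refine ⟨h2.isChain, by simp, fun x hx y hy => ?_⟩
      simp only [List.head?_cons, Option.mem_some_iff] at hy
      subst hy
      exact fun h => h1 x (List.mem_of_mem_getLast? hx) (h.trans hb)
  obtain ⟨c₂, hc₂, hpen₂⟩ := exists_walk_of_blocks (S := S) hH (a, a) (L ++ [(b, b)]) hblocks hc
    hdiff (b := b) (by simp)
  have hblocks₁ : ∀ p ∈ [(a, b)], (p.1 : G ⧸ H) = (p.2 : G ⧸ H) := by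
    simp [ha, hb]
  obtain ⟨c₁, hc₁, hpen₁⟩ := exists_walk_of_blocks (S := S) hH (a, b) [] hblocks₁ (by simp)
    (by simp) (b := b) (by simp)
  have hq₁ : IsRelQuasiGeodesic H S (2 * (3 * (n + 2) : ℕ)) c₁.support := by
    refine isRelQuasiGeodesic_of_nodup hS ?_ ?_ ?_ (by omega)
    · rw [hc₁]
      exact isChain_flatMap_blockPath hblocks₁ (by simp)
    · rw [hc₁]
      simpa using nodup_blockPath (a, b)
    · rw [hc₁]
      have := length_blockPath_le (H := H) (a, b)
      simp only [List.flatMap_cons, List.flatMap_nil, List.append_nil]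
      omega
  have hq₂ : IsRelQuasiGeodesic H S (2 * (3 * (n + 2) : ℕ)) c₂.support := by
    refine isRelQuasiGeodesic_of_nodup hS ?_ ?_ ?_ (by omega)
    · rw [hc₂]
      exact isChain_flatMap_blockPath hblocks hc
    · rw [hc₂, List.nodup_flatMap]
      refine ⟨fun p _ => nodup_blockPath p, ?_⟩
      have hdisj : ∀ p p' : G × G, (p.1 : G ⧸ H) = p.2 → (p'.1 : G ⧸ H) = p'.2 →
          (p.1 : G ⧸ H) ≠ p'.1 → (blockPath H p).Disjoint (blockPath H p') := by
        intro p p' hp hp' hne v hv hv'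
        have key : ∀ p : G × G, (p.1 : G ⧸ H) = p.2 → ∀ v ∈ blockPath H p,
            Sum.elim (fun x : G => (x : G ⧸ H)) id v = p.1 := by
          intro p hp v hv
          unfold blockPath at hv
          split_ifs at hv
          · simp only [List.mem_singleton] at hv
            subst hv; rfl
          · simp only [List.mem_cons, List.not_mem_nil, or_false] at hv
            rcases hv with rfl | rfl | rfl
            · rfl
            · rfl
            · exact hp.symm
        exact hne ((key p hp v hv).symm.trans (key p' hp' v hv'))
      rw [List.pairwise_cons]
      constructor
      · intro p hp
        simp only [List.mem_append, List.mem_singleton] at hp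
        rcases hp with hp | rfl
        · exact hdisj _ _ rfl (hL p hp).1 (fun h => h1 p hp (h ▸ ha))
        -- The two end blocks share the coset `q`; they are disjoint because trivial blocks omit the
        -- cone vertex and `a ≠ b`.
        · simp [Function.onFun, blockPath, Ne.symm hab]
      · rw [List.pairwise_append]
        refine ⟨?_, by simp, ?_⟩
        · refine h2.imp_of_mem fun {p p'} hp hp' h => hdisj p p' (hL p hp).1 (hL p' hp').1 h
        · intro p hp p' hp'
          simp only [List.mem_singleton] at hp'
          subst hp'
          exact hdisj _ _ (hL p hp).1 rfl (fun h => h1 p hp (h.trans hb))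
    · rw [hc₂, List.length_flatMap]
      refine (List.sum_le_card_nsmul _ 3 ?_).trans ?_
      · intro k hk
        obtain ⟨p, -, rfl⟩ := List.mem_map.1 hk
        exact length_blockPath_le p
      · simp
        omega
  have hdist : (mulCayley S).dist a b ≤ ρ₀ := by
    by_contra hlt
    push Not at hlt
    have hlt' : r < ((mulCayley S).dist a b : ℝ) :=
      hρ₀.trans_lt (by exact_mod_cast hlt)
    obtain ⟨x', y', hx'⟩ := (hr a b c₁ c₂ hq₁ hq₂).1 q a b ((hpen₁ q a b).2 (by simp [hab, ha]))
      hlt'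
    obtain ⟨hmem, hxy, hxq⟩ := (hpen₂ q x' y').1 hx'
    simp only [List.mem_cons, List.mem_append, Prod.mk.injEq, List.not_mem_nil, or_false] at hmem
    rcases hmem with ⟨rfl, rfl⟩ | hmem | ⟨rfl, rfl⟩
    · exact hxy rfl
    · exact h1 _ hmem hxq
    · exact hxy rfl
  nlinarith

/-- A Cayley edge starts a new block, and a passage through a cone vertex is absorbed by enlarging
the first block of the remaining walk. Avoiding the cone vertex of `q` keeps the blocks in `q`
trivial. Separating the first block from `L` lets the induction modify it. -/
lemma exists_blocks_of_walk (q : G ⧸ H) (n : ℕ) : ∀ (a b : G)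
    (w : (conedOffGraph H S).Walk (.inl a) (.inl b)), w.length ≤ n → .inr q ∉ w.support →
    ∃ (c : G) (L : List (G × G)), L.length ≤ n ∧
      (∀ p ∈ (a, c) :: L, (p.1 : G ⧸ H) = (p.2 : G ⧸ H) ∧ ((p.1 : G ⧸ H) = q → p.1 = p.2)) ∧
      ((a, c) :: L).IsChain (fun p p' => (mulCayley S).Adj p.2 p'.1) ∧
      (((a, c) :: L).getLast (List.cons_ne_nil _ _)).2 = b := by
  induction n using Nat.strong_induction_on with
  | _ n ih =>
  intro a b w hw hq
  match w, hw, hq with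
  | .nil, _, _ => exact ⟨a, [], by simp, by simp, by simp, by simp⟩
  | .cons (v := .inl y) h p, hw, hq =>
    simp only [Walk.length_cons] at hw
    obtain ⟨c, L, h1, h2, h3, h4⟩ := ih (n - 1) (by omega) y b p (by omega)
      (fun hmem => hq (by simp [hmem]))
    refine ⟨a, (y, c) :: L, by simp; omega, ?_, ?_, by simpa using h4⟩
    · intro p hp
      rw [List.mem_cons] at hp
      rcases hp with rfl | hp
      · simp
      · exact h2 p hp
    · rw [List.isChain_cons_cons]
      exact ⟨h, h3⟩
  | .cons (v := .inr q') h (.cons (v := .inr q'') h' p), _, _ => exact h'.elim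
  | .cons (v := .inr q') h (.cons (v := .inl y) h' p), hw, hq =>
    simp only [Walk.length_cons] at hw
    obtain ⟨c, L, h1, h2, h3, h4⟩ := ih (n - 2) (by omega) y b p (by omega)
      (fun hmem => hq (by simp [hmem]))
    have hqq : q' ≠ q := by
      rintro rfl
      exact hq (by simp)
    have ha : (a : G ⧸ H) = q' := h
    have hy : (y : G ⧸ H) = q' := h'
    rw [List.isChain_cons] at h3
    refine ⟨c, L, by omega, ?_, List.isChain_cons.2 h3, ?_⟩
    · intro p hp
      rw [List.mem_cons] at hp
      rcases hp with rfl | hp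
      · have := (h2 (y, c) (by simp)).1
        exact ⟨by rw [ha, ← hy, this], fun h => absurd (ha.symm.trans h) hqq⟩
      · exact h2 p (by simp [hp])
    · cases L with
      | nil => simpa using h4
      | cons x L => simpa using h4

/-- The coned-off graph is fine: two elements of a coset that can be joined by a short path avoiding
the cone vertex of this coset are close to each other. -/
theorem exists_fineness_bound (hS : Subgroup.closure S = ⊤)
    (hH : Subgroup.closure (S ∩ (H : Set G)) = H) (bcp : BoundedCosetPenetration H S) (n : ℕ) :
    ∃ κ : ℕ, ∀ (q : G ⧸ H) (a b : G) (w : (conedOffGraph H S).Walk (.inl a) (.inl b)),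
      (a : G ⧸ H) = q → (b : G ⧸ H) = q → .inr q ∉ w.support → w.length ≤ n →
      (mulCayley S).dist a b ≤ κ := by
  obtain ⟨ρ, hρ⟩ := exists_dist_le_of_blocks hS hH bcp n
  refine ⟨(n + 1) * ρ, fun q a b w ha hb hq hw => ?_⟩
  obtain ⟨c, L, h1, h2, h3, h4⟩ := exists_blocks_of_walk q n a b w hw hq
  obtain rfl : a = c := (h2 (a, c) (by simp)).2 ha
  rcases L.eq_nil_or_concat with rfl | ⟨L', p, rfl⟩
  · obtain rfl : a = b := by simpa using h4
    simp
  · obtain ⟨x, y⟩ := p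
    obtain rfl : y = b := by simpa using h4
    have hxy := h2 (x, y) (by simp)
    obtain rfl : x = y := hxy.2 (hxy.1.trans hb)
    simp at h1
    refine (hρ q L' a x (by omega) ha hb (fun p hp => h2 p (by simp [hp])) (by simpa using h3)).trans
      (Nat.mul_le_mul_right _ (by omega))

end Fineness
end RelHyp
end

noncomputable section
namespace RelHyp

/-! ### Thin triangles and projections to cosets in the coned-off graph. -/

section Projections

open SimpleGraph

variable {G : Type u} [Group G] {H : Subgroup G} {S : Set G}

/-! ### Geodesics in the coned-off graph -/

/-- The vertex `p` lies on a geodesic of the coned-off graph from `u` to `w`. -/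
abbrev Between (H : Subgroup G) (S : Set G) (u p w : G ⊕ (G ⧸ H)) : Prop :=
  coneDist H S u p + coneDist H S p w = coneDist H S u w

/-- The element `a` of the coset `q` is the last vertex before the cone vertex of `q` on a geodesic
from `u`. -/
def IsProj (S : Set G) (q : G ⧸ H) (u : G ⊕ (G ⧸ H)) (a : G) : Prop :=
  (a : G ⧸ H) = q ∧ coneDist H S u (.inl a) + 1 = coneDist H S u (.inr q)

/-- There is a path with at most `n` edges from `u` to `v` avoiding the cone vertex of `q`. -/
def ReachAvoiding (S : Set G) (q : G ⧸ H) (n : ℕ) (u v : G ⊕ (G ⧸ H)) : Prop :=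
  ∃ w : (conedOffGraph H S).Walk u v, .inr q ∉ w.support ∧ w.length ≤ n

lemma ReachAvoiding.symm {q : G ⧸ H} {n : ℕ} {u v : G ⊕ (G ⧸ H)}
    (h : ReachAvoiding S q n u v) : ReachAvoiding S q n v u := by
  obtain ⟨w, h1, h2⟩ := h
  exact ⟨w.reverse, by simpa using h1, by simpa using h2⟩

lemma ReachAvoiding.trans {q : G ⧸ H} {n m : ℕ} {u v z : G ⊕ (G ⧸ H)}
    (h : ReachAvoiding S q n u v) (h' : ReachAvoiding S q m v z) :
    ReachAvoiding S q (n + m) u z := by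
  obtain ⟨w, h1, h2⟩ := h
  obtain ⟨w', h1', h2'⟩ := h'
  refine ⟨w.append w', ?_, by simp; omega⟩
  rw [Walk.mem_support_append_iff]
  tauto

lemma ReachAvoiding.mono {q : G ⧸ H} {n m : ℕ} {u v : G ⊕ (G ⧸ H)}
    (h : ReachAvoiding S q n u v) (hnm : n ≤ m) : ReachAvoiding S q m u v := by
  obtain ⟨w, h1, h2⟩ := h
  exact ⟨w, h1, h2.trans hnm⟩

lemma exists_geodesic_walk (hS : Subgroup.closure S = ⊤) (u v : G ⊕ (G ⧸ H)) :
    ∃ w : (conedOffGraph H S).Walk u v, w.length ≤ coneDist H S u v ∧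
      ∀ z ∈ w.support, Between H S u z v := by
  induction hn : coneDist H S u v using Nat.strong_induction_on generalizing u with
  | _ n ih =>
  by_cases huv : u = v
  · subst huv
    exact ⟨Walk.nil, by simp, by simp⟩
  obtain ⟨u', hadj, h1, h2⟩ := exists_step hS huv
  have h3 := one_le_edgeWeight u u'
  obtain ⟨w, hw, hz⟩ := ih (coneDist H S u' v) (by omega) u' rfl
  refine ⟨Walk.cons hadj w, by simp; omega, fun z hz' => ?_⟩
  rw [Walk.support_cons, List.mem_cons] at hz'
  rcases hz' with rfl | hz'
  · simp
  · have h4 := hz z hz'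
    have h5 := coneDist_triangle hS u u' z
    have h6 := coneDist_triangle hS u z v
    omega

lemma reachAvoiding_of_not_between (hS : Subgroup.closure S = ⊤) {q : G ⧸ H} {u v : G ⊕ (G ⧸ H)}
    (h : ¬ Between H S u (.inr q) v) {n : ℕ} (hn : coneDist H S u v ≤ n) :
    ReachAvoiding S q n u v := by
  obtain ⟨w, hw, hz⟩ := exists_geodesic_walk hS u v
  exact ⟨w, fun hmem => h (hz _ hmem), hw.trans hn⟩

/-- The tolerance of one is unavoidable: a Cayley edge has weight two and may jump over the level
`s`. -/
lemma exists_between_at (hS : Subgroup.closure S = ⊤) (u v : G ⊕ (G ⧸ H)) {s : ℕ}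
    (hs : s ≤ coneDist H S u v) :
    ∃ p, Between H S u p v ∧ s ≤ coneDist H S u p ∧ coneDist H S u p ≤ s + 1 := by
  induction s with
  | zero => exact ⟨u, by simp, by simp, by simp⟩
  | succ s ih =>
    obtain ⟨p, h1, h2, h3⟩ := ih (by omega)
    by_cases h : s + 1 ≤ coneDist H S u p
    · exact ⟨p, h1, h, by omega⟩
    have hpv : p ≠ v := by
      rintro rfl
      omega
    obtain ⟨p', hadj, h4, h5⟩ := exists_step hS hpv
    have h6 := one_le_edgeWeight p p'
    have h7 := edgeWeight_le_two p p'
    have h8 := coneDist_triangle hS u p p'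
    have h9 := coneDist_triangle hS u p' v
    exact ⟨p', by omega, by omega, by omega⟩

lemma coneDist_inl_inr (hS : Subgroup.closure S = ⊤) {a : G} {q : G ⧸ H} (h : (a : G ⧸ H) = q) :
    coneDist H S (.inl a) (.inr q) = 1 := by
  have h1 : coneDist H S (.inl a) (.inr q) ≤ 1 :=
    coneDist_adj_le (show (conedOffGraph H S).Adj (.inl a) (.inr q) from h)
  have h2 : coneDist H S (.inl a) (.inr q) ≠ 0 := fun h0 => by
    have := eq_of_coneDist_eq_zero hS h0
    simp at this
  omega

lemma exists_isProj (hS : Subgroup.closure S = ⊤) {q : G ⧸ H} {u : G ⊕ (G ⧸ H)}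
    (hu : u ≠ .inr q) : ∃ a, IsProj S q u a := by
  obtain ⟨v, hadj, h1, h2⟩ := exists_step hS hu.symm
  rcases v with a | q'
  · refine ⟨a, hadj, ?_⟩
    have h3 : edgeWeight (H := H) (.inr q) (.inl a) = 1 := rfl
    have h4 := coneDist_comm hS u (.inl a)
    have h5 := coneDist_comm hS u (.inr q)
    omega
  · exact hadj.elim

lemma IsProj.ne {q : G ⧸ H} {u : G ⊕ (G ⧸ H)} {a : G} (h : IsProj S q u a) : u ≠ .inr q := by
  rintro rfl
  have := h.2
  simp at this

lemma ne_of_not_between {u v : G ⊕ (G ⧸ H)} {q : G ⧸ H} (h : ¬ Between H S u (.inr q) v) :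
    u ≠ .inr q ∧ v ≠ .inr q := by
  constructor <;> rintro rfl <;> exact h (by simp)

/-! ### Thin triangles -/

/-- The four point inequality for the metric of the coned-off graph. -/
def FourPoint (H : Subgroup G) (S : Set G) (K : ℕ) : Prop :=
  ∀ w x y z : G ⊕ (G ⧸ H), coneDist H S x z + coneDist H S w y ≤
    max (coneDist H S x y + coneDist H S w z) (coneDist H S y z + coneDist H S w x) + K

/-- Two geodesics from `w` stay close up to the Gromov product of their ends, with slack `c`. One
use of the four point inequality bounds the distance from `p` to `v`, and a second one then bounds
that from `p` to `p'`. -/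
lemma FourPoint.fellow_travel (hS : Subgroup.closure S = ⊤) {K : ℕ} (h4 : FourPoint H S K)
    {u v w p p' : G ⊕ (G ⧸ H)} {c : ℕ} (hp : Between H S w p u) (hp' : Between H S w p' v)
    (h1 : coneDist H S w p ≤ coneDist H S w p' + 1) (h2 : coneDist H S w p' ≤ coneDist H S w p + 1)
    (h3 : 2 * coneDist H S w p + coneDist H S u v ≤ coneDist H S w u + coneDist H S w v + c) :
    coneDist H S p p' ≤ 2 * K + c + 1 := by
  have e₁ := h4 w p u v
  have e₂ := h4 w p v p'
  have e₃ := coneDist_comm hS v p'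
  omega

/-- Depending on which side of the centre of the comparison tripod `p` lies, it fellow-travels with
the side from `u` or with the side from `w`. -/
lemma FourPoint.slim (hS : Subgroup.closure S = ⊤) {K : ℕ} (h4 : FourPoint H S K)
    {u w p : G ⊕ (G ⧸ H)} (hp : Between H S u p w) (z : G ⊕ (G ⧸ H)) :
    ∃ p', (Between H S u p' z ∨ Between H S z p' w) ∧ coneDist H S p p' ≤ 2 * K + 1 := by
  have t₁ := coneDist_triangle hS u w z
  have t₂ := coneDist_triangle hS w u z
  have t₃ := coneDist_triangle hS u z w
  have c₁ := coneDist_comm hS u w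
  have c₂ := coneDist_comm hS z w
  have c₃ := coneDist_comm hS p w
  have c₄ := coneDist_comm hS p u
  by_cases h : 2 * coneDist H S u p + coneDist H S w z ≤ coneDist H S u w + coneDist H S u z
  · obtain ⟨p', h1, h2, h3⟩ := exists_between_at hS u z (s := coneDist H S u p) (by omega)
    exact ⟨p', Or.inl h1, h4.fellow_travel hS hp h1 (by omega) h3 (c := 0) (by omega)⟩
  · have c₅ := coneDist_comm hS u z
    obtain ⟨p', h1, h2, h3⟩ := exists_between_at hS w z (s := coneDist H S w p) (by omega)
    have c₆ := coneDist_comm hS p' w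
    have c₇ := coneDist_comm hS z p'
    refine ⟨p', Or.inr (by omega), ?_⟩
    exact h4.fellow_travel hS (w := w) (u := u) (by omega) h1 (by omega) h3 (c := 0) (by omega)

/-! ### Projections to cosets -/

/-- Walking from the projection `a` of `u` towards `u` avoids the cone vertex. -/
lemma IsProj.exists_toward (hS : Subgroup.closure S = ⊤) {q : G ⧸ H} {u : G ⊕ (G ⧸ H)} {a : G}
    (ha : IsProj S q u a) {L : ℕ} (hL : L ≤ coneDist H S (.inl a) u) :
    ∃ p, Between H S (.inr q) p u ∧ L + 1 ≤ coneDist H S (.inr q) p ∧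
      coneDist H S (.inr q) p ≤ L + 2 ∧ ReachAvoiding S q (L + 1) (.inl a) p := by
  obtain ⟨p, h1, h2, h3⟩ := exists_between_at hS (.inl a) u hL
  have e₁ := coneDist_inl_inr hS ha.1
  have e₂ := ha.2
  have e₃ := coneDist_comm hS u (.inl a)
  have e₄ := coneDist_comm hS u (.inr q)
  have e₅ := coneDist_comm hS (.inl a) (.inr q)
  have e₆ := coneDist_triangle hS (.inr q) (.inl a) p
  have e₇ := coneDist_triangle hS (.inr q) p u
  exact ⟨p, by omega, by omega, by omega, reachAvoiding_of_not_between hS (by omega) h3⟩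

/-- The path from a projection `a` of `u` to a centre `m` of the triangle `u`, `w`, `q` on a geodesic
from `u` to `w`. -/
lemma IsProj.reachAvoiding_center (hS : Subgroup.closure S = ⊤) {K : ℕ} (h4 : FourPoint H S K)
    {q : G ⧸ H} {u w m : G ⊕ (G ⧸ H)} {a : G} (ha : IsProj S q u a)
    (hq : ¬ Between H S u (.inr q) w) (hm : Between H S u m w)
    (h1 : 2 * coneDist H S u m + coneDist H S w (.inr q) ≤
      coneDist H S u (.inr q) + coneDist H S u w + 3)
    (h2 : coneDist H S u (.inr q) + coneDist H S u w ≤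
      2 * coneDist H S u m + coneDist H S w (.inr q) + 3)
    (h3 : coneDist H S u (.inr q) + coneDist H S w (.inr q) < coneDist H S u w + 4 * K + 20) :
    ReachAvoiding S q (8 * K + 60) (.inl a) m := by
  -- Otherwise the cone vertex would lie on a geodesic from `u` to `w`, contrary to `hq`.
  have hmid : ∀ p', Between H S u p' m → ¬ Between H S p' (.inr q) m := by
    intro p' hp' hb
    have t₁ := coneDist_triangle hS u p' (.inr q)
    have t₂ := coneDist_triangle hS (.inr q) m w
    have t₃ := coneDist_triangle hS u (.inr q) w
    omega
  have e₁ := ha.2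
  have e₂ := coneDist_comm hS u (.inl a)
  have e₃ := coneDist_comm hS w (.inr q)
  have e₄ := coneDist_comm hS u (.inr q)
  have e₅ := coneDist_comm hS w u
  have t₀ := coneDist_triangle hS u w (.inr q)
  have t₀' := coneDist_triangle hS u (.inr q) w
  by_cases hL : 2 * K + 12 ≤ coneDist H S (.inl a) u
  -- The detour goes from `a` towards `u` until it is at least `2 * K + 13` away from the cone
  -- vertex. It then jumps to the side from `u` to `w`, by a geodesic of length at most `2 * K + 1`
  -- that cannot reach the cone vertex, and follows that side to `m`. If `u` is closer than this,
  -- the other branch goes through `u` itself.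
  · obtain ⟨p, hp1, hp2, hp3, hp4⟩ := ha.exists_toward hS hL
    have e₆ := coneDist_comm hS u p
    have e₇ := coneDist_comm hS p (.inr q)
    obtain ⟨p', hp1', hp2', hp3'⟩ := exists_between_at hS u m (s := coneDist H S u p) (by omega)
    have t₁ := coneDist_triangle hS u p' w
    have t₂ := coneDist_triangle hS p' m w
    have hpp := h4.fellow_travel hS (w := u) (u := .inr q) (v := w) (p := p) (p' := p') (c := 0)
      (by omega) (by omega) (by omega) (by omega) (by omega)
    have r₁ : ReachAvoiding S q (2 * K + 1) p p' :=
      reachAvoiding_of_not_between hS (by omega) (by omega)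
    have r₂ : ReachAvoiding S q (2 * K + 20) p' m :=
      reachAvoiding_of_not_between hS (hmid p' hp1') (by omega)
    exact ((hp4.trans r₁).trans r₂).mono (by omega)
  · have r₁ : ReachAvoiding S q (2 * K + 12) (.inl a) u := by
      have e₆ := coneDist_comm hS (.inl a) (.inr q)
      have e₇ := coneDist_inl_inr hS ha.1
      exact reachAvoiding_of_not_between hS (by omega) (by omega)
    have r₂ : ReachAvoiding S q (2 * K + 20) u m :=
      reachAvoiding_of_not_between hS (hmid u (by simp)) (by omega)
    exact (r₁.trans r₂).mono (by omega)

/-- If the Gromov product of `u` and `w` at the cone vertex is small, both projections are connected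
to a common centre on the side from `u` to `w`. If it is large, the geodesics from the cone vertex
to `u` and `w` are still close at a distance from which a connecting geodesic cannot return to the
cone vertex. -/
lemma IsProj.reachAvoiding (hS : Subgroup.closure S = ⊤) {K : ℕ} (h4 : FourPoint H S K)
    {q : G ⧸ H} {u w : G ⊕ (G ⧸ H)} {a b : G} (ha : IsProj S q u a) (hb : IsProj S q w b)
    (hq : ¬ Between H S u (.inr q) w) : ReachAvoiding S q (16 * K + 120) (.inl a) (.inl b) := by
  have e₁ := ha.2
  have e₂ := coneDist_comm hS u (.inl a)
  have e₃ := coneDist_comm hS w (.inr q)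
  have e₄ := coneDist_comm hS u (.inr q)
  have e₅ := coneDist_comm hS w u
  have e₆ := hb.2
  have e₇ := coneDist_comm hS w (.inl b)
  have t₀ := coneDist_triangle hS u w (.inr q)
  have t₀' := coneDist_triangle hS w u (.inr q)
  by_cases h : coneDist H S u (.inr q) + coneDist H S w (.inr q) < coneDist H S u w + 4 * K + 20
  · obtain ⟨m, hm1, hm2, hm3⟩ := exists_between_at hS u w
      (s := (coneDist H S u (.inr q) + coneDist H S u w - coneDist H S w (.inr q)) / 2) (by omega)
    have e₈ := coneDist_comm hS u m
    have e₉ := coneDist_comm hS m w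
    have e₁₀ := coneDist_comm hS (.inr q) w
    have r₁ := ha.reachAvoiding_center hS h4 hq hm1 (by omega) (by omega) h
    have r₂ := hb.reachAvoiding_center hS h4 (w := u) (m := m) (by omega) (by omega) (by omega)
      (by omega) (by omega)
    exact (r₁.trans r₂.symm).mono (by omega)
  · obtain ⟨p, hp1, hp2, hp3, hp4⟩ := ha.exists_toward hS (L := 2 * K + 5) (by omega)
    obtain ⟨p', hp1', hp2', hp3', hp4'⟩ := hb.exists_toward hS (L := 2 * K + 5) (by omega)
    have hpp := h4.fellow_travel hS (c := 2) hp1 hp1' (by omega) (by omega) (by omega)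
    have e₈ := coneDist_comm hS p (.inr q)
    have r : ReachAvoiding S q (2 * K + 3) p p' :=
      reachAvoiding_of_not_between hS (by omega) (by omega)
    exact ((hp4.trans r).trans hp4'.symm).mono (by omega)

/-- Vertices joined by a geodesic that avoids a cone vertex have close projections. -/
theorem exists_proj_bound (hS : Subgroup.closure S = ⊤)
    (hH : Subgroup.closure (S ∩ (H : Set G)) = H) (bcp : BoundedCosetPenetration H S)
    {K : ℕ} (h4 : FourPoint H S K) :
    ∃ κ : ℕ, ∀ (q : G ⧸ H) (u w : G ⊕ (G ⧸ H)) (a b : G), IsProj S q u a → IsProj S q w b →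
      ¬ Between H S u (.inr q) w → (mulCayley S).dist a b ≤ κ := by
  obtain ⟨κ, hκ⟩ := exists_fineness_bound hS hH bcp (16 * K + 120)
  refine ⟨κ, fun q u w a b ha hb hq => ?_⟩
  obtain ⟨w', h1, h2⟩ := ha.reachAvoiding hS h4 hb hq
  exact hκ q a b w' ha.1 hb.1 h1 h2

end Projections
end RelHyp
end

noncomputable section
namespace RelHyp

/-! ### Guessing geodesics: a criterion for hyperbolicity of a graph -/

section Guessing

open SimpleGraph

variable {X : Type u} {Γ : SimpleGraph X}

/-- The vertices `α 0, …, α n` form a geodesic. -/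
def IsGeodesicSeq (Γ : SimpleGraph X) (α : ℕ → X) (n : ℕ) : Prop :=
  ∀ i j, i ≤ j → j ≤ n → Γ.dist (α i) (α j) + i = j

lemma exists_isGeodesicSeq (hΓ : Γ.Connected) (x y : X) :
    ∃ α : ℕ → X, IsGeodesicSeq Γ α (Γ.dist x y) ∧ α 0 = x ∧ α (Γ.dist x y) = y := by
  obtain ⟨w, hw⟩ := hΓ.exists_walk_length_eq_dist x y
  have hle : ∀ i j, i ≤ j → j ≤ w.length → Γ.dist (w.getVert i) (w.getVert j) + i ≤ j := by
    intro i j hij hj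
    induction j, hij using Nat.le_induction with
    | base => simp
    | succ j hij ih =>
      have h1 := ih (by omega)
      have h2 := dist_eq_one_iff_adj.2 (w.adj_getVert_succ (i := j) (by omega))
      have h3 := hΓ.dist_triangle (u := w.getVert i) (v := w.getVert j) (w := w.getVert (j + 1))
      omega
  refine ⟨w.getVert, fun i j hij hj => ?_, by simp, by rw [← hw]; simp⟩
  rw [← hw] at hj
  have h1 := hle i j hij hj
  have h2 := hle 0 i (by omega) (by omega)
  have h3 := hle j w.length hj le_rfl
  simp only [Walk.getVert_zero, Walk.getVert_length] at h2 h3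
  have h4 := hΓ.dist_triangle (u := x) (v := w.getVert i) (w := y)
  have h5 := hΓ.dist_triangle (u := w.getVert i) (v := w.getVert j) (w := y)
  omega

/-- The bootstrap in `guess_near_geodesic` needs this: `2 * h` pays for two uses of thinness, and
the logarithm for bisecting a window of length at most `4 * t + 4 * h + 2`. -/
lemma exists_logarithmic_bound (h : ℕ) :
    ∃ R : ℕ, ∀ t, R < t → 2 * h + h * (Nat.clog 2 (4 * t + 4 * h + 2) + 1) < t := by
  have hexp : ∀ c m : ℕ, 2 * c + 4 ≤ m → c * (m + 2) ≤ 2 ^ m := by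
    intro c m hm
    have hc : c < 2 ^ c := Nat.lt_two_pow_self
    induction m, hm using Nat.le_induction with
    | base =>
      have : 2 ^ (2 * c + 4) = 16 * (2 ^ c * 2 ^ c) := by ring
      rw [this]
      nlinarith
    | succ m hm ih =>
      have h1 : 2 ^ c ≤ 2 ^ m := Nat.pow_le_pow_right (by norm_num) (by omega)
      rw [pow_succ]
      nlinarith
  set c := 16 * (8 * h + 8) with hc
  refine ⟨(h + 1) * (2 * c + 9), fun t ht => ?_⟩
  set m := t / (h + 1) with hm
  have h1 : (h + 1) * m ≤ t := Nat.mul_div_le t (h + 1)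
  have h2 : t < (h + 1) * (m + 1) := Nat.lt_mul_div_succ t (Nat.succ_pos h)
  have h3 : 2 * c + 9 ≤ m := by
    rw [hm, Nat.le_div_iff_mul_le (Nat.succ_pos h)]
    nlinarith
  have h4 : 4 * t + 4 * h + 2 ≤ 2 ^ (m - 4) := by
    have h5 := hexp c m (le_trans (Nat.add_le_add_left (by norm_num) _) h3)
    have h6 : 2 ^ m = 2 ^ (m - 4) * 16 := by
      have h7 := pow_add 2 (m - 4) 4
      rwa [Nat.sub_add_cancel (le_trans (by omega) h3)] at h7
    rw [h6, hc] at h5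
    nlinarith
  have h7 : Nat.clog 2 (4 * t + 4 * h + 2) ≤ m - 4 := Nat.clog_le_of_le_pow h4
  have h8 : Nat.clog 2 (4 * t + 4 * h + 2) + 3 ≤ m - 1 := by omega
  have h9 : h * (Nat.clog 2 (4 * t + 4 * h + 2) + 3) ≤ h * (m - 1) := Nat.mul_le_mul_left h h8
  have h10 : h * (m - 1) + (m - 1) < t := by
    obtain ⟨m', hm'⟩ : ∃ m', m = m' + 1 := ⟨m - 1, by omega⟩
    rw [hm'] at h1 ⊢
    simp only [Nat.add_sub_cancel]
    nlinarith
  nlinarith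

variable {A : X → X → Set X} {h : ℕ}

/-- Repeated bisection costs `h` per level, hence logarithmically many steps in the length of the
geodesic. -/
lemma guess_near_path (hΓ : Γ.Connected)
    (hadj : ∀ x y, Γ.dist x y ≤ 1 → ∀ p ∈ A x y, Γ.dist p x ≤ h)
    (hthin : ∀ x y z, ∀ p ∈ A x y, ∃ p', (p' ∈ A x z ∨ p' ∈ A z y) ∧ Γ.dist p p' ≤ h)
    {α : ℕ → X} {n : ℕ} (hα : IsGeodesicSeq Γ α n) (k : ℕ) :
    ∀ i j, i ≤ j → j ≤ n → j ≤ i + 2 ^ k → ∀ p ∈ A (α i) (α j),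
      ∃ m, i ≤ m ∧ m ≤ j ∧ Γ.dist p (α m) ≤ h * (k + 1) := by
  induction k with
  | zero =>
    intro i j hij hj hk p hp
    have := hα i j hij hj
    exact ⟨i, le_rfl, hij, by simpa using hadj _ _ (by simp at hk; omega) p hp⟩
  | succ k ih =>
    intro i j hij hj hk p hp
    obtain ⟨p', hp', hd⟩ := hthin _ _ (α ((i + j) / 2)) p hp
    rw [pow_succ] at hk
    rcases hp' with hp' | hp'
    · obtain ⟨m, h1, h2, h3⟩ := ih i ((i + j) / 2) (by omega) (by omega) (by omega) p' hp'
      have := hΓ.dist_triangle (u := p) (v := p') (w := α m)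
      exact ⟨m, h1, by omega, by nlinarith⟩
    · obtain ⟨m, h1, h2, h3⟩ := ih ((i + j) / 2) j (by omega) (by omega) (by omega) p' hp'
      have := hΓ.dist_triangle (u := p) (v := p') (w := α m)
      exact ⟨m, by omega, h2, by nlinarith⟩

/-- The logarithmic bound from bisection depends on the length, but it is finite. As long as a
uniform bound `t` for all geodesics of length at most `n` exceeds `R`, it can be lowered by one, so
`R` itself is a bound independent of `n`. -/
lemma guess_near_geodesic (hΓ : Γ.Connected)
    (hadj : ∀ x y, Γ.dist x y ≤ 1 → ∀ p ∈ A x y, Γ.dist p x ≤ h)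
    (hthin : ∀ x y z, ∀ p ∈ A x y, ∃ p', (p' ∈ A x z ∨ p' ∈ A z y) ∧ Γ.dist p p' ≤ h) :
    ∃ R, ∀ (α : ℕ → X) (n : ℕ), IsGeodesicSeq Γ α n → ∀ p ∈ A (α 0) (α n),
      ∃ i ≤ n, Γ.dist p (α i) ≤ R := by
  obtain ⟨R, hR⟩ := exists_logarithmic_bound h
  refine ⟨R, fun α n hα => ?_⟩
  suffices hB : ∀ t, R ≤ t → ∀ (α : ℕ → X) (m : ℕ), m ≤ n → IsGeodesicSeq Γ α m →
      ∀ p ∈ A (α 0) (α m), ∃ i ≤ m, Γ.dist p (α i) ≤ t from hB R le_rfl α n le_rfl hα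
  have hbase : ∀ (α : ℕ → X) (m : ℕ), m ≤ n → IsGeodesicSeq Γ α m →
      ∀ p ∈ A (α 0) (α m), ∃ i ≤ m, Γ.dist p (α i) ≤ R + h * (Nat.clog 2 n + 1) := by
    intro α m hm hα p hp
    obtain ⟨i, -, h1, h2⟩ := guess_near_path hΓ hadj hthin hα (Nat.clog 2 n) 0 m (by omega) le_rfl
      (by have := Nat.le_pow_clog (b := 2) (by norm_num) n; omega) p hp
    exact ⟨i, h1, by omega⟩
  have hdesc : ∀ t, R < t → (∀ (α : ℕ → X) (m : ℕ), m ≤ n → IsGeodesicSeq Γ α m →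
      ∀ p ∈ A (α 0) (α m), ∃ i ≤ m, Γ.dist p (α i) ≤ t) →
      ∀ (α : ℕ → X) (m : ℕ), m ≤ n → IsGeodesicSeq Γ α m →
      ∀ p ∈ A (α 0) (α m), ∃ i ≤ m, Γ.dist p (α i) ≤ t - 1 := by
    intro t ht hB α m hm hα p hp
    have hft := hR t ht
    by_contra hcon
    push Not at hcon
    obtain ⟨i₀, hi₀, hd₀⟩ := hB α m hm hα p hp
    have hd₀' := Γ.dist_comm (u := p) (v := α i₀)
    -- This rules out the degenerate pieces, when the window is cut off by an end of the geodesic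
    -- and `p` would lie within `3 * h` of that end.
    have hlin : 3 * h < t := by nlinarith
    -- Cut the geodesic at distance `2 * t + 2 * h + 1` on both sides of `i₀`. A point within `2 *
    -- h` of `p` on an outer guessed path would be within `t` of the outer geodesic, putting a point
    -- there within `2 * t + 2 * h` of `α i₀`. So only the middle piece remains, and bisection there
    -- beats `t`.
    obtain ⟨p₁, hp₁, hd₁⟩ := hthin _ _ (α (i₀ - (2 * t + 2 * h + 1))) p hp
    rcases hp₁ with hp₁ | hp₁
    · obtain ⟨i, hi, hd⟩ := hB α (i₀ - (2 * t + 2 * h + 1)) (by omega)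
        (fun i j hij hj => hα i j hij (by omega)) p₁ hp₁
      by_cases h0 : i₀ ≤ 2 * t + 2 * h + 1
      · rw [Nat.sub_eq_zero_of_le h0] at hp₁
        have e₁ := hadj _ _ (by simp) p₁ hp₁
        have e₂ := hΓ.dist_triangle (u := p) (v := p₁) (w := α 0)
        have e₃ := hcon 0 (by omega)
        omega
      · have e₁ := hΓ.dist_triangle (u := p) (v := p₁) (w := α i)
        have e₂ := hΓ.dist_triangle (u := α i) (v := p) (w := α i₀)
        have e₃ := hα i i₀ (by omega) hi₀
        have e₄ := Γ.dist_comm (u := α i) (v := p)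
        omega
    · obtain ⟨p₂, hp₂, hd₂⟩ := hthin _ _ (α (min m (i₀ + (2 * t + 2 * h + 1)))) p₁ hp₁
      have e₀ := hΓ.dist_triangle (u := p) (v := p₁) (w := p₂)
      rcases hp₂ with hp₂ | hp₂
      · obtain ⟨i, hi₁, hi₂, hd⟩ := guess_near_path hΓ hadj hthin hα
          (Nat.clog 2 (4 * t + 4 * h + 2)) _ _ (by omega) (by omega)
          (by have := Nat.le_pow_clog (b := 2) (by norm_num) (4 * t + 4 * h + 2); omega) p₂ hp₂
        have e₁ := hΓ.dist_triangle (u := p) (v := p₂) (w := α i)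
        have e₂ := hcon i (by omega)
        omega
      · by_cases h0 : m ≤ i₀ + (2 * t + 2 * h + 1)
        · rw [min_eq_left h0] at hp₂
          have e₁ := hadj _ _ (by simp) p₂ hp₂
          have e₂ := hΓ.dist_triangle (u := p) (v := p₂) (w := α m)
          have e₃ := hcon m le_rfl
          omega
        · rw [min_eq_right (by omega)] at hp₂
          obtain ⟨i, hi, hd⟩ := hB (fun j => α (i₀ + (2 * t + 2 * h + 1) + j))
            (m - (i₀ + (2 * t + 2 * h + 1))) (by omega)
            (fun i j hij hj => by
              have := hα (i₀ + (2 * t + 2 * h + 1) + i) (i₀ + (2 * t + 2 * h + 1) + j)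
                (by omega) (by omega)
              dsimp only
              omega) p₂
            (by
              have : i₀ + (2 * t + 2 * h + 1) + (m - (i₀ + (2 * t + 2 * h + 1))) = m := by omega
              simpa [this] using hp₂)
          have e₁ := hΓ.dist_triangle (u := p) (v := p₂) (w := α (i₀ + (2 * t + 2 * h + 1) + i))
          have e₂ := hΓ.dist_triangle (u := α i₀) (v := p)
            (w := α (i₀ + (2 * t + 2 * h + 1) + i))
          have e₃ := hα i₀ (i₀ + (2 * t + 2 * h + 1) + i) (by omega) (by omega)
          omega
  have hall : ∀ d t, t + d = R + h * (Nat.clog 2 n + 1) → R ≤ t →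
      ∀ (α : ℕ → X) (m : ℕ), m ≤ n → IsGeodesicSeq Γ α m →
      ∀ p ∈ A (α 0) (α m), ∃ i ≤ m, Γ.dist p (α i) ≤ t := by
    intro d
    induction d with
    | zero =>
      intro t ht _
      simpa [← ht] using hbase
    | succ d ih =>
      intro t ht htR
      simpa using hdesc (t + 1) (by omega) (ih (t + 1) (by omega) (by omega))
  intro t ht α m hm hα p hp
  obtain ⟨i, hi, hd⟩ := hall _ R rfl le_rfl α m hm hα p hp
  exact ⟨i, hi, hd.trans ht⟩

/-- A discrete connectedness argument: along the chain from `x` to `z` every point is near one of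
the other two sides. Without a point near both, closeness to the side at `x` would persist up to
`z`, which lies on the other side. -/
lemma exists_guess_center (hΓ : Γ.Connected)
    (hthin : ∀ x y z, ∀ p ∈ A x y, ∃ p', (p' ∈ A x z ∨ p' ∈ A z y) ∧ Γ.dist p p' ≤ h)
    (hleft : ∀ x y, x ∈ A x y) (hright : ∀ x y, y ∈ A x y)
    (hchain : ∀ x y, Relation.ReflTransGen (fun a b => b ∈ A x y ∧ Γ.dist a b ≤ h) x y)
    (x y z : X) : ∃ p ∈ A x z, (∃ p₁ ∈ A x y, Γ.dist p p₁ ≤ 2 * h) ∧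
      ∃ p₂ ∈ A y z, Γ.dist p p₂ ≤ 2 * h := by
  by_contra hcon
  push Not at hcon
  have key : ∀ p, Relation.ReflTransGen (fun a b => b ∈ A x z ∧ Γ.dist a b ≤ h) x p →
      p ∈ A x z ∧ ∃ p₁ ∈ A x y, Γ.dist p p₁ ≤ h := by
    intro p hp
    induction hp with
    | refl => exact ⟨hleft x z, x, hleft x y, by simp⟩
    | @tail a b _ hab ih =>
      obtain ⟨ha, p₁, hp₁, hd₁⟩ := ih
      refine ⟨hab.1, ?_⟩
      obtain ⟨p', hp' | hp', hd⟩ := hthin x z y b hab.1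
      · exact ⟨p', hp', hd⟩
      · have e₁ := hcon a ha ⟨p₁, hp₁, by omega⟩ p' hp'
        have e₂ := hΓ.dist_triangle (u := a) (v := b) (w := p')
        omega
  obtain ⟨hz, p₁, hp₁, hd⟩ := key z (hchain x z)
  have := hcon z hz ⟨p₁, hp₁, by omega⟩ z (hright y z)
  simp at this

/-- A graph with a family of chains which form thin triangles and which are short between adjacent
vertices is hyperbolic. -/
theorem exists_fourPoint_of_guess (hΓ : Γ.Connected)
    (hadj : ∀ x y, Γ.dist x y ≤ 1 → ∀ p ∈ A x y, Γ.dist p x ≤ h)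
    (hthin : ∀ x y z, ∀ p ∈ A x y, ∃ p', (p' ∈ A x z ∨ p' ∈ A z y) ∧ Γ.dist p p' ≤ h)
    (hleft : ∀ x y, x ∈ A x y) (hright : ∀ x y, y ∈ A x y)
    (hchain : ∀ x y, Relation.ReflTransGen (fun a b => b ∈ A x y ∧ Γ.dist a b ≤ h) x y) :
    ∃ δ : ℕ, ∀ w x y z : X, Γ.dist x z + Γ.dist w y ≤
      max (Γ.dist x y + Γ.dist w z) (Γ.dist y z + Γ.dist w x) + δ := by
  obtain ⟨R, hR⟩ := guess_near_geodesic hΓ hadj hthin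
  have hnear : ∀ x y, ∀ p ∈ A x y, ∀ c, Γ.dist x c + Γ.dist c y ≤
      Γ.dist x y + 2 * (Γ.dist p c + R) := by
    intro x y p hp c
    obtain ⟨β, hβ, h0, hn⟩ := exists_isGeodesicSeq hΓ x y
    obtain ⟨i, hi, hd⟩ := hR β _ hβ p (by rwa [h0, hn])
    have e₁ := hβ 0 i (by omega) hi
    have e₂ := hβ i _ hi le_rfl
    rw [h0] at e₁
    rw [hn] at e₂
    have e₃ := hΓ.dist_triangle (u := x) (v := β i) (w := c)
    have e₄ := hΓ.dist_triangle (u := c) (v := β i) (w := y)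
    have e₅ := hΓ.dist_triangle (u := β i) (v := p) (w := c)
    have e₆ := Γ.dist_comm (u := β i) (v := p)
    have e₇ := Γ.dist_comm (u := β i) (v := c)
    omega
  have hcenter : ∀ x y z (α : ℕ → X), IsGeodesicSeq Γ α (Γ.dist x z) → α 0 = x →
      α (Γ.dist x z) = z → ∃ i ≤ Γ.dist x z,
        Γ.dist x (α i) + Γ.dist (α i) y ≤ Γ.dist x y + (4 * R + 4 * h) ∧
        Γ.dist y (α i) + Γ.dist (α i) z ≤ Γ.dist y z + (4 * R + 4 * h) := by
    intro x y z α hα h0 hn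
    obtain ⟨p, hp, ⟨p₁, hp₁, hd₁⟩, p₂, hp₂, hd₂⟩ :=
      exists_guess_center hΓ hthin hleft hright hchain x y z
    obtain ⟨i, hi, hd⟩ := hR α _ hα p (by rwa [h0, hn])
    have e₁ := hnear x y p₁ hp₁ (α i)
    have e₂ := hnear y z p₂ hp₂ (α i)
    have e₃ := hΓ.dist_triangle (u := p₁) (v := p) (w := α i)
    have e₄ := hΓ.dist_triangle (u := p₂) (v := p) (w := α i)
    have e₅ := Γ.dist_comm (u := p₁) (v := p)
    have e₆ := Γ.dist_comm (u := p₂) (v := p)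
    exact ⟨i, hi, by omega, by omega⟩
  refine ⟨8 * R + 8 * h, fun w x y z => ?_⟩
  obtain ⟨α, hα, h0, hn⟩ := exists_isGeodesicSeq hΓ x z
  obtain ⟨i, hi, a₁, a₂⟩ := hcenter x y z α hα h0 hn
  obtain ⟨j, hj, b₁, b₂⟩ := hcenter x w z α hα h0 hn
  have i₁ := hα 0 i (by omega) hi
  have i₂ := hα i _ hi le_rfl
  have j₁ := hα 0 j (by omega) hj
  have j₂ := hα j _ hj le_rfl
  rw [h0] at i₁ j₁
  rw [hn] at i₂ j₂
  have c₁ := Γ.dist_comm (u := α i) (v := y)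
  have c₂ := Γ.dist_comm (u := α j) (v := w)
  have c₃ := Γ.dist_comm (u := x) (v := w)
  have t₁ := hΓ.dist_triangle (u := w) (v := α j) (w := y)
  have t₂ := hΓ.dist_triangle (u := α j) (v := α i) (w := y)
  have c₄ := Γ.dist_comm (u := α i) (v := α j)
  -- On the geodesic from `x` to `z` the two centres determine a comparison tree, and their order
  -- decides which term of the maximum is used.
  rcases le_total i j with hij | hij
  · have := hα i j hij hj
    omega
  · have := hα j i hij hi
    omega

end Guessing
end RelHyp
end

noncomputable section
namespace RelHyp

/-! ### Coarse projections and combinatorial horoballs. -/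

section Cusped

open SimpleGraph

variable {G : Type u} [Group G] {H : Subgroup G} {S : Set G}

/-! ### Coarse projections -/

/-- The hypotheses on the coned-off graph that are used below: its metric is hyperbolic, and
vertices joined by a geodesic that avoids a cone vertex have close projections. -/
structure IsFineHyperbolic (H : Subgroup G) (S : Set G) (K κ : ℕ) : Prop where
  closure_eq : Subgroup.closure S = ⊤
  fourPoint : FourPoint H S K
  proj : ∀ (q : G ⧸ H) (u w : G ⊕ (G ⧸ H)) (a b : G), IsProj S q u a → IsProj S q w b →
      ¬ Between H S u (.inr q) w → (mulCayley S).dist a b ≤ κ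

open Classical in
/-- A chosen projection of the vertex `u` to the coset `q`. -/
def coneProj (S : Set G) (q : G ⧸ H) (u : G ⊕ (G ⧸ H)) : G :=
  if h : ∃ a, IsProj S q u a then h.choose else 1

lemma isProj_coneProj (hS : Subgroup.closure S = ⊤) {q : G ⧸ H} {u : G ⊕ (G ⧸ H)}
    (hu : u ≠ .inr q) : IsProj S q u (coneProj S q u) := by
  have h := exists_isProj hS hu
  rw [coneProj, dif_pos h]
  exact h.choose_spec

lemma between_comm (hS : Subgroup.closure S = ⊤) {u p w : G ⊕ (G ⧸ H)} :
    Between H S u p w ↔ Between H S w p u := by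
  have h1 := coneDist_comm hS u p
  have h2 := coneDist_comm hS p w
  have h3 := coneDist_comm hS u w
  constructor <;> intro h <;> omega

lemma one_le_coneDist (hS : Subgroup.closure S = ⊤) {u v : G ⊕ (G ⧸ H)} (h : u ≠ v) :
    1 ≤ coneDist H S u v := by
  rw [Nat.one_le_iff_ne_zero]
  exact fun h0 => h (eq_of_coneDist_eq_zero hS h0)

namespace IsFineHyperbolic

variable {K κ : ℕ}

lemma dist_coneProj_le (hF : IsFineHyperbolic H S K κ) {q : G ⧸ H} {u w : G ⊕ (G ⧸ H)}
    (h : ¬ Between H S u (.inr q) w) :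
    (mulCayley S).dist (coneProj S q u) (coneProj S q w) ≤ κ :=
  hF.proj q u w _ _ (isProj_coneProj hF.closure_eq (ne_of_not_between h).1)
    (isProj_coneProj hF.closure_eq (ne_of_not_between h).2) h

lemma dist_isProj_le (hF : IsFineHyperbolic H S K κ) {q : G ⧸ H} {u : G ⊕ (G ⧸ H)} {a : G}
    (h : IsProj S q u a) : (mulCayley S).dist a (coneProj S q u) ≤ κ := by
  refine hF.proj q u u _ _ h (isProj_coneProj hF.closure_eq h.ne) ?_
  intro hb
  have h1 := one_le_coneDist hF.closure_eq h.ne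
  have h2 := coneDist_self H S u
  omega

lemma dist_triangle (hF : IsFineHyperbolic H S K κ) (x y z : G) :
    (mulCayley S).dist x z ≤ (mulCayley S).dist x y + (mulCayley S).dist y z :=
  (mulCayley_connected hF.closure_eq).dist_triangle

/-- If the cone vertex of `q` lies on neither of the sides `u z` and `z w`, then a vertex of the
side `u w` and a vertex of another side have close projections. -/
lemma dist_coneProj_side_le (hF : IsFineHyperbolic H S K κ) {q : G ⧸ H}
    {u w z p' : G ⊕ (G ⧸ H)} {g : G} (hg : Between H S u (.inl g) w)
    (hp' : Between H S u p' z ∨ Between H S z p' w) (h1 : ¬ Between H S u (.inr q) z)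
    (h2 : ¬ Between H S z (.inr q) w) :
    (mulCayley S).dist (coneProj S q (.inl g)) (coneProj S q p') ≤ 3 * κ := by
  have hS := hF.closure_eq
  have key : ∀ u w : G ⊕ (G ⧸ H), Between H S u (.inl g) w → Between H S u p' z →
      ¬ Between H S u (.inr q) z → ¬ Between H S z (.inr q) w →
      (mulCayley S).dist (coneProj S q (.inl g)) (coneProj S q p') ≤ 3 * κ := by
    intro u w hg hp' h1 h2
    have t₁ := coneDist_triangle hS u (.inr q) z
    have hup : ¬ Between H S u (.inr q) p' := fun hb => by
      have := coneDist_triangle hS (.inr q) p' z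
      omega
    have hpz : ¬ Between H S p' (.inr q) z := fun hb => by
      have := coneDist_triangle hS u p' (.inr q)
      omega
    -- The projection to `q` is coarsely constant along stretches that avoid the cone vertex. If the
    -- stretch from `u` to `g` meets it, the one from `g` to `w` does not, and the comparison goes
    -- around through `w` and `z`.
    by_cases hug : Between H S u (.inr q) (.inl g)
    · have hgw : ¬ Between H S (.inl g) (.inr q) w := fun hb => by
        have t₂ := coneDist_triangle hS u (.inr q) w
        have t₃ := one_le_coneDist (H := H) (S := S) hS (u := .inl g) (v := .inr q) (by simp)
        have t₄ := coneDist_comm hS (.inl g) (.inr q)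
        omega
      have d₁ := hF.dist_coneProj_le hgw
      have d₂ := hF.dist_coneProj_le h2
      have d₃ := hF.dist_coneProj_le hpz
      have d₄ := hF.dist_triangle (coneProj S q (.inl g)) (coneProj S q w) (coneProj S q z)
      have d₅ := hF.dist_triangle (coneProj S q (.inl g)) (coneProj S q z) (coneProj S q p')
      have d₆ := (mulCayley S).dist_comm (u := coneProj S q w) (v := coneProj S q z)
      have d₇ := (mulCayley S).dist_comm (u := coneProj S q p') (v := coneProj S q z)
      omega
    · have d₁ := hF.dist_coneProj_le hug
      have d₂ := hF.dist_coneProj_le hup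
      have d₃ := hF.dist_triangle (coneProj S q (.inl g)) (coneProj S q u) (coneProj S q p')
      have d₄ := (mulCayley S).dist_comm (u := coneProj S q (.inl g)) (v := coneProj S q u)
      omega
  rcases hp' with hp' | hp'
  · exact key u w hg hp' h1 h2
  · exact key w u ((between_comm hS).1 hg) ((between_comm hS).1 hp')
      (fun h => h2 ((between_comm hS).1 h)) (fun h => h1 ((between_comm hS).1 h))

/-- If the cone vertex of `q` lies on the side `u z`, then a vertex of the side `u w` has the
same projection to `q`, up to bounded error, as one of the vertices of the triangle. -/
lemma dist_coneProj_vertex_le (hF : IsFineHyperbolic H S K κ) {q : G ⧸ H}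
    {u w z : G ⊕ (G ⧸ H)} {g : G} (hg : Between H S u (.inl g) w) :
    (u ≠ .inr q ∧ (mulCayley S).dist (coneProj S q (.inl g)) (coneProj S q u) ≤ 2 * κ) ∨
    (z ≠ .inr q ∧ (mulCayley S).dist (coneProj S q (.inl g)) (coneProj S q z) ≤ 2 * κ) ∨
    (Between H S z (.inr q) w ∧ w ≠ .inr q ∧
      (mulCayley S).dist (coneProj S q (.inl g)) (coneProj S q w) ≤ 2 * κ) := by
  have hS := hF.closure_eq
  by_cases hug : Between H S u (.inr q) (.inl g)
  swap
  · left
    have d₁ := hF.dist_coneProj_le hug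
    have d₂ := (mulCayley S).dist_comm (u := coneProj S q (.inl g)) (v := coneProj S q u)
    exact ⟨(ne_of_not_between hug).1, by omega⟩
  have hgw : ¬ Between H S (.inl g) (.inr q) w := fun hb => by
    have t₂ := coneDist_triangle hS u (.inr q) w
    have t₃ := one_le_coneDist (H := H) (S := S) hS (u := .inl g) (v := .inr q) (by simp)
    have t₄ := coneDist_comm hS (.inl g) (.inr q)
    omega
  have d₁ := hF.dist_coneProj_le hgw
  by_cases hzw : Between H S z (.inr q) w
  · exact Or.inr (Or.inr ⟨hzw, (ne_of_not_between hgw).2, by omega⟩)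
  · have d₂ := hF.dist_coneProj_le hzw
    have d₃ := hF.dist_triangle (coneProj S q (.inl g)) (coneProj S q w) (coneProj S q z)
    have d₄ := (mulCayley S).dist_comm (u := coneProj S q w) (v := coneProj S q z)
    exact Or.inr (Or.inl ⟨(ne_of_not_between hzw).1, by omega⟩)

end IsFineHyperbolic

/-! ### The cusped graph -/

/-- The cusped graph: the Cayley graph of `G` at level `0`, with a combinatorial horoball attached to
each left coset of `H`. -/
def cuspedGraph (H : Subgroup G) (S : Set G) : SimpleGraph (G × ℕ) where
  Adj ξ η := (ξ.2 = 0 ∧ η.2 = 0 ∧ (mulCayley S).Adj ξ.1 η.1) ∨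
    (ξ.1 = η.1 ∧ (ξ.2 + 1 = η.2 ∨ η.2 + 1 = ξ.2)) ∨
    (ξ.2 = η.2 ∧ ξ.1 ≠ η.1 ∧ (ξ.1 : G ⧸ H) = (η.1 : G ⧸ H) ∧
      (mulCayley S).dist ξ.1 η.1 ≤ 2 ^ ξ.2)
  symm := ⟨by
    rintro ⟨x, i⟩ ⟨y, j⟩ (⟨h1, h2, h3⟩ | ⟨h1, h2⟩ | ⟨h1, h2, h3, h4⟩)
    · exact Or.inl ⟨h2, h1, h3.symm⟩
    · exact Or.inr (Or.inl ⟨h1.symm, h2.symm⟩)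
    · refine Or.inr (Or.inr ⟨h1.symm, Ne.symm h2, h3.symm, ?_⟩)
      simp only at h1
      subst h1
      rwa [SimpleGraph.dist_comm]⟩
  loopless := ⟨by
    rintro ⟨x, i⟩ (⟨-, -, h⟩ | ⟨-, h⟩ | ⟨-, h, -⟩)
    · exact h.ne rfl
    · rcases h with h | h <;> simp at h
    · exact h rfl⟩

lemma cuspedGraph_connected (H : Subgroup G) (hS : Subgroup.closure S = ⊤) :
    (cuspedGraph H S).Connected := by
  have h1 : ∀ x y : G, (cuspedGraph H S).Reachable (x, 0) (y, 0) := fun x y =>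
    ((mulCayley_connected hS).preconnected x y).map
      (⟨fun g => (g, 0), fun h => Or.inl ⟨rfl, rfl, h⟩⟩ : mulCayley S →g cuspedGraph H S)
  have h2 : ∀ (x : G) (i : ℕ), (cuspedGraph H S).Reachable (x, 0) (x, i) := by
    intro x i
    induction i with
    | zero => rfl
    | succ i ih =>
      exact ih.trans (Adj.reachable (Or.inr (Or.inl ⟨rfl, Or.inl rfl⟩)))
  have : Nonempty (G × ℕ) := ⟨(1, 0)⟩
  refine ⟨?_⟩
  rintro ⟨x, i⟩ ⟨y, j⟩
  exact ((h2 x i).symm.trans (h1 x y)).trans (h2 y j)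

lemma cuspedGraph_dist_le_one {ξ η : G × ℕ} (h : (cuspedGraph H S).Adj ξ η) :
    (cuspedGraph H S).dist ξ η ≤ 1 :=
  (dist_eq_one_iff_adj.2 h).le

lemma cusped_dist_vertical (hS : Subgroup.closure S = ⊤) (x : G) (i k : ℕ) :
    (cuspedGraph H S).dist (x, i) (x, i + k) ≤ k := by
  induction k with
  | zero => simp
  | succ k ih =>
    have h1 := (cuspedGraph_connected H hS).dist_triangle (u := (x, i)) (v := (x, i + k))
      (w := (x, i + (k + 1)))
    have h2 : (cuspedGraph H S).dist (x, i + k) (x, i + (k + 1)) ≤ 1 :=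
      cuspedGraph_dist_le_one (Or.inr (Or.inl ⟨rfl, Or.inl (by simp; omega)⟩))
    omega

lemma cusped_dist_horizontal {x y : G} (hxy : (x : G ⧸ H) = (y : G ⧸ H)) {i : ℕ}
    (h : (mulCayley S).dist x y ≤ 2 ^ i) : (cuspedGraph H S).dist (x, i) (y, i) ≤ 1 := by
  by_cases hne : x = y
  · subst hne; simp
  · exact cuspedGraph_dist_le_one (Or.inr (Or.inr ⟨rfl, hne, hxy, h⟩))

lemma cusped_dist_coset (hS : Subgroup.closure S = ⊤) {x y : G}
    (hxy : (x : G ⧸ H) = (y : G ⧸ H)) {r : ℕ} (h : (mulCayley S).dist x y ≤ r) :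
    (cuspedGraph H S).dist (x, 0) (y, 0) ≤ 2 * r + 1 := by
  have h1 := cusped_dist_vertical (H := H) hS x 0 r
  have h2 := cusped_dist_vertical (H := H) hS y 0 r
  have h3 := cusped_dist_horizontal (S := S) hxy (i := r) (h.trans Nat.lt_two_pow_self.le)
  rw [zero_add] at h1 h2
  have h4 := (cuspedGraph_connected H hS).dist_triangle (u := (x, 0)) (v := (x, r)) (w := (y, 0))
  have h5 := (cuspedGraph_connected H hS).dist_triangle (u := (x, r)) (v := (y, r)) (w := (y, 0))
  have h6 := (cuspedGraph H S).dist_comm (u := (y, r)) (v := (y, 0))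
  omega

/-! ### Paths in horoballs -/

/-- The top level of the standard path in a horoball. -/
def hatHeight (S : Set G) (ξ η : G × ℕ) : ℕ :=
  max (max ξ.2 η.2) (Nat.clog 2 ((mulCayley S).dist ξ.1 η.1))

/-- The vertices of the standard path in a horoball: up, across, and down. -/
def horoPath (S : Set G) (ξ η : G × ℕ) : Set (G × ℕ) :=
  {p | (p.1 = ξ.1 ∧ ξ.2 ≤ p.2 ∧ p.2 ≤ hatHeight S ξ η) ∨
    (p.1 = η.1 ∧ η.2 ≤ p.2 ∧ p.2 ≤ hatHeight S ξ η)}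

lemma hatHeight_comm (ξ η : G × ℕ) : hatHeight S ξ η = hatHeight S η ξ := by
  rw [hatHeight, hatHeight, max_comm ξ.2, SimpleGraph.dist_comm]

lemma horoPath_comm (ξ η : G × ℕ) : horoPath S ξ η = horoPath S η ξ := by
  ext p
  simp only [horoPath, Set.mem_ofPred_eq, hatHeight_comm ξ η]
  exact or_comm

lemma left_mem_horoPath (ξ η : G × ℕ) : ξ ∈ horoPath S ξ η :=
  Or.inl ⟨rfl, le_rfl, by simp [hatHeight]⟩

lemma right_mem_horoPath (ξ η : G × ℕ) : η ∈ horoPath S ξ η :=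
  Or.inr ⟨rfl, le_rfl, by simp [hatHeight]⟩

lemma dist_le_two_pow (x y : G) {i : ℕ} (h : Nat.clog 2 ((mulCayley S).dist x y) ≤ i) :
    (mulCayley S).dist x y ≤ 2 ^ i :=
  (Nat.le_pow_clog (by norm_num) _).trans (Nat.pow_le_pow_right (by norm_num) h)

/-- The triangle inequality at most doubles a distance bounded by `2 ^ M`, which costs one level. -/
lemma hatHeight_le (hS : Subgroup.closure S = ⊤) (ξ η ζ : G × ℕ) :
    hatHeight S ξ η ≤ max (hatHeight S ξ ζ) (hatHeight S ζ η) + 1 := by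
  set M := max (hatHeight S ξ ζ) (hatHeight S ζ η) with hM
  have h1 : hatHeight S ξ ζ ≤ M := le_max_left _ _
  have h2 : hatHeight S ζ η ≤ M := le_max_right _ _
  simp only [hatHeight] at h1 h2
  have h3 : (mulCayley S).dist ξ.1 ζ.1 ≤ 2 ^ M := dist_le_two_pow _ _ (by omega)
  have h4 : (mulCayley S).dist ζ.1 η.1 ≤ 2 ^ M := dist_le_two_pow _ _ (by omega)
  have h5 := (mulCayley_connected hS).dist_triangle (u := ξ.1) (v := ζ.1) (w := η.1)
  have h6 : Nat.clog 2 ((mulCayley S).dist ξ.1 η.1) ≤ M + 1 := by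
    refine Nat.clog_le_of_le_pow ?_
    rw [pow_succ]
    omega
  simp only [hatHeight]
  omega

/-- A point in the column of `ξ` above the path to `ζ` is high enough for a horizontal edge to the
column of `ζ`. By `hatHeight_le` it is at most one level above the higher of the other two paths. -/
lemma horoPath_thin (hS : Subgroup.closure S = ⊤) {ξ η ζ : G × ℕ}
    (h1 : (ξ.1 : G ⧸ H) = (ζ.1 : G ⧸ H)) (h2 : (ζ.1 : G ⧸ H) = (η.1 : G ⧸ H)) {p : G × ℕ}
    (hp : p ∈ horoPath S ξ η) :
    ∃ p', (p' ∈ horoPath S ξ ζ ∨ p' ∈ horoPath S ζ η) ∧ (cuspedGraph H S).dist p p' ≤ 2 := by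
  have key : ∀ ξ η : G × ℕ, (ξ.1 : G ⧸ H) = (ζ.1 : G ⧸ H) →
      ∀ k, ξ.2 ≤ k → k ≤ hatHeight S ξ η → ∃ p', (p' ∈ horoPath S ξ ζ ∨ p' ∈ horoPath S ζ η) ∧
        (cuspedGraph H S).dist (ξ.1, k) p' ≤ 2 := by
    intro ξ η h1 k hk hk'
    by_cases hle : k ≤ hatHeight S ξ ζ
    · exact ⟨(ξ.1, k), Or.inl (Or.inl ⟨rfl, hk, hle⟩), by simp⟩
    have h3 := hatHeight_le hS ξ η ζ
    have h4 : ζ.2 ≤ hatHeight S ζ η := by simp [hatHeight]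
    have h5 : ζ.2 ≤ hatHeight S ξ ζ := by simp [hatHeight]
    have h6 : (cuspedGraph H S).dist (ξ.1, k) (ζ.1, k) ≤ 1 :=
      cusped_dist_horizontal h1 (dist_le_two_pow _ _ (by simp only [hatHeight] at hle; omega))
    by_cases hle' : k ≤ hatHeight S ζ η
    · exact ⟨(ζ.1, k), Or.inr (Or.inl ⟨rfl, by simp only; omega, hle'⟩), by omega⟩
    by_cases hmax : hatHeight S ζ η ≤ hatHeight S ξ ζ
    · refine ⟨(ξ.1, k - 1), Or.inl (Or.inl ⟨rfl, ?_, by simp only; omega⟩), ?_⟩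
      · have : ξ.2 ≤ hatHeight S ξ ζ := by simp [hatHeight]
        simp only
        omega
      · have h7 := cusped_dist_vertical (H := H) hS ξ.1 (k - 1) 1
        rw [Nat.sub_add_cancel (by omega), SimpleGraph.dist_comm] at h7
        omega
    · refine ⟨(ζ.1, k - 1), Or.inr (Or.inl ⟨rfl, by simp only; omega, by simp only; omega⟩), ?_⟩
      have h7 := cusped_dist_vertical (H := H) hS ζ.1 (k - 1) 1
      rw [Nat.sub_add_cancel (by omega), SimpleGraph.dist_comm] at h7
      have := (cuspedGraph_connected H hS).dist_triangle (u := (ξ.1, k)) (v := (ζ.1, k))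
        (w := (ζ.1, k - 1))
      omega
  obtain ⟨x, k⟩ := p
  rcases hp with ⟨rfl, hk, hk'⟩ | ⟨rfl, hk, hk'⟩
  · exact key ξ η h1 k hk hk'
  · rw [hatHeight_comm] at hk'
    obtain ⟨p', hp', hd⟩ := key η ξ h2.symm k hk hk'
    rw [horoPath_comm η ζ, horoPath_comm ζ ξ] at hp'
    exact ⟨p', hp'.symm, hd⟩

lemma horoPath_small (hS : Subgroup.closure S = ⊤) {x y : G} (hxy : (x : G ⧸ H) = (y : G ⧸ H))
    {r : ℕ} (h : (mulCayley S).dist x y ≤ r) {p : G × ℕ} (hp : p ∈ horoPath S (x, 0) (y, 0)) :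
    (cuspedGraph H S).dist p (x, 0) ≤ 3 * r + 1 ∧ (cuspedGraph H S).dist p (y, 0) ≤ 3 * r + 1 := by
  have key : ∀ x y : G, (x : G ⧸ H) = (y : G ⧸ H) → (mulCayley S).dist x y ≤ r → ∀ k,
      k ≤ hatHeight S (x, 0) (y, 0) → (cuspedGraph H S).dist (x, k) (x, 0) ≤ r ∧
        (cuspedGraph H S).dist (x, k) (y, 0) ≤ 3 * r + 1 := by
    intro x y hxy h k hk
    have hr : k ≤ r := by
      simp only [hatHeight, max_self, zero_le, max_eq_right] at hk
      exact hk.trans (Nat.clog_le_of_le_pow (h.trans Nat.lt_two_pow_self.le))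
    have h1 := cusped_dist_vertical (H := H) hS x 0 k
    rw [zero_add, SimpleGraph.dist_comm] at h1
    have h2 := cusped_dist_coset hS hxy h
    have h3 := (cuspedGraph_connected H hS).dist_triangle (u := (x, k)) (v := (x, 0))
      (w := (y, 0))
    omega
  obtain ⟨g, k⟩ := p
  rcases hp with ⟨h0, -, hk'⟩ | ⟨h0, -, hk'⟩ <;> simp only at h0 hk'
  · obtain ⟨h1, h2⟩ := key x y hxy h k hk'
    rw [h0]
    exact ⟨by omega, h2⟩
  · rw [hatHeight_comm] at hk'
    obtain ⟨h1, h2⟩ := key y x hxy.symm (by rwa [SimpleGraph.dist_comm]) k hk'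
    rw [h0]
    exact ⟨h2, by omega⟩

lemma horoPath_chain (hS : Subgroup.closure S = ⊤) {ξ η : G × ℕ}
    (h : (ξ.1 : G ⧸ H) = (η.1 : G ⧸ H)) :
    Relation.ReflTransGen (fun a b => b ∈ horoPath S ξ η ∧ (cuspedGraph H S).dist a b ≤ 1) ξ η := by
  have hup : ∀ k, ξ.2 + k ≤ hatHeight S ξ η → Relation.ReflTransGen
      (fun a b => b ∈ horoPath S ξ η ∧ (cuspedGraph H S).dist a b ≤ 1) ξ (ξ.1, ξ.2 + k) := by
    intro k
    induction k with
    | zero => intro _; exact .refl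
    | succ k ih =>
      intro hk
      exact (ih (by omega)).tail ⟨Or.inl ⟨rfl, by simp, hk⟩,
        cusped_dist_vertical hS ξ.1 (ξ.2 + k) 1⟩
  have hdown : ∀ k, η.2 + k ≤ hatHeight S ξ η → Relation.ReflTransGen
      (fun a b => b ∈ horoPath S ξ η ∧ (cuspedGraph H S).dist a b ≤ 1) (η.1, η.2 + k) η := by
    intro k
    induction k with
    | zero => intro _; exact .refl
    | succ k ih =>
      intro hk
      refine Relation.ReflTransGen.head (b := (η.1, η.2 + k)) ⟨Or.inr ⟨rfl, ?_, ?_⟩, ?_⟩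
        (ih (by omega))
      · simp
      · simp only; omega
      · rw [SimpleGraph.dist_comm]
        exact cusped_dist_vertical hS η.1 (η.2 + k) 1
  have h1 : ξ.2 ≤ hatHeight S ξ η := by simp [hatHeight]
  have h2 : η.2 ≤ hatHeight S ξ η := by simp [hatHeight]
  have h3 := hup (hatHeight S ξ η - ξ.2) (by omega)
  have h4 := hdown (hatHeight S ξ η - η.2) (by omega)
  rw [Nat.add_sub_cancel' h1] at h3
  rw [Nat.add_sub_cancel' h2] at h4
  refine (h3.tail (c := (η.1, hatHeight S ξ η)) ⟨Or.inr ⟨rfl, h2, le_rfl⟩, ?_⟩).trans h4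
  exact cusped_dist_horizontal h (dist_le_two_pow _ _ (by simp [hatHeight]))

end Cusped
end RelHyp
end

noncomputable section
namespace RelHyp

/-! ### Hyperbolicity of the cusped graph. -/

section CuspedHyperbolic

open SimpleGraph

variable {G : Type u} [Group G] {H : Subgroup G} {S : Set G}

/-! ### Guessed paths in the cusped graph -/

open Classical in
/-- The projection of a vertex of the cusped graph to the horoball of the coset `q`. -/
def horoProj (S : Set G) (q : G ⧸ H) (ξ : G × ℕ) : G × ℕ :=
  if (ξ.1 : G ⧸ H) = q then ξ else (coneProj S q (.inr (ξ.1 : G ⧸ H)), 0)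

/-- The vertices of all lifts to the cusped graph of the geodesics between two cone vertices. -/
def guess (H : Subgroup G) (S : Set G) (ξ η : G × ℕ) : Set (G × ℕ) :=
  {p | (p.2 = 0 ∧ Between H S (.inr (ξ.1 : G ⧸ H)) (.inl p.1) (.inr (η.1 : G ⧸ H))) ∨
    ∃ q : G ⧸ H, Between H S (.inr (ξ.1 : G ⧸ H)) (.inr q) (.inr (η.1 : G ⧸ H)) ∧
      p ∈ horoPath S (horoProj S q ξ) (horoProj S q η)}

lemma guess_comm (hS : Subgroup.closure S = ⊤) (ξ η : G × ℕ) :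
    guess H S ξ η = guess H S η ξ := by
  ext p
  simp only [guess, Set.mem_ofPred_eq, between_comm hS (u := .inr (ξ.1 : G ⧸ H)),
    horoPath_comm (horoProj S _ ξ)]

lemma horoProj_self (ξ : G × ℕ) : horoProj S (ξ.1 : G ⧸ H) ξ = ξ := by simp [horoProj]

lemma horoProj_of_ne {q : G ⧸ H} {ξ : G × ℕ}
    (h : (.inr (ξ.1 : G ⧸ H) : G ⊕ (G ⧸ H)) ≠ .inr q) :
    horoProj S q ξ = (coneProj S q (.inr (ξ.1 : G ⧸ H)), 0) := by
  rw [horoProj, if_neg]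
  rintro rfl
  exact h rfl

lemma mk_horoProj (hS : Subgroup.closure S = ⊤) (q : G ⧸ H) (ξ : G × ℕ) :
    ((horoProj S q ξ).1 : G ⧸ H) = q := by
  rw [horoProj]
  split_ifs with h
  · exact h
  · refine (isProj_coneProj hS ?_).1
    simpa using h

lemma left_mem_guess (ξ η : G × ℕ) : ξ ∈ guess H S ξ η := by
  refine Or.inr ⟨ξ.1, by simp, ?_⟩
  have h := left_mem_horoPath (S := S) (horoProj S (ξ.1 : G ⧸ H) ξ) (horoProj S (ξ.1 : G ⧸ H) η)
  rwa [horoProj_self ξ] at h ⊢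

namespace IsFineHyperbolic

variable {K κ : ℕ}

/-- Elements at bounded distance in the coned-off graph whose projections to the cosets between
them are close have bounded distance in the cusped graph. -/
lemma cusped_dist_le (hF : IsFineHyperbolic H S K κ) {R : ℕ} {g e : G}
    (hR : ∀ q : G ⧸ H, Between H S (.inl g) (.inr q) (.inl e) →
      (mulCayley S).dist (coneProj S q (.inl g)) (coneProj S q (.inl e)) ≤ R) :
    (cuspedGraph H S).dist (g, 0) (e, 0) ≤
      coneDist H S (.inl g) (.inl e) * (2 * (R + 2 * κ) + 1) := by
  have hS := hF.closure_eq
  -- The entry and exit points at a coset on the geodesic are projections of `g` and `e`, each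
  -- within `κ` of the chosen one. They are thus within `R + 2 * κ` of each other, and `B` bounds
  -- the cost of crossing in the horoball.
  set B := 2 * (R + 2 * κ) + 1 with hB
  suffices h : ∀ n (z : G), coneDist H S (.inl z) (.inl e) = n →
      Between H S (.inl g) (.inl z) (.inl e) →
      (cuspedGraph H S).dist (z, 0) (e, 0) ≤ n * B from h _ g rfl (by simp)
  intro n
  induction n using Nat.strong_induction_on with
  | _ n ih =>
  intro z hn hz
  by_cases hze : z = e
  · subst hze; simp
  have hne : (.inl z : G ⊕ (G ⧸ H)) ≠ .inl e := by simpa using hze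
  obtain ⟨v, hadj, h1, h2⟩ := exists_step hS hne
  have t₁ := coneDist_triangle hS (.inl g) (.inl z) v
  have t₂ := coneDist_triangle hS (.inl g) v (.inl e)
  rcases v with z' | q
  · have hw : edgeWeight (H := H) (.inl z) (.inl z') = 2 := rfl
    have e₁ := ih _ (by omega) z' rfl (by omega)
    have e₂ : (cuspedGraph H S).dist (z, 0) (z', 0) ≤ 1 :=
      cuspedGraph_dist_le_one (Or.inl ⟨rfl, rfl, hadj⟩)
    have e₃ := (cuspedGraph_connected H hS).dist_triangle (u := (z, 0)) (v := (z', 0))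
      (w := (e, 0))
    have e₄ : n = coneDist H S (.inl z') (.inl e) + 2 := by omega
    rw [e₄]
    nlinarith
  · have hw : edgeWeight (H := H) (.inl z) (.inr q) = 1 := rfl
    obtain ⟨v, hadj', h1', h2'⟩ := exists_step (S := S) hS
      (u := (.inr q : G ⊕ (G ⧸ H))) (v := .inl e) (by simp)
    rcases v with b | q'
    swap
    · exact hadj'.elim
    have hw' : edgeWeight (H := H) (.inr q) (.inl b) = 1 := rfl
    have t₃ := coneDist_triangle hS (.inl g) (.inr q) (.inl b)
    have t₄ := coneDist_triangle (H := H) hS (.inl g) (.inl b) (.inl e)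
    have c₁ := coneDist_comm (H := H) hS (.inl e) (.inl b)
    have c₂ := coneDist_comm (S := S) hS (.inl e) (.inr q)
    have p₁ : IsProj S q (.inl g) z := ⟨hadj, by omega⟩
    have p₂ : IsProj S q (.inl e) b := ⟨hadj', by omega⟩
    have d₁ := hF.dist_isProj_le p₁
    have d₂ := hF.dist_isProj_le p₂
    have d₃ := hR q (by omega)
    have d₄ := hF.dist_triangle z (coneProj S q (.inl g)) b
    have d₅ := hF.dist_triangle (coneProj S q (.inl g)) (coneProj S q (.inl e)) b
    have d₆ := (mulCayley S).dist_comm (u := b) (v := coneProj S q (.inl e))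
    have e₁ := ih _ (by omega) b rfl (by omega)
    have e₂ := cusped_dist_coset hS (p₁.1.trans p₂.1.symm) (r := R + 2 * κ) (by omega)
    have e₃ := (cuspedGraph_connected H hS).dist_triangle (u := (z, 0)) (v := (b, 0))
      (w := (e, 0))
    have e₄ : n = coneDist H S (.inl b) (.inl e) + 2 := by omega
    rw [e₄]
    nlinarith

/-- The distance in the cusped graph from an element of a side of a triangle to the guessed paths
of the other two sides. -/
def vertexBound (K κ : ℕ) : ℕ := (2 * K + 1) * (12 * κ + 1) + 4 * κ + 1

/-- Take a vertex `p'` of the other sides closest to `g`. By minimality no cone vertex nearer to `g`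
lies on these sides, so the projections to the intermediate cosets are close and the short path from
`g` lifts to a short path. If `p'` is itself a cone vertex, the lift ends at the projection of `g`,
which is close to an endpoint of a horoball path of the other sides. -/
lemma thin_vertex (hF : IsFineHyperbolic H S K κ) {ξ η : G × ℕ} (ζ : G × ℕ) {g : G}
    (hg : Between H S (.inr (ξ.1 : G ⧸ H)) (.inl g) (.inr (η.1 : G ⧸ H))) :
    ∃ p', (p' ∈ guess H S ξ ζ ∨ p' ∈ guess H S ζ η) ∧
      (cuspedGraph H S).dist (g, 0) p' ≤ vertexBound K κ := by
  have hS := hF.closure_eq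
  set u : G ⊕ (G ⧸ H) := .inr (ξ.1 : G ⧸ H) with hu
  set w : G ⊕ (G ⧸ H) := .inr (η.1 : G ⧸ H) with hw
  set z : G ⊕ (G ⧸ H) := .inr (ζ.1 : G ⧸ H) with hz
  -- a vertex of the other sides closest to `g`
  obtain ⟨p', hp', hmin⟩ : ∃ p', (Between H S u p' z ∨ Between H S z p' w) ∧
      ∀ p, (Between H S u p z ∨ Between H S z p w) →
        coneDist H S (.inl g) p' ≤ coneDist H S (.inl g) p := by
    obtain ⟨p₀, hp₀, -⟩ := hF.fourPoint.slim hS hg z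
    obtain ⟨p', hp', hmin⟩ := WellFounded.has_min
      (InvImage.wf (fun p => coneDist H S (.inl g) p) wellFounded_lt)
      {p | Between H S u p z ∨ Between H S z p w} ⟨p₀, hp₀⟩
    exact ⟨p', hp', fun p hp => not_lt.1 (hmin p hp)⟩
  have hclose : coneDist H S (.inl g) p' ≤ 2 * K + 1 := by
    obtain ⟨p₀, hp₀, hd⟩ := hF.fourPoint.slim hS hg z
    exact (hmin p₀ hp₀).trans hd
  have hside : ∀ q : G ⧸ H, coneDist H S (.inl g) (.inr q) < coneDist H S (.inl g) p' →
      (mulCayley S).dist (coneProj S q (.inl g)) (coneProj S q p') ≤ 3 * κ := by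
    intro q hq
    refine hF.dist_coneProj_side_le hg hp' (fun h => ?_) (fun h => ?_)
    · have := hmin _ (Or.inl h)
      omega
    · have := hmin _ (Or.inr h)
      omega
  rcases p' with g' | q
  · refine ⟨(g', 0), ?_, ?_⟩
    · exact hp'.imp (fun h => Or.inl ⟨rfl, h⟩) (fun h => Or.inl ⟨rfl, h⟩)
    · refine (hF.cusped_dist_le (R := 3 * κ) fun q hq => hside q ?_).trans ?_
      · have := one_le_coneDist (S := S) hS (u := (.inr q : G ⊕ (G ⧸ H))) (v := .inl g') (by simp)
        omega
      · unfold vertexBound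
        nlinarith
  · have hpe := isProj_coneProj (S := S) hS (q := q) (u := .inl g) (by simp)
    have hle := hpe.2
    set e := coneProj S q (.inl g) with he
    have hge : (cuspedGraph H S).dist (g, 0) (e, 0) ≤ (2 * K + 1) * (12 * κ + 1) := by
      refine (hF.cusped_dist_le (R := 4 * κ) fun q₂ hq₂ => ?_).trans ?_
      · have e₁ := one_le_coneDist (S := S) hS (u := (.inr q₂ : G ⊕ (G ⧸ H))) (v := .inl e)
          (by simp)
        have e₂ := coneDist_comm (S := S) hS (.inr q₂ : G ⊕ (G ⧸ H)) (.inl e)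
        have e₃ := hside q₂ (by omega)
        have e₄ := coneDist_inl_inr (S := S) hS hpe.1
        have e₅ : ¬ Between H S (.inl e) (.inr q₂) (.inr q) := by
          intro hb
          have h0 : coneDist H S (.inr q₂) (.inr q) = 0 := by omega
          have h1 := eq_of_coneDist_eq_zero hS h0
          rw [Sum.inr.injEq] at h1
          subst h1
          omega
        have e₆ := hF.dist_coneProj_le e₅
        have e₇ := hF.dist_triangle (coneProj S q₂ (.inl g)) (coneProj S q₂ (.inr q))
          (coneProj S q₂ (.inl e))
        have e₈ := (mulCayley S).dist_comm (u := coneProj S q₂ (.inl e))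
          (v := coneProj S q₂ (.inr q))
        omega
      · have h1 : coneDist H S (.inl g) (.inl e) ≤ 2 * K + 1 := by omega
        nlinarith
    have hfin : ∀ v : G × ℕ, (.inr (v.1 : G ⧸ H) : G ⊕ (G ⧸ H)) ≠ .inr q →
        (mulCayley S).dist e (coneProj S q (.inr (v.1 : G ⧸ H))) ≤ 2 * κ →
        (cuspedGraph H S).dist (g, 0) (horoProj S q v) ≤ vertexBound K κ := by
      intro v hv hd
      rw [horoProj_of_ne hv]
      have e₁ := cusped_dist_coset hS (hpe.1.trans (isProj_coneProj (S := S) hS hv).1.symm) hd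
      have e₂ := (cuspedGraph_connected H hS).dist_triangle (u := (g, 0)) (v := (e, 0))
        (w := (coneProj S q (.inr (v.1 : G ⧸ H)), 0))
      unfold vertexBound
      omega
    rcases hp' with hp' | hp'
    · rcases hF.dist_coneProj_vertex_le (q := q) (z := z) hg with ⟨h1, h2⟩ | ⟨h1, h2⟩ | ⟨h1, h2, h3⟩
      · exact ⟨_, Or.inl (Or.inr ⟨q, hp', left_mem_horoPath _ _⟩), hfin ξ h1 h2⟩
      · exact ⟨_, Or.inl (Or.inr ⟨q, hp', right_mem_horoPath _ _⟩), hfin ζ h1 h2⟩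
      · exact ⟨_, Or.inr (Or.inr ⟨q, h1, right_mem_horoPath _ _⟩), hfin η h2 h3⟩
    · rcases hF.dist_coneProj_vertex_le (q := q) (z := z) ((between_comm hS).1 hg) with
        ⟨h1, h2⟩ | ⟨h1, h2⟩ | ⟨h1, h2, h3⟩
      · exact ⟨_, Or.inr (Or.inr ⟨q, hp', right_mem_horoPath _ _⟩), hfin η h1 h2⟩
      · exact ⟨_, Or.inr (Or.inr ⟨q, hp', left_mem_horoPath _ _⟩), hfin ζ h1 h2⟩
      · exact ⟨_, Or.inl (Or.inr ⟨q, (between_comm hS).1 h1, left_mem_horoPath _ _⟩),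
          hfin ξ h2 h3⟩

/-- The bound on the thinness of the guessed paths. -/
def thinBound (K κ : ℕ) : ℕ := vertexBound K κ + 10 * κ + 10

/-- When the cone vertex is not between the two cosets, the projections are close and the horoball
path between them is short. Neither point then lies over `q`. -/
lemma horoProj_close (hF : IsFineHyperbolic H S K κ) {q : G ⧸ H} {ξ η : G × ℕ}
    (h : ¬ Between H S (.inr (ξ.1 : G ⧸ H)) (.inr q) (.inr (η.1 : G ⧸ H))) {p : G × ℕ}
    (hp : p ∈ horoPath S (horoProj S q ξ) (horoProj S q η)) :
    (cuspedGraph H S).dist p (horoProj S q ξ) ≤ 3 * κ + 1 ∧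
      (cuspedGraph H S).dist p (horoProj S q η) ≤ 3 * κ + 1 := by
  have hS := hF.closure_eq
  have h1 := mk_horoProj (S := S) hS q ξ
  have h2 := mk_horoProj (S := S) hS q η
  rw [horoProj_of_ne (ne_of_not_between h).1] at hp h1 ⊢
  rw [horoProj_of_ne (ne_of_not_between h).2] at hp h2 ⊢
  exact horoPath_small hS (h1.trans h2.symm) (hF.dist_coneProj_le h) hp

/-- Horoball triangles are thin, but a side in the horoball of `q` belongs to a guessed path only
when the cone vertex of `q` is on the corresponding geodesics. A side that is missing is short, so
one can move to its corner. -/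
lemma guess_thin (hF : IsFineHyperbolic H S K κ) (ξ η ζ : G × ℕ) {p : G × ℕ}
    (hp : p ∈ guess H S ξ η) :
    ∃ p', (p' ∈ guess H S ξ ζ ∨ p' ∈ guess H S ζ η) ∧
      (cuspedGraph H S).dist p p' ≤ thinBound K κ := by
  have hS := hF.closure_eq
  have htri := fun a b c => (cuspedGraph_connected H hS).dist_triangle (u := a) (v := b) (w := c)
  rcases hp with ⟨h0, hp⟩ | ⟨q, hq, hp⟩
  · obtain ⟨x, i⟩ := p
    obtain rfl : i = 0 := h0
    obtain ⟨p', h1, h2⟩ := hF.thin_vertex ζ hp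
    exact ⟨p', h1, h2.trans (by unfold thinBound; omega)⟩
  obtain ⟨p', hp', hd⟩ := horoPath_thin (H := H) (ζ := horoProj S q ζ) hS
    (by rw [mk_horoProj hS, mk_horoProj hS]) (by rw [mk_horoProj hS, mk_horoProj hS]) hp
  by_cases h1 : Between H S (.inr (ξ.1 : G ⧸ H)) (.inr q) (.inr (ζ.1 : G ⧸ H)) <;>
  by_cases h2 : Between H S (.inr (ζ.1 : G ⧸ H)) (.inr q) (.inr (η.1 : G ⧸ H))
  · refine ⟨p', hp'.imp (fun h => Or.inr ⟨q, h1, h⟩) (fun h => Or.inr ⟨q, h2, h⟩), ?_⟩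
    unfold thinBound; omega
  · rcases hp' with hp' | hp'
    · exact ⟨p', Or.inl (Or.inr ⟨q, h1, hp'⟩), by unfold thinBound; omega⟩
    · refine ⟨horoProj S q ζ, Or.inl (Or.inr ⟨q, h1, right_mem_horoPath _ _⟩), ?_⟩
      have e₁ := (hF.horoProj_close h2 hp').1
      have e₂ := htri p p' (horoProj S q ζ)
      unfold thinBound; omega
  · rcases hp' with hp' | hp'
    · refine ⟨horoProj S q ζ, Or.inr (Or.inr ⟨q, h2, left_mem_horoPath _ _⟩), ?_⟩
      have e₁ := (hF.horoProj_close h1 hp').2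
      have e₂ := htri p p' (horoProj S q ζ)
      unfold thinBound; omega
    · exact ⟨p', Or.inr (Or.inr ⟨q, h2, hp'⟩), by unfold thinBound; omega⟩
  -- Both comparison sides are short here, so `p` is near the projection of `ξ`. That projection
  -- lies on a geodesic between the cosets of `ξ` and `η`, and `thin_vertex` applies to it.
  · have hξ := (ne_of_not_between h1).1
    have hproj := isProj_coneProj (S := S) hS hξ
    have hb : Between H S (.inr (ξ.1 : G ⧸ H))
        (.inl (coneProj S q (.inr (ξ.1 : G ⧸ H)))) (.inr (η.1 : G ⧸ H)) := by
      have t₁ := coneDist_triangle hS (.inr (ξ.1 : G ⧸ H))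
        (.inl (coneProj S q (.inr (ξ.1 : G ⧸ H)))) (.inr (η.1 : G ⧸ H))
      have t₂ := coneDist_triangle hS (.inl (coneProj S q (.inr (ξ.1 : G ⧸ H))))
        (.inr q) (.inr (η.1 : G ⧸ H))
      have t₃ := coneDist_inl_inr hS hproj.1
      have t₄ := hproj.2
      omega
    obtain ⟨p'', hp'', hd''⟩ := hF.thin_vertex ζ hb
    refine ⟨p'', hp'', ?_⟩
    rw [← horoProj_of_ne hξ] at hd''
    have e₁ := htri p (horoProj S q ξ) p''
    have e₂ := htri p p' (horoProj S q ξ)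
    rcases hp' with hp' | hp'
    · have e₃ := (hF.horoProj_close h1 hp').1
      unfold thinBound; omega
    · have e₃ := (hF.horoProj_close h2 hp').1
      have e₄ := (hF.horoProj_close h1 (left_mem_horoPath _ _)).2
      have e₅ := htri p' (horoProj S q ζ) (horoProj S q ξ)
      have e₆ := (cuspedGraph H S).dist_comm (u := horoProj S q ξ) (v := horoProj S q ζ)
      unfold thinBound; omega

/-- One geodesic between the cone vertices is followed step by step. At each cone vertex the
horoball path is inserted; its ends are chosen projections, within `κ` of the neighbours on the
geodesic. -/
lemma guess_chain (hF : IsFineHyperbolic H S K κ) (ξ η : G × ℕ) :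
    Relation.ReflTransGen (fun a b => b ∈ guess H S ξ η ∧
      (cuspedGraph H S).dist a b ≤ thinBound K κ) ξ η := by
  have hS := hF.closure_eq
  set r := fun a b => b ∈ guess H S ξ η ∧ (cuspedGraph H S).dist a b ≤ thinBound K κ with hr
  set u : G ⊕ (G ⧸ H) := .inr (ξ.1 : G ⧸ H) with hu
  set w : G ⊕ (G ⧸ H) := .inr (η.1 : G ⧸ H) with hw
  have hhoro : ∀ q : G ⧸ H, Between H S u (.inr q) w →
      Relation.ReflTransGen r (horoProj S q ξ) (horoProj S q η) := by
    intro q hq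
    refine Relation.ReflTransGen.mono ?_ _ _ (horoPath_chain (H := H) (ξ := horoProj S q ξ)
      (η := horoProj S q η) hS (by rw [mk_horoProj hS, mk_horoProj hS]))
    rintro a b ⟨h1, h2⟩
    exact ⟨Or.inr ⟨q, hq, h1⟩, h2.trans (by unfold thinBound; omega)⟩
  have hwalk : ∀ n (v : G ⊕ (G ⧸ H)), coneDist H S u v = n → Between H S u v w →
      (∀ g, v = .inl g → Relation.ReflTransGen r ξ (g, 0)) ∧
      (∀ q, v = .inr q → Relation.ReflTransGen r ξ (horoProj S q ξ)) := by
    intro n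
    induction n using Nat.strong_induction_on with
    | _ n ih =>
    intro v hn hv
    by_cases huv : v = u
    · subst huv
      refine ⟨fun g hg => by simp [hu] at hg, fun q hq => ?_⟩
      rw [hu, Sum.inr.injEq] at hq
      subst hq
      rw [horoProj_self]
    obtain ⟨v', hadj, h1, h2⟩ := exists_step hS huv
    have c₁ := coneDist_comm hS v u
    have c₂ := coneDist_comm hS v' u
    have c₃ := coneDist_comm hS v v'
    have h3 := one_le_edgeWeight v v'
    have t₁ := coneDist_triangle hS v' v w
    have t₂ := coneDist_triangle hS u v' w
    obtain ⟨ihg, ihq⟩ := ih (coneDist H S u v') (by omega) v' rfl (by omega)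
    rcases v with g | q
    · refine ⟨fun g' hg' => ?_, fun q hq => by simp at hq⟩
      rw [Sum.inl.injEq] at hg'
      subst hg'
      have hmem : (g, 0) ∈ guess H S ξ η := Or.inl ⟨rfl, hv⟩
      rcases v' with g' | q'
      · refine (ihg g' rfl).tail ⟨hmem, ?_⟩
        have hadj' : (mulCayley S).Adj g g' := hadj
        exact (cuspedGraph_dist_le_one (Or.inl ⟨rfl, rfl, hadj'.symm⟩)).trans
          (by unfold thinBound; omega)
      · refine ((ihq q' rfl).trans (hhoro q' (by omega))).tail ⟨hmem, ?_⟩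
        have hwt : edgeWeight (H := H) (.inl g) (.inr q') = 1 := rfl
        have c₄ := coneDist_comm hS (.inl g) w
        have c₅ := coneDist_comm hS (.inr q') w
        have hproj : IsProj S q' w g := ⟨hadj, by omega⟩
        rw [horoProj_of_ne hproj.ne, SimpleGraph.dist_comm]
        refine (cusped_dist_coset hS (hproj.1.trans (isProj_coneProj hS hproj.ne).1.symm)
          (hF.dist_isProj_le hproj)).trans ?_
        unfold thinBound; omega
    · refine ⟨fun g hg => by simp at hg, fun q' hq' => ?_⟩
      rw [Sum.inr.injEq] at hq'
      subst hq'
      rcases v' with g' | q'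
      swap
      · exact hadj.elim
      refine (ihg g' rfl).tail ⟨Or.inr ⟨q, hv, left_mem_horoPath _ _⟩, ?_⟩
      have hwt : edgeWeight (H := H) (.inr q) (.inl g') = 1 := rfl
      have hproj : IsProj S q u g' := ⟨hadj, by omega⟩
      rw [horoProj_of_ne hproj.ne]
      refine (cusped_dist_coset hS (hproj.1.trans (isProj_coneProj hS hproj.ne).1.symm)
          (hF.dist_isProj_le hproj)).trans ?_
      unfold thinBound; omega
  have h1 := (hwalk _ w rfl (by simp)).2 _ rfl
  have h2 := hhoro (η.1 : G ⧸ H) (by simp [hw])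
  have h3 := h1.trans h2
  rwa [horoProj_self] at h3

lemma three_le_coneDist (hS : Subgroup.closure S = ⊤) {a : G} {q : G ⧸ H}
    (h : (a : G ⧸ H) ≠ q) : 3 ≤ coneDist H S (.inl a) (.inr q) := by
  obtain ⟨v, hadj, h1, h2⟩ := exists_step (S := S) hS (u := (.inl a : G ⊕ (G ⧸ H)))
    (v := .inr q) (by simp)
  rcases v with b | q'
  · have h3 : edgeWeight (H := H) (.inl a) (.inl b) = 2 := rfl
    have h4 := one_le_coneDist (S := S) hS (u := (.inl b : G ⊕ (G ⧸ H))) (v := .inr q) (by simp)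
    omega
  · have hne : (.inr q' : G ⊕ (G ⧸ H)) ≠ .inr q := by
      rintro h'
      rw [Sum.inr.injEq] at h'
      subst h'
      exact h hadj
    have h3 := one_le_edgeWeight (H := H) (.inl a) (.inr q')
    obtain ⟨v, hadj', h1', h2'⟩ := exists_step (S := S) hS hne
    rcases v with b | q''
    · have h3' := one_le_edgeWeight (H := H) (.inr q') (.inl b)
      have h4 := one_le_coneDist (S := S) hS (u := (.inl b : G ⊕ (G ⧸ H))) (v := .inr q) (by simp)
      omega
    · exact hadj'.elim

lemma four_le_coneDist (hS : Subgroup.closure S = ⊤) {q q' : G ⧸ H} (h : q ≠ q') :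
    4 ≤ coneDist H S (.inr q) (.inr q') := by
  obtain ⟨a, ha⟩ := exists_isProj (S := S) hS (q := q') (u := .inr q) (by simpa using h)
  have h1 := three_le_coneDist (S := S) hS (a := a) (q := q) (by rw [ha.1]; exact h.symm)
  have h2 := ha.2
  have h3 := coneDist_comm (S := S) hS (.inr q) (.inl a)
  omega

/-- The projection of an adjacent coset is close to the endpoint of the edge. -/
lemma dist_coneProj_of_adj (hF : IsFineHyperbolic H S K κ) {x y : G}
    (hadj : (mulCayley S).Adj x y) (hxy : (x : G ⧸ H) ≠ (y : G ⧸ H)) :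
    (mulCayley S).dist x (coneProj S (x : G ⧸ H) (.inr (y : G ⧸ H))) ≤ 3 * κ := by
  have hS := hF.closure_eq
  have e₁ : coneDist H S (.inl x) (.inl y) ≤ 2 :=
    coneDist_adj_le (show (conedOffGraph H S).Adj (.inl x) (.inl y) from hadj)
  have e₂ := coneDist_inl_inr (S := S) hS (rfl : (x : G ⧸ H) = x)
  have e₃ := coneDist_inl_inr (S := S) hS (rfl : (y : G ⧸ H) = y)
  have e₄ := three_le_coneDist (S := S) hS (a := y) (q := (x : G ⧸ H)) hxy.symm
  have e₅ := coneDist_comm (S := S) hS (.inl y) (.inr (x : G ⧸ H))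
  have e₆ := coneDist_self H S (.inl x)
  have d₁ := hF.dist_isProj_le (q := (x : G ⧸ H)) (u := .inl x) (a := x) ⟨rfl, by omega⟩
  have d₂ := hF.dist_coneProj_le (q := (x : G ⧸ H)) (u := .inl x) (w := .inl y) (by omega)
  have d₃ := hF.dist_coneProj_le (q := (x : G ⧸ H)) (u := .inl y) (w := .inr (y : G ⧸ H))
    (by omega)
  have d₄ := hF.dist_triangle x (coneProj S (x : G ⧸ H) (.inl x))
    (coneProj S (x : G ⧸ H) (.inr (y : G ⧸ H)))
  have d₅ := hF.dist_triangle (coneProj S (x : G ⧸ H) (.inl x))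
    (coneProj S (x : G ⧸ H) (.inl y)) (coneProj S (x : G ⧸ H) (.inr (y : G ⧸ H)))
  omega

lemma hatHeight_le_of_dist_le_one (hS : Subgroup.closure S = ⊤) {ξ η : G × ℕ}
    (h : (cuspedGraph H S).dist ξ η ≤ 1) :
    hatHeight S ξ η ≤ ξ.2 + 1 ∧ hatHeight S ξ η ≤ η.2 + 1 := by
  rcases Nat.le_one_iff_eq_zero_or_eq_one.1 h with h | h
  · obtain rfl := ((cuspedGraph_connected H hS).dist_eq_zero_iff).1 h
    simp [hatHeight]
  · rw [dist_eq_one_iff_adj] at h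
    rcases h with ⟨h1, h2, h3⟩ | ⟨h1, h2⟩ | ⟨h1, h2, h3, h4⟩
    · simp [hatHeight, h1, h2, dist_eq_one_iff_adj.2 h3]
    · simp only [hatHeight, h1, SimpleGraph.dist_self, Nat.clog_zero_right]
      omega
    · have := Nat.clog_le_of_le_pow (b := 2) h4
      simp only [hatHeight]
      omega

/-- Inside one horoball the guessed path is the horoball path, which rises at most one level.
Otherwise the two points are joined by a Cayley edge at level `0` and the cone vertices are at
distance at most four, leaving no room for a third coset. -/
lemma guess_adj (hF : IsFineHyperbolic H S K κ) {ξ η : G × ℕ}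
    (h : (cuspedGraph H S).dist ξ η ≤ 1) {p : G × ℕ} (hp : p ∈ guess H S ξ η) :
    (cuspedGraph H S).dist p ξ ≤ thinBound K κ := by
  have hS := hF.closure_eq
  have htri := fun a b c => (cuspedGraph_connected H hS).dist_triangle (u := a) (v := b) (w := c)
  by_cases hcoset : (ξ.1 : G ⧸ H) = (η.1 : G ⧸ H)
  · have hbet : ∀ v, Between H S (.inr (ξ.1 : G ⧸ H)) v (.inr (η.1 : G ⧸ H)) →
        v = .inr (ξ.1 : G ⧸ H) := by
      intro v hv
      rw [← hcoset] at hv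
      have h0 := coneDist_self H S (.inr (ξ.1 : G ⧸ H))
      exact (eq_of_coneDist_eq_zero hS (by omega)).symm
    rcases hp with ⟨-, hp⟩ | ⟨q, hq, hp⟩
    · simpa using hbet _ hp
    · obtain rfl : q = (ξ.1 : G ⧸ H) := by simpa using hbet _ hq
      rw [horoProj_self, hcoset, horoProj_self] at hp
      obtain ⟨h1, h2⟩ := hatHeight_le_of_dist_le_one hS h
      have key : ∀ ζ : G × ℕ, hatHeight S ξ η ≤ ζ.2 + 1 → ∀ k, ζ.2 ≤ k → k ≤ hatHeight S ξ η →
          (cuspedGraph H S).dist (ζ.1, k) ζ ≤ 1 := by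
        intro ζ h1 k hk hk'
        obtain ⟨j, rfl⟩ := Nat.exists_eq_add_of_le hk
        have := cusped_dist_vertical (H := H) hS ζ.1 ζ.2 j
        rw [SimpleGraph.dist_comm] at this
        exact this.trans (by omega)
      obtain ⟨g, k⟩ := p
      unfold thinBound
      rcases hp with ⟨h0, hk, hk'⟩ | ⟨h0, hk, hk'⟩ <;> simp only at h0 hk hk' <;> subst h0
      · have := key ξ h1 k hk hk'
        omega
      · have e₁ := key η h2 k hk hk'
        have e₂ := htri (η.1, k) η ξ
        rw [SimpleGraph.dist_comm (u := η)] at e₂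
        omega
  · have hadj : (cuspedGraph H S).Adj ξ η := by
      rw [← dist_eq_one_iff_adj]
      refine le_antisymm h (Nat.one_le_iff_ne_zero.2 fun h0 => hcoset ?_)
      rw [((cuspedGraph_connected H hS).dist_eq_zero_iff).1 h0]
    obtain ⟨x, i⟩ := ξ
    obtain ⟨y, j⟩ := η
    rcases hadj with ⟨rfl, rfl, hadj⟩ | ⟨h1, -⟩ | ⟨-, -, h1, -⟩
    rotate_left
    · exact absurd (congrArg _ h1) hcoset
    · exact absurd h1 hcoset
    simp only at hadj hcoset
    have a₁ := hF.dist_coneProj_of_adj hadj hcoset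
    have a₂ := hF.dist_coneProj_of_adj hadj.symm (Ne.symm hcoset)
    have e₁ : coneDist H S (.inl x) (.inl y) ≤ 2 :=
      coneDist_adj_le (show (conedOffGraph H S).Adj (.inl x) (.inl y) from hadj)
    have e₂ := coneDist_inl_inr (S := S) hS (rfl : (x : G ⧸ H) = x)
    have e₃ := coneDist_inl_inr (S := S) hS (rfl : (y : G ⧸ H) = y)
    have e₄ := coneDist_triangle hS (.inr (x : G ⧸ H)) (.inl x) (.inr (y : G ⧸ H))
    have e₅ := coneDist_triangle hS (.inl x) (.inl y) (.inr (y : G ⧸ H))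
    have e₆ := coneDist_comm (S := S) hS (.inl x) (.inr (x : G ⧸ H))
    have hux : (.inr (x : G ⧸ H) : G ⊕ (G ⧸ H)) ≠ .inr (y : G ⧸ H) := by simpa using hcoset
    have p₁ := isProj_coneProj (S := S) hS hux
    have p₂ := isProj_coneProj (S := S) hS hux.symm
    unfold thinBound
    rcases hp with ⟨h0, hp⟩ | ⟨q, hq, hp⟩
    · obtain ⟨g, k⟩ := p
      obtain rfl : k = 0 := h0
      simp only at hp
      have e₇ := coneDist_comm (S := S) hS (.inl g) (.inr (x : G ⧸ H))
      have e₈ := coneDist_comm (S := S) hS (.inl g) (.inr (y : G ⧸ H))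
      have e₉ := coneDist_comm (S := S) hS (.inr (x : G ⧸ H)) (.inr (y : G ⧸ H))
      by_cases hgx : (g : G ⧸ H) = x
      · have e₁₀ := coneDist_inl_inr (S := S) hS hgx
        have hproj : IsProj S (x : G ⧸ H) (.inr (y : G ⧸ H)) g := ⟨hgx, by omega⟩
        have d₁ := hF.dist_isProj_le hproj
        have d₂ := hF.dist_triangle g (coneProj S (x : G ⧸ H) (.inr (y : G ⧸ H))) x
        have d₃ := (mulCayley S).dist_comm (u := x)
          (v := coneProj S (x : G ⧸ H) (.inr (y : G ⧸ H)))
        have d₄ := cusped_dist_coset (S := S) hS hgx (r := 4 * κ) (by omega)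
        omega
      by_cases hgy : (g : G ⧸ H) = y
      · have e₁₀ := coneDist_inl_inr (S := S) hS hgy
        have hproj : IsProj S (y : G ⧸ H) (.inr (x : G ⧸ H)) g := ⟨hgy, by omega⟩
        have d₁ := hF.dist_isProj_le hproj
        have d₂ := hF.dist_triangle g (coneProj S (y : G ⧸ H) (.inr (x : G ⧸ H))) y
        have d₃ := (mulCayley S).dist_comm (u := y)
          (v := coneProj S (y : G ⧸ H) (.inr (x : G ⧸ H)))
        have d₄ := cusped_dist_coset (S := S) hS hgy (r := 4 * κ) (by omega)
        have d₅ := htri (g, 0) (y, 0) (x, 0)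
        have d₆ := (cuspedGraph H S).dist_comm (u := (y, 0)) (v := (x, 0))
        omega
      have e₁₀ := three_le_coneDist (S := S) hS hgx
      have e₁₁ := three_le_coneDist (S := S) hS hgy
      omega
    · by_cases hqx : q = (x : G ⧸ H)
      · subst hqx
        rw [show horoProj S (x : G ⧸ H) (x, 0) = (x, 0) from horoProj_self (x, 0),
          horoProj_of_ne hux.symm] at hp
        have := (horoPath_small hS p₂.1.symm a₁ hp).1
        omega
      by_cases hqy : q = (y : G ⧸ H)
      · subst hqy
        rw [show horoProj S (y : G ⧸ H) (y, 0) = (y, 0) from horoProj_self (y, 0),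
          horoProj_of_ne hux, horoPath_comm] at hp
        have d₁ := (horoPath_small hS p₁.1.symm a₂ hp).1
        have d₅ := htri p (y, 0) (x, 0)
        have d₆ := (cuspedGraph H S).dist_comm (u := (y, 0)) (v := (x, 0))
        omega
      have e₁₀ := four_le_coneDist (S := S) hS (Ne.symm hqx)
      have e₁₁ := four_le_coneDist (S := S) hS hqy
      simp only at hq
      omega

/-- The cusped graph is hyperbolic. -/
theorem exists_cusped_fourPoint (hF : IsFineHyperbolic H S K κ) :
    ∃ δ : ℕ, ∀ w x y z : G × ℕ, (cuspedGraph H S).dist x z + (cuspedGraph H S).dist w y ≤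
      max ((cuspedGraph H S).dist x y + (cuspedGraph H S).dist w z)
        ((cuspedGraph H S).dist y z + (cuspedGraph H S).dist w x) + δ := by
  refine exists_fourPoint_of_guess (A := guess H S) (h := thinBound K κ)
    (cuspedGraph_connected H hF.closure_eq) (fun x y h p hp => hF.guess_adj h hp)
    (fun x y z p hp => hF.guess_thin x y z hp) left_mem_guess (fun x y => ?_)
    (fun x y => hF.guess_chain x y)
  rw [guess_comm hF.closure_eq]
  exact left_mem_guess y x

end IsFineHyperbolic

end CuspedHyperbolic
end RelHyp
end

noncomputable section
namespace RelHyp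

/-! ### The distance between horoballs as a proper hyperbolic distance on cosets. -/

section CosetDistance

open SimpleGraph

/-- A `G`-invariant distance function on a `G`-set `V` that is hyperbolic and coarsely geodesic, and
such that the action on pairs of distinct points of bounded distance is proper and cofinite. -/
structure IsProperHyperbolic (G : Type u) [Group G] {V : Type u} [MulAction G V]
    (D : V → V → ℕ) (c : ℕ) : Prop where
  self : ∀ v, D v v = 0
  comm : ∀ v w, D v w = D w v
  smul : ∀ (g : G) (v w : V), D (g • v) (g • w) = D v w
  fourPoint : ∀ w x y z, x ≠ z → w ≠ y →
    D x z + D w y ≤ max (D x y + D w z) (D y z + D w x) + c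
  exists_between : ∀ v w m, 1 ≤ m → m < D v w → ∃ p, p ≠ v ∧ p ≠ w ∧ D v p ≤ m ∧ D p w + m ≤ D v w
  finite_inter : ∀ v w n, v ≠ w → {p | D v p ≤ n ∧ D w p ≤ n}.Finite
  finite_stabilizer : ∀ v w : V, v ≠ w → {g : G | g • v = v ∧ g • w = w}.Finite
  cofinite : ∀ n, ∃ T : Set (V × V), T.Finite ∧ ∀ v w, D v w ≤ n → ∃ g : G, (g • v, g • w) ∈ T

variable {G : Type u} [Group G] {H : Subgroup G} {S : Set G}

lemma cuspedGraph_adj_mul_left (g : G) {ξ η : G × ℕ} (h : (cuspedGraph H S).Adj ξ η) :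
    (cuspedGraph H S).Adj (g * ξ.1, ξ.2) (g * η.1, η.2) := by
  rcases h with ⟨h1, h2, h3⟩ | ⟨h1, h2⟩ | ⟨h1, h2, h3, h4⟩
  · exact Or.inl ⟨h1, h2, (mulCayleyIso S g).map_adj_iff.2 h3⟩
  · exact Or.inr (Or.inl ⟨by rw [h1], h2⟩)
  · refine Or.inr (Or.inr ⟨h1, fun h => h2 (mul_left_cancel h), ?_, ?_⟩)
    · rw [QuotientGroup.eq] at h3 ⊢
      simpa [mul_assoc] using h3
    · simpa only [mulCayley_dist_mul_left] using h4

lemma cusped_dist_mul_left_le (hS : Subgroup.closure S = ⊤) (g : G) (ξ η : G × ℕ) :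
    (cuspedGraph H S).dist (g * ξ.1, ξ.2) (g * η.1, η.2) ≤ (cuspedGraph H S).dist ξ η := by
  obtain ⟨p, hp⟩ := (cuspedGraph_connected H hS).exists_walk_length_eq_dist ξ η
  rw [← hp]
  let f : cuspedGraph H S →g cuspedGraph H S :=
    ⟨fun ξ => (g * ξ.1, ξ.2), fun h => cuspedGraph_adj_mul_left g h⟩
  have := dist_le (p.map f)
  rwa [Walk.length_map] at this

lemma cusped_dist_mul_left (hS : Subgroup.closure S = ⊤) (g : G) (ξ η : G × ℕ) :
    (cuspedGraph H S).dist (g * ξ.1, ξ.2) (g * η.1, η.2) = (cuspedGraph H S).dist ξ η := by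
  refine (cusped_dist_mul_left_le hS g ξ η).antisymm ?_
  simpa using cusped_dist_mul_left_le (H := H) hS g⁻¹ (g * ξ.1, ξ.2) (g * η.1, η.2)

lemma level_le_of_adj {ξ η : G × ℕ} (h : (cuspedGraph H S).Adj ξ η) : η.2 ≤ ξ.2 + 1 := by
  rcases h with ⟨h1, h2, -⟩ | ⟨-, h2⟩ | ⟨h1, -⟩ <;> omega

lemma level_le_add_dist (hS : Subgroup.closure S = ⊤) (ξ η : G × ℕ) :
    η.2 ≤ ξ.2 + (cuspedGraph H S).dist ξ η := by
  obtain ⟨p, hp⟩ := (cuspedGraph_connected H hS).exists_walk_length_eq_dist ξ η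
  rw [← hp]
  clear hp
  induction p with
  | nil => simp
  | cons h p ih =>
    have := level_le_of_adj h
    rw [Walk.length_cons]
    omega

lemma cayley_dist_le_of_adj {ξ η : G × ℕ} (h : (cuspedGraph H S).Adj ξ η) :
    (mulCayley S).dist ξ.1 η.1 ≤ 2 ^ ξ.2 := by
  rcases h with ⟨h1, -, h3⟩ | ⟨h1, -⟩ | ⟨-, -, -, h4⟩
  · rw [dist_eq_one_iff_adj.2 h3]
    exact Nat.one_le_two_pow
  · simp [h1]
  · exact h4

/-- Horoballs distort word distances at most exponentially. This suffices for the finiteness of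
balls at level `0`. -/
lemma cayley_dist_le (hS : Subgroup.closure S = ⊤) (ξ η : G × ℕ) :
    (mulCayley S).dist ξ.1 η.1 ≤
      (cuspedGraph H S).dist ξ η * 2 ^ (ξ.2 + (cuspedGraph H S).dist ξ η) := by
  obtain ⟨p, hp⟩ := (cuspedGraph_connected H hS).exists_walk_length_eq_dist ξ η
  rw [← hp]
  clear hp
  induction p with
  | nil => simp
  | @cons a b c h p ih =>
    have h1 := level_le_of_adj h
    have h2 := cayley_dist_le_of_adj h
    have h3 := (mulCayley_connected hS).dist_triangle (u := a.1) (v := b.1) (w := c.1)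
    have h4 : 2 ^ (b.2 + p.length) ≤ 2 ^ (a.2 + (p.length + 1)) :=
      Nat.pow_le_pow_right (by norm_num) (by omega)
    have h5 : 2 ^ a.2 ≤ 2 ^ (a.2 + (p.length + 1)) :=
      Nat.pow_le_pow_right (by norm_num) (by omega)
    have h6 := Nat.mul_le_mul_left p.length h4
    rw [Walk.length_cons, add_mul, one_mul]
    omega

lemma finite_cayley_ball (hS : Subgroup.closure S = ⊤) (hfin : S.Finite) (n : ℕ) :
    {g : G | (mulCayley S).dist 1 g ≤ n}.Finite := by
  induction n with
  | zero =>
    refine (Set.finite_singleton (1 : G)).subset fun g hg => ?_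
    have := (mulCayley_connected hS).dist_eq_zero_iff.1 (Nat.le_zero.1 hg)
    exact this.symm
  | succ n ih =>
    refine (ih.union (ih.image2 (· * ·) (hfin.union hfin.inv))).subset fun g hg => ?_
    by_cases h0 : (mulCayley S).dist 1 g ≤ n
    · exact Or.inl h0
    have hne : (mulCayley S).dist 1 g = n + 1 := le_antisymm hg (by omega)
    obtain ⟨α, hα, hα0, hα1⟩ := exists_isGeodesicSeq (mulCayley_connected hS) 1 g
    rw [hne] at hα hα1
    have h1 := hα 0 n (by omega) (by omega)
    have h2 := hα n (n + 1) (by omega) le_rfl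
    rw [hα0] at h1
    rw [hα1] at h2
    have h3 : (mulCayley S).Adj (α n) g := dist_eq_one_iff_adj.1 (by omega)
    refine Or.inr ⟨α n, by simp only [Set.mem_ofPred_eq]; omega, (α n)⁻¹ * g, ?_, by simp⟩
    rw [mulCayley_adj] at h3
    exact h3.2.imp id fun h => by simpa using h

lemma finite_cusped_ball (hS : Subgroup.closure S = ⊤) (hfin : S.Finite) (n : ℕ) :
    {g : G | (cuspedGraph H S).dist (1, 0) (g, 0) ≤ n}.Finite := by
  refine (finite_cayley_ball hS hfin (n * 2 ^ n)).subset fun g hg => ?_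
  have h1 := cayley_dist_le (H := H) hS (1, 0) (g, 0)
  simp only [zero_add] at h1
  exact h1.trans (Nat.mul_le_mul hg (Nat.pow_le_pow_right (by norm_num) hg))

/-- A path that leaves a horoball passes through its level `0`. -/
lemma exists_exit (hS : Subgroup.closure S = ⊤) {ξ η : G × ℕ}
    (h : (ξ.1 : G ⧸ H) ≠ (η.1 : G ⧸ H)) : ∃ x : G, (x : G ⧸ H) = (ξ.1 : G ⧸ H) ∧
      (cuspedGraph H S).dist ξ (x, 0) + (cuspedGraph H S).dist (x, 0) η ≤
        (cuspedGraph H S).dist ξ η := by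
  obtain ⟨p, hp⟩ := (cuspedGraph_connected H hS).exists_walk_length_eq_dist ξ η
  rw [← hp]
  clear hp
  induction p with
  | nil => exact absurd rfl h
  | @cons a b c hab p ih =>
    rw [Walk.length_cons]
    by_cases hb : (a.1 : G ⧸ H) = (b.1 : G ⧸ H)
    · obtain ⟨x, hx, hle⟩ := ih (hb ▸ h)
      have h1 := (cuspedGraph_connected H hS).dist_triangle (u := a) (v := b) (w := (x, 0))
      have h2 := cuspedGraph_dist_le_one hab
      exact ⟨x, hx.trans hb.symm, by omega⟩
    · have ha : a.2 = 0 := by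
        rcases hab with ⟨h1, -⟩ | ⟨h1, -⟩ | ⟨-, -, h3, -⟩
        · exact h1
        · exact absurd (by rw [h1]) hb
        · exact absurd h3 hb
      refine ⟨a.1, rfl, ?_⟩
      rw [← ha, Prod.mk.eta, SimpleGraph.dist_self, zero_add]
      exact dist_le (Walk.cons hab p)

/-- The distance of two left cosets in the cusped graph. -/
def cosetDist (H : Subgroup G) (S : Set G) (q q' : G ⧸ H) : ℕ :=
  sInf {n | ∃ x y : G, (x : G ⧸ H) = q ∧ (y : G ⧸ H) = q' ∧
    (cuspedGraph H S).dist (x, 0) (y, 0) = n}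

lemma exists_cosetDist (q q' : G ⧸ H) : ∃ x y : G, (x : G ⧸ H) = q ∧ (y : G ⧸ H) = q' ∧
    (cuspedGraph H S).dist (x, 0) (y, 0) = cosetDist H S q q' := by
  refine Nat.sInf_mem (s := {n | ∃ x y : G, (x : G ⧸ H) = q ∧ (y : G ⧸ H) = q' ∧
    (cuspedGraph H S).dist (x, 0) (y, 0) = n}) ?_
  exact ⟨_, q.out, q'.out, by simp, by simp, rfl⟩

lemma cosetDist_le (x y : G) :
    cosetDist H S (x : G ⧸ H) (y : G ⧸ H) ≤ (cuspedGraph H S).dist (x, 0) (y, 0) :=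
  Nat.sInf_le ⟨x, y, rfl, rfl, rfl⟩

lemma cosetDist_self (q : G ⧸ H) : cosetDist H S q q = 0 := by
  obtain ⟨x, rfl⟩ := QuotientGroup.mk_surjective q
  simpa using cosetDist_le (H := H) (S := S) x x

lemma cosetDist_comm (q q' : G ⧸ H) : cosetDist H S q q' = cosetDist H S q' q := by
  have key : ∀ q q' : G ⧸ H, cosetDist H S q q' ≤ cosetDist H S q' q := by
    intro q q'
    obtain ⟨x, y, rfl, rfl, h⟩ := exists_cosetDist (S := S) q' q
    rw [← h, SimpleGraph.dist_comm]
    exact cosetDist_le y x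
  exact (key q q').antisymm (key q' q)

lemma cosetDist_smul (hS : Subgroup.closure S = ⊤) (g : G) (q q' : G ⧸ H) :
    cosetDist H S (g • q) (g • q') = cosetDist H S q q' := by
  have key : ∀ (g : G) (q q' : G ⧸ H), cosetDist H S (g • q) (g • q') ≤ cosetDist H S q q' := by
    intro g q q'
    obtain ⟨x, y, rfl, rfl, h⟩ := exists_cosetDist (S := S) q q'
    rw [← h, ← cusped_dist_mul_left hS g (x, 0) (y, 0)]
    exact cosetDist_le (g * x) (g * y)
  refine (key g q q').antisymm ?_
  simpa using key g⁻¹ (g • q) (g • q')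

/-- Points of different horoballs are at least as far apart as the horoballs. -/
lemma add_cosetDist_le (hS : Subgroup.closure S = ⊤) {ξ η : G × ℕ}
    (h : (ξ.1 : G ⧸ H) ≠ (η.1 : G ⧸ H)) :
    ξ.2 + cosetDist H S ξ.1 η.1 + η.2 ≤ (cuspedGraph H S).dist ξ η := by
  obtain ⟨x, hx, h1⟩ := exists_exit (S := S) hS h
  obtain ⟨y, hy, h2⟩ := exists_exit (S := S) hS (ξ := η) (η := (x, 0))
    (fun e => h (hx.symm.trans e.symm))
  have h3 := cosetDist_le (H := H) (S := S) x y
  rw [hx, hy] at h3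
  have h4 := level_le_add_dist (H := H) hS (x, 0) ξ
  have h5 := level_le_add_dist (H := H) hS (y, 0) η
  have c₁ := (cuspedGraph H S).dist_comm (u := (x, 0)) (v := ξ)
  have c₂ := (cuspedGraph H S).dist_comm (u := (y, 0)) (v := η)
  have c₃ := (cuspedGraph H S).dist_comm (u := (x, 0)) (v := η)
  have c₄ := (cuspedGraph H S).dist_comm (u := (x, 0)) (v := (y, 0))
  simp only at h4 h5
  omega

lemma dist_high_le (hS : Subgroup.closure S = ⊤) {x y : G} (hxy : (x : G ⧸ H) = (y : G ⧸ H))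
    {t : ℕ} (h : (mulCayley S).dist x y ≤ t) : (cuspedGraph H S).dist (x, t) (y, 0) ≤ t + 1 := by
  have h1 := cusped_dist_horizontal hxy (h.trans Nat.lt_two_pow_self.le)
  have h2 := cusped_dist_vertical (H := H) hS y 0 t
  rw [zero_add] at h2
  have h3 := (cuspedGraph_connected H hS).dist_triangle (u := (x, t)) (v := (y, t)) (w := (y, 0))
  have c₁ := (cuspedGraph H S).dist_comm (u := (y, 0)) (v := (y, t))
  omega

/-- At a large height one horizontal edge reaches the column of a closest point, so the position
inside the coset becomes irrelevant. With `add_cosetDist_le` this computes distances of high points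
over distinct cosets up to two. -/
lemma exists_dist_high_le (hS : Subgroup.closure S = ⊤) (x y : G) : ∃ t₀, ∀ t, t₀ ≤ t →
    (cuspedGraph H S).dist (x, t) (y, t) ≤ 2 * t + cosetDist H S x y + 2 := by
  obtain ⟨x', y', hx, hy, h⟩ := exists_cosetDist (S := S) (x : G ⧸ H) (y : G ⧸ H)
  refine ⟨max ((mulCayley S).dist x x') ((mulCayley S).dist y y'), fun t ht => ?_⟩
  have h1 := dist_high_le hS hx.symm (le_of_max_le_left ht)
  have h2 := dist_high_le hS hy.symm (le_of_max_le_right ht)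
  have h3 := (cuspedGraph_connected H hS).dist_triangle (u := (x, t)) (v := (x', 0)) (w := (y, t))
  have h4 := (cuspedGraph_connected H hS).dist_triangle (u := (x', 0)) (v := (y', 0))
    (w := (y, t))
  have c₁ := (cuspedGraph H S).dist_comm (u := (y', 0)) (v := (y, t))
  omega

/-- The hyperbolicity of the cusped graph passes to the distance of cosets. -/
theorem isProperHyperbolic_cosetDist (hS : Subgroup.closure S = ⊤) (hfin : S.Finite) {δ : ℕ}
    (hδ : ∀ w x y z : G × ℕ, (cuspedGraph H S).dist x z + (cuspedGraph H S).dist w y ≤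
      max ((cuspedGraph H S).dist x y + (cuspedGraph H S).dist w z)
        ((cuspedGraph H S).dist y z + (cuspedGraph H S).dist w x) + δ) :
    IsProperHyperbolic G (cosetDist H S) (δ + 4) where
  self := cosetDist_self
  comm := cosetDist_comm
  smul := cosetDist_smul hS
  -- The inequality is transported from height `t`, and the two upper bounds on the right cost `4`.
  -- The pairs on the left must be distinct because the lower bound `2 * t` fails for points over
  -- the same coset.
  fourPoint q₁ q₂ q₃ q₄ h₁ h₂ := by
    obtain ⟨w, rfl⟩ := QuotientGroup.mk_surjective q₁
    obtain ⟨x, rfl⟩ := QuotientGroup.mk_surjective q₂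
    obtain ⟨y, rfl⟩ := QuotientGroup.mk_surjective q₃
    obtain ⟨z, rfl⟩ := QuotientGroup.mk_surjective q₄
    obtain ⟨t₁, ht₁⟩ := exists_dist_high_le (H := H) hS x y
    obtain ⟨t₂, ht₂⟩ := exists_dist_high_le (H := H) hS w z
    obtain ⟨t₃, ht₃⟩ := exists_dist_high_le (H := H) hS y z
    obtain ⟨t₄, ht₄⟩ := exists_dist_high_le (H := H) hS w x
    obtain ⟨t, ht⟩ : ∃ t, t = t₁ + t₂ + t₃ + t₄ := ⟨_, rfl⟩
    have e₁ := ht₁ t (by omega)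
    have e₂ := ht₂ t (by omega)
    have e₃ := ht₃ t (by omega)
    have e₄ := ht₄ t (by omega)
    have e₅ := add_cosetDist_le (S := S) hS (ξ := (x, t)) (η := (z, t)) h₁
    have e₆ := add_cosetDist_le (S := S) hS (ξ := (w, t)) (η := (y, t)) h₂
    have e₇ := hδ (w, t) (x, t) (y, t) (z, t)
    simp only at e₅ e₆
    omega
  -- The coset under the `m`-th vertex of a geodesic that realizes the distance works: by minimality
  -- this vertex lies over neither end.
  exists_between q q' m hm hlt := by
    obtain ⟨x, y, rfl, rfl, h⟩ := exists_cosetDist (S := S) q q'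
    have hX := cuspedGraph_connected H hS
    obtain ⟨α, hα, hα0, hα1⟩ := exists_isGeodesicSeq hX (x, 0) (y, 0)
    rw [h] at hα hα1
    have e₁ := hα 0 m (by omega) hlt.le
    have e₂ := hα m _ hlt.le le_rfl
    rw [hα0] at e₁
    rw [hα1] at e₂
    obtain ⟨ζ, hζ⟩ : ∃ ζ, ζ = α m := ⟨_, rfl⟩
    rw [← hζ] at e₁ e₂
    have hx : (ζ.1 : G ⧸ H) ≠ (x : G ⧸ H) →
        cosetDist H S (x : G ⧸ H) (ζ.1 : G ⧸ H) ≤ m := fun hne => by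
      have := add_cosetDist_le (S := S) hS (ξ := (x, 0)) (η := ζ) hne.symm
      simp only at this
      omega
    have hy : (ζ.1 : G ⧸ H) ≠ (y : G ⧸ H) →
        cosetDist H S (ζ.1 : G ⧸ H) (y : G ⧸ H) + m ≤ cosetDist H S x y := fun hne => by
      have := add_cosetDist_le (S := S) hS (ξ := ζ) (η := (y, 0)) hne
      simp only at this
      omega
    have hxy : (x : G ⧸ H) ≠ (y : G ⧸ H) := fun he => by
      rw [he, cosetDist_self] at hlt
      omega
    have hne₁ : (ζ.1 : G ⧸ H) ≠ (x : G ⧸ H) := fun he => by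
      have := hy (he ▸ hxy)
      rw [he] at this
      omega
    have hne₂ : (ζ.1 : G ⧸ H) ≠ (y : G ⧸ H) := fun he => by
      have := hx hne₁
      rw [he] at this
      omega
    exact ⟨ζ.1, hne₁, hne₂, hx hne₁, hy hne₂⟩
  -- Seen from high points over `q` and `q'`, a common neighbour must have an element near `(x, 0)`:
  -- the four point inequality bounds the exit point of its horoball on the way to `(x, 0)`, and
  -- balls at level `0` are finite.
  finite_inter q q' n hne := by
    obtain ⟨x, rfl⟩ := QuotientGroup.mk_surjective q
    obtain ⟨y, rfl⟩ := QuotientGroup.mk_surjective q'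
    have hX := cuspedGraph_connected H hS
    obtain ⟨L, hL⟩ : ∃ L, L = (cuspedGraph H S).dist (x, 0) (y, 0) := ⟨_, rfl⟩
    have hball := (finite_cusped_ball (H := H) hS hfin (L + n + 2 + δ)).image
      fun g => ((x * g : G) : G ⧸ H)
    refine (hball.insert (x : G ⧸ H)).subset ?_
    rintro q'' ⟨h1, h2⟩
    obtain ⟨z, rfl⟩ := QuotientGroup.mk_surjective q''
    by_cases hzx : (z : G ⧸ H) = (x : G ⧸ H)
    · exact Or.inl hzx
    obtain ⟨t₁, ht₁⟩ := exists_dist_high_le (H := H) hS x z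
    obtain ⟨t₂, ht₂⟩ := exists_dist_high_le (H := H) hS y z
    obtain ⟨t, ht⟩ : ∃ t, t = t₁ + t₂ := ⟨_, rfl⟩
    have e₁ := ht₁ t (by omega)
    have e₂ := ht₂ t (by omega)
    have e₃ := add_cosetDist_le (S := S) hS (ξ := (x, t)) (η := (y, t)) hne
    have e₄ := cusped_dist_vertical (H := H) hS x 0 t
    have e₅ := cusped_dist_vertical (H := H) hS y 0 t
    have e₆ := hX.dist_triangle (u := (x, 0)) (v := (y, 0)) (w := (y, t))
    have e₇ := hδ (x, t) (x, 0) (y, t) (z, t)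
    obtain ⟨z', hz', e₈⟩ := exists_exit (S := S) hS (ξ := (z, t)) (η := (x, 0)) hzx
    have e₉ := level_le_add_dist (H := H) hS (z', 0) (z, t)
    have c₁ := (cuspedGraph H S).dist_comm (u := (z', 0)) (v := (z, t))
    have c₂ := (cuspedGraph H S).dist_comm (u := (x, 0)) (v := (z, t))
    have c₃ := (cuspedGraph H S).dist_comm (u := (x, 0)) (v := (x, t))
    have c₄ := (cuspedGraph H S).dist_comm (u := (x, 0)) (v := (z', 0))
    rw [zero_add] at e₄ e₅
    simp only [zero_add] at e₃ e₉
    refine Or.inr ⟨x⁻¹ * z', ?_, by simpa using hz'⟩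
    have e₁₀ := cusped_dist_mul_left (H := H) hS x⁻¹ (x, 0) (z', 0)
    simp only [inv_mul_cancel] at e₁₀
    simp only [Set.mem_ofPred_eq]
    omega
  -- Both `x` and `g * x` start shortest connections from the coset of `x` to that of `y`. Such a
  -- point is coarsely unique, so `g * x` lies within `δ + 1` of `x`.
  finite_stabilizer q q' hne := by
    obtain ⟨x, y, rfl, rfl, h⟩ := exists_cosetDist (S := S) q q'
    have hX := cuspedGraph_connected H hS
    have hball := (finite_cusped_ball (H := H) hS hfin (δ + 1)).image fun g => x * g * x⁻¹
    refine hball.subset ?_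
    rintro g ⟨h1, h2⟩
    refine ⟨x⁻¹ * (g * x), ?_, by simp [mul_assoc]⟩
    obtain ⟨t, ht⟩ : ∃ t, t = (mulCayley S).dist x (g * x) + (mulCayley S).dist y (g * y) :=
      ⟨_, rfl⟩
    have e₁ := add_cosetDist_le (S := S) hS (ξ := (x, t)) (η := (y, t)) hne
    have e₂ := cusped_dist_vertical (H := H) hS x 0 t
    have e₃ := cusped_dist_vertical (H := H) hS y 0 t
    have e₄ := dist_high_le (H := H) hS (x := x) (y := g * x) (t := t) h1.symm (by omega)
    have e₅ := dist_high_le (H := H) hS (x := y) (y := g * y) (t := t) h2.symm (by omega)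
    have e₆ := hX.dist_triangle (u := (x, 0)) (v := (y, 0)) (w := (y, t))
    have e₇ := hX.dist_triangle (u := (g * x, 0)) (v := (g * y, 0)) (w := (y, t))
    have e₈ := cusped_dist_mul_left (H := H) hS g (x, 0) (y, 0)
    have e₉ := hδ (x, t) (x, 0) (y, t) (g * x, 0)
    have e₁₀ := cusped_dist_mul_left (H := H) hS x⁻¹ (x, 0) (g * x, 0)
    have c₁ := (cuspedGraph H S).dist_comm (u := (x, 0)) (v := (x, t))
    have c₂ := (cuspedGraph H S).dist_comm (u := (g * x, 0)) (v := (x, t))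
    have c₃ := (cuspedGraph H S).dist_comm (u := (g * y, 0)) (v := (y, t))
    have c₄ := (cuspedGraph H S).dist_comm (u := (g * x, 0)) (v := (y, t))
    rw [zero_add] at e₂ e₃
    simp only [inv_mul_cancel] at e₁₀
    simp only at e₁ e₈
    simp only [Set.mem_ofPred_eq]
    omega
  cofinite n := by
    refine ⟨(fun g : G => (((1 : G) : G ⧸ H), (g : G ⧸ H))) ''
      {g : G | (cuspedGraph H S).dist (1, 0) (g, 0) ≤ n},
      (finite_cusped_ball hS hfin n).image _, fun q q' hle => ?_⟩
    obtain ⟨x, y, rfl, rfl, h⟩ := exists_cosetDist (S := S) q q'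
    refine ⟨x⁻¹, x⁻¹ * y, ?_, ?_⟩
    · have e := cusped_dist_mul_left (H := H) hS x⁻¹ (x, 0) (y, 0)
      simp only [inv_mul_cancel] at e
      simp only [Set.mem_ofPred_eq]
      omega
    · change _ = (((x⁻¹ * x : G) : G ⧸ H), ((x⁻¹ * y : G) : G ⧸ H))
      rw [inv_mul_cancel]

end CosetDistance
end RelHyp
end

noncomputable section
namespace RelHyp

/-! ### Rips chains in the exterior algebra, and Rips' acyclicity argument. -/

section Exterior

open ExteriorAlgebra

variable {M : Type u} [AddCommGroup M]

/-! ### Contractions of monomials in the exterior algebra -/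

/-- The contraction of the exterior algebra by a linear functional. -/
def contract (d : Module.Dual ℤ M) : ExteriorAlgebra ℤ M →ₗ[ℤ] ExteriorAlgebra ℤ M :=
  CliffordAlgebra.contractLeft d

lemma contract_ι_mul (d : Module.Dual ℤ M) (a : M) (x : ExteriorAlgebra ℤ M) :
    contract d (ι ℤ a * x) = d a • x - ι ℤ a * contract d x :=
  CliffordAlgebra.contractLeft_ι_mul d a x

lemma contract_one (d : Module.Dual ℤ M) : contract d 1 = 0 :=
  CliffordAlgebra.contractLeft_one _ d

lemma contract_algebraMap (d : Module.Dual ℤ M) (r : ℤ) : contract d (algebraMap ℤ _ r) = 0 :=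
  CliffordAlgebra.contractLeft_algebraMap _ d r

lemma contract_contract (d : Module.Dual ℤ M) (x : ExteriorAlgebra ℤ M) :
    contract d (contract d x) = 0 :=
  CliffordAlgebra.contractLeft_contractLeft d x

lemma contract_comm (d d' : Module.Dual ℤ M) (x : ExteriorAlgebra ℤ M) :
    contract d (contract d' x) = -contract d' (contract d x) :=
  CliffordAlgebra.contractLeft_comm d d' x

lemma contract_map (d : Module.Dual ℤ M) (f : M →ₗ[ℤ] M) (x : ExteriorAlgebra ℤ M) :
    contract d (ExteriorAlgebra.map f x) = ExteriorAlgebra.map f (contract (d ∘ₗ f) x) := by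
  induction x using CliffordAlgebra.left_induction with
  | algebraMap r => rw [AlgHom.commutes, contract_algebraMap, contract_algebraMap, map_zero]
  | add x y hx hy => simp only [map_add, hx, hy]
  | ι_mul x m hx =>
    change contract d (ExteriorAlgebra.map f (ι ℤ m * x)) =
      ExteriorAlgebra.map f (contract (d ∘ₗ f) (ι ℤ m * x))
    rw [map_mul, map_apply_ι, contract_ι_mul, contract_ι_mul, hx, map_sub, map_mul, map_zsmul,
      map_apply_ι]
    rfl

variable {V : Type u} (b : Module.Basis V ℤ M)

/-- The product of the basis vectors in a list. -/
def wedge (l : List V) : ExteriorAlgebra ℤ M := (l.map fun v => ι ℤ (b v)).prod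

lemma wedge_nil : wedge b [] = 1 := rfl

lemma wedge_cons (v : V) (l : List V) : wedge b (v :: l) = ι ℤ (b v) * wedge b l := by
  simp [wedge]

lemma contract_wedge_mem (d : Module.Dual ℤ M) (l : List V) :
    contract d (wedge b l) ∈ Submodule.span ℤ
      {x | ∃ l' : List V, l' ⊆ l ∧ l'.length + 1 = l.length ∧ wedge b l' = x} := by
  induction l with
  | nil => rw [wedge_nil, contract_one]; exact zero_mem _
  | cons v l ih =>
    rw [wedge_cons, contract_ι_mul]
    refine sub_mem (Submodule.smul_mem _ _ (Submodule.subset_span ⟨l, by simp, by simp, rfl⟩)) ?_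
    have h : Submodule.span ℤ {x | ∃ l' : List V, l' ⊆ l ∧ l'.length + 1 = l.length ∧
        wedge b l' = x} ≤ (Submodule.span ℤ {x | ∃ l' : List V, l' ⊆ v :: l ∧
          l'.length + 1 = (v :: l).length ∧ wedge b l' = x}).comap
            (LinearMap.mulLeft ℤ (ι ℤ (b v))) := by
      rw [Submodule.span_le]
      rintro _ ⟨l', h1, h2, rfl⟩
      refine Submodule.subset_span ⟨v :: l', List.cons_subset_cons v h1, by simp [h2], ?_⟩
      rw [wedge_cons, LinearMap.mulLeft_apply]
    exact h ih

lemma contract_coord_wedge_of_notMem {u : V} {l : List V} (h : u ∉ l) :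
    contract (b.coord u) (wedge b l) = 0 := by
  induction l with
  | nil => rw [wedge_nil, contract_one]
  | cons v l ih =>
    rw [List.mem_cons, not_or] at h
    rw [wedge_cons, contract_ι_mul, ih h.2]
    simp [Ne.symm h.1]

open Classical in
/-- Replacing a vertex in a monomial. -/
lemma wedge_map_update (u u' : V) (l : List V) :
    wedge b (l.map (Function.update id u u')) =
      wedge b l + ι ℤ (b u' - b u) * contract (b.coord u) (wedge b l) := by
  induction l with
  | nil => simp [wedge_nil, contract_one]
  | cons v l ih =>
    rw [List.map_cons, wedge_cons, wedge_cons, contract_ι_mul, ih]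
    have h1 : b (Function.update id u u' v) = b v + b.coord u (b v) • (b u' - b u) := by
      by_cases h : v = u
      · subst h; simp
      · simp [h]
    rw [h1]
    generalize b u' - b u = x
    generalize b.coord u (b v) = c
    generalize contract (b.coord u) (wedge b l) = y
    generalize wedge b l = m
    have h2 : ι ℤ (b v) * ι ℤ x = -(ι ℤ x * ι ℤ (b v)) := eq_neg_of_add_eq_zero_left
      (ι_add_mul_swap _ _)
    have h3 := ι_sq_zero (R := ℤ) x
    simp only [map_add, map_zsmul, add_mul, mul_add, mul_sub, smul_mul_assoc, mul_smul_comm,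
      ← mul_assoc, h2, h3, neg_mul, zero_mul, smul_zero]
    abel

lemma wedge_perm {l l' : List V} (h : l.Perm l') : wedge b l = wedge b l' ∨
    wedge b l = -wedge b l' := by
  induction h with
  | nil => exact Or.inl rfl
  | cons v _ ih =>
    rw [wedge_cons, wedge_cons]
    rcases ih with ih | ih <;> rw [ih]
    · exact Or.inl rfl
    · exact Or.inr (mul_neg _ _)
  | swap v w l =>
    right
    rw [wedge_cons, wedge_cons, wedge_cons, wedge_cons, ← mul_assoc, ← mul_assoc,
      eq_neg_of_add_eq_zero_left (ι_add_mul_swap (R := ℤ) (b w) (b v)), neg_mul]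
  | trans _ _ ih₁ ih₂ =>
    rcases ih₁ with ih₁ | ih₁ <;> rcases ih₂ with ih₂ | ih₂ <;> simp [ih₁, ih₂]

lemma wedge_of_not_nodup {l : List V} (h : ¬ l.Nodup) : wedge b l = 0 := by
  obtain ⟨v, hv⟩ := List.exists_duplicate_iff_not_nodup.2 h
  obtain ⟨l', hl'⟩ := (List.duplicate_iff_sublist.1 hv).exists_perm_append
  have h0 : wedge b ([v, v] ++ l') = 0 := by
    rw [List.cons_append, List.cons_append, List.nil_append, wedge_cons, wedge_cons, ← mul_assoc,
      ι_sq_zero, zero_mul]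
  rcases wedge_perm b hl' with h1 | h1 <;> rw [h1, h0]
  exact neg_zero

/-- The functional that is dual to a monomial. -/
def wedgeCoord : List V → ExteriorAlgebra ℤ M →ₗ[ℤ] ℤ
  | [] => (algebraMapInv : ExteriorAlgebra ℤ M →ₐ[ℤ] ℤ).toLinearMap
  | v :: l => wedgeCoord l ∘ₗ contract (b.coord v)

lemma wedgeCoord_self {l : List V} (h : l.Nodup) : wedgeCoord b l (wedge b l) = 1 := by
  induction l with
  | nil => simp [wedgeCoord, wedge_nil]
  | cons v l ih =>
    rw [List.nodup_cons] at h
    rw [wedgeCoord, LinearMap.comp_apply, wedge_cons, contract_ι_mul,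
      contract_coord_wedge_of_notMem b h.1]
    simp [ih h.2]

lemma wedgeCoord_eq_zero {u : V} {l l' : List V} (hu : u ∈ l) (hu' : u ∉ l') :
    wedgeCoord b l (wedge b l') = 0 := by
  -- Contracting a monomial gives a combination of monomials, so the induction runs over the span of
  -- those avoiding `u`.
  suffices ∀ x ∈ Submodule.span ℤ {x | ∃ l' : List V, u ∉ l' ∧ wedge b l' = x},
      wedgeCoord b l x = 0 from this _ (Submodule.subset_span ⟨l', hu', rfl⟩)
  clear hu'
  induction l with
  | nil => simp at hu
  | cons v l ih =>
    intro x hx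
    rw [wedgeCoord, LinearMap.comp_apply]
    by_cases huv : u = v
    · subst huv
      have : contract (b.coord u) x = 0 := by
        induction hx using Submodule.span_induction with
        | mem x hx =>
          obtain ⟨l', h, rfl⟩ := hx
          exact contract_coord_wedge_of_notMem b h
        | zero => exact map_zero _
        | add x y _ _ hx hy => rw [map_add, hx, hy, add_zero]
        | smul r x _ hx => rw [map_smul, hx, smul_zero]
      rw [this, map_zero]
    · refine ih ((List.mem_cons.1 hu).resolve_left huv) _ ?_
      induction hx using Submodule.span_induction with
      | mem x hx =>
        obtain ⟨l', h, rfl⟩ := hx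
        refine Submodule.span_mono ?_ (contract_wedge_mem b _ l')
        rintro _ ⟨l'', h1, -, rfl⟩
        exact ⟨l'', fun h2 => h (h1 h2), rfl⟩
      | zero => rw [map_zero]; exact zero_mem _
      | add x y _ _ hx hy => rw [map_add]; exact add_mem hx hy
      | smul r x _ hx => rw [map_smul]; exact Submodule.smul_mem _ _ hx

/-! ### The Rips complex and its acyclicity -/

variable (D : V → V → ℕ)

/-- The chains of the Rips complex on `k` vertices, supported on a set `F` of vertices. -/
def ripsChains (N k : ℕ) (F : Set V) : Submodule ℤ (ExteriorAlgebra ℤ M) :=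
  Submodule.span ℤ {x | ∃ l : List V, l.length = k ∧ (∀ v ∈ l, v ∈ F) ∧
    (∀ v ∈ l, ∀ w ∈ l, D v w ≤ N) ∧ wedge b l = x}

variable {D} {N k : ℕ}

lemma ripsChains_mono {F F' : Set V} (h : F ⊆ F') :
    ripsChains b D N k F ≤ ripsChains b D N k F' := by
  refine Submodule.span_mono ?_
  rintro _ ⟨l, h1, h2, h3, rfl⟩
  exact ⟨l, h1, fun v hv => h (h2 v hv), h3, rfl⟩

lemma contract_mem_ripsChains (d : Module.Dual ℤ M) {F : Set V} {x : ExteriorAlgebra ℤ M}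
    (hx : x ∈ ripsChains b D N (k + 1) F) : contract d x ∈ ripsChains b D N k F := by
  have h : ripsChains b D N (k + 1) F ≤ (ripsChains b D N k F).comap (contract d) := by
    refine Submodule.span_le.2 ?_
    rintro _ ⟨l, h1, h2, h3, rfl⟩
    refine Submodule.span_mono ?_ (contract_wedge_mem b d l)
    rintro _ ⟨l', h4, h5, rfl⟩
    exact ⟨l', by omega, fun v hv => h2 v (h4 hv), fun v hv w hw => h3 v (h4 hv) w (h4 hw), rfl⟩
  exact h hx

lemma exists_finset_mem_ripsChains {x : ExteriorAlgebra ℤ M}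
    (hx : x ∈ ripsChains b D N k Set.univ) :
    ∃ F : Finset V, x ∈ ripsChains b D N k (F : Set V) := by
  classical
  induction hx using Submodule.span_induction with
  | mem x hx =>
    obtain ⟨l, h1, -, h3, rfl⟩ := hx
    exact ⟨l.toFinset, Submodule.subset_span ⟨l, h1, by simp, h3, rfl⟩⟩
  | zero => exact ⟨∅, zero_mem _⟩
  | add x y _ _ hx hy =>
    obtain ⟨F, hF⟩ := hx
    obtain ⟨F', hF'⟩ := hy
    refine ⟨F ∪ F', add_mem (ripsChains_mono b ?_ hF) (ripsChains_mono b ?_ hF')⟩ <;> simp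
  | smul r x _ hx =>
    obtain ⟨F, hF⟩ := hx
    exact ⟨F, Submodule.smul_mem _ _ hF⟩

/-- A chain all of whose vertices are close to `o` can be coned off from `o`. -/
lemma ι_mul_mem_ripsChains (hself : ∀ v, D v v = 0) (hcomm : ∀ v w, D v w = D w v) {F : Set V}
    {o : V} (ho : ∀ v ∈ F, D v o ≤ N) {x : ExteriorAlgebra ℤ M} (hx : x ∈ ripsChains b D N k F) :
    ι ℤ (b o) * x ∈ ripsChains b D N (k + 1) Set.univ := by
  have h : ripsChains b D N k F ≤ (ripsChains b D N (k + 1) Set.univ).comap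
      (LinearMap.mulLeft ℤ (ι ℤ (b o))) := by
    refine Submodule.span_le.2 ?_
    rintro _ ⟨l, h1, h2, h3, rfl⟩
    refine Submodule.subset_span ⟨o :: l, by simp [h1], by simp, ?_, ?_⟩
    · intro v hv w hw
      rcases List.mem_cons.1 hv with rfl | hv' <;> rcases List.mem_cons.1 hw with rfl | hw'
      · rw [hself]; exact Nat.zero_le _
      · rw [hcomm]; exact ho w (h2 w hw')
      · exact ho v (h2 v hv')
      · exact h3 v hv' w hw'
    · rw [wedge_cons, LinearMap.mulLeft_apply]
  exact h hx

open Classical in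
/-- Pushing a vertex `u` to `u'`. -/
lemma push_mem_ripsChains (hself : ∀ v, D v v = 0) (hcomm : ∀ v w, D v w = D w v) {F : Finset V}
    {u u' : V} (hu : ∀ w ∈ F, D w u ≤ N → D w u' ≤ N) {x : ExteriorAlgebra ℤ M}
    (hx : x ∈ ripsChains b D N k (F : Set V)) :
    x + ι ℤ (b u' - b u) * contract (b.coord u) x ∈
        ripsChains b D N k (insert u' (F.erase u) : Finset V) ∧
      ι ℤ (b u') * (ι ℤ (b u) * contract (b.coord u) x) ∈ ripsChains b D N (k + 1) Set.univ := by
  have hclose : ∀ l : List V, (∀ v ∈ l, v ∈ F) → (∀ v ∈ l, ∀ w ∈ l, D v w ≤ N) → u ∈ l →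
      ∀ v ∈ l, D v u' ≤ N :=
    fun l h2 h3 hul v hv => hu v (h2 v hv) (h3 v hv u hul)
  constructor
  · have h : ripsChains b D N k (F : Set V) ≤
        (ripsChains b D N k (insert u' (F.erase u) : Finset V)).comap
          (LinearMap.id + LinearMap.mulLeft ℤ (ι ℤ (b u' - b u)) ∘ₗ contract (b.coord u)) := by
      refine Submodule.span_le.2 ?_
      rintro _ ⟨l, h1, h2, h3, rfl⟩
      refine Submodule.subset_span ⟨l.map (Function.update id u u'), by simp [h1], ?_, ?_, ?_⟩
      · intro v hv
        obtain ⟨w, hw, rfl⟩ := List.mem_map.1 hv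
        by_cases hwu : w = u
        · simp [hwu]
        · simpa [Function.update_of_ne hwu, hwu] using Or.inr (h2 w hw)
      · intro v hv w hw
        obtain ⟨v, hv', rfl⟩ := List.mem_map.1 hv
        obtain ⟨w, hw', rfl⟩ := List.mem_map.1 hw
        by_cases hvu : v = u <;> by_cases hwu : w = u
        · subst hvu hwu
          simp [hself]
        · subst hvu
          rw [Function.update_self, Function.update_of_ne hwu, id, hcomm]
          exact hclose l h2 h3 hv' w hw'
        · subst hwu
          rw [Function.update_self, Function.update_of_ne hvu, id]
          exact hclose l h2 h3 hw' v hv'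
        · rw [Function.update_of_ne hvu, Function.update_of_ne hwu]
          exact h3 v hv' w hw'
      · rw [wedge_map_update]
        rfl
    exact h hx
  · have h : ripsChains b D N k (F : Set V) ≤ (ripsChains b D N (k + 1) Set.univ).comap
        (LinearMap.mulLeft ℤ (ι ℤ (b u')) ∘ₗ LinearMap.mulLeft ℤ (ι ℤ (b u)) ∘ₗ
          contract (b.coord u)) := by
      refine Submodule.span_le.2 ?_
      rintro _ ⟨l, h1, h2, h3, rfl⟩
      by_cases hul : u ∈ l
      swap
      · simp [contract_coord_wedge_of_notMem b hul]
      rw [SetLike.mem_coe, Submodule.mem_comap, LinearMap.comp_apply, LinearMap.comp_apply]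
      have h4 := contract_wedge_mem b (b.coord u) l
      rw [← Submodule.mem_comap, ← Submodule.mem_comap]
      refine Submodule.span_le.2 ?_ h4
      rintro _ ⟨l', h5, h6, rfl⟩
      have hsub : u :: l' ⊆ l := List.cons_subset.2 ⟨hul, h5⟩
      refine Submodule.subset_span ⟨u' :: u :: l', by simp only [List.length_cons]; omega,
        by simp, ?_, ?_⟩
      · intro v hv w hw
        rcases List.mem_cons.1 hv with rfl | hv' <;> rcases List.mem_cons.1 hw with rfl | hw'
        · rw [hself]; exact Nat.zero_le _
        · rw [hcomm]; exact hclose l h2 h3 hul w (hsub hw')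
        · exact hclose l h2 h3 hul v (hsub hv')
        · exact h3 v (hsub hv') w (hsub hw')
      · simp [wedge_cons]
    exact h hx

open Classical in
/-- The Rips complex is acyclic for large parameters. -/
theorem exists_contract_eq {G : Type u} [Group G] [MulAction G V] {c : ℕ}
    (hD : IsProperHyperbolic G D c) (hN : N = 2 * c + 2) {aug : Module.Dual ℤ M}
    (haug : ∀ v, aug (b v) = 1) (o : V) {x : ExteriorAlgebra ℤ M}
    (hx : x ∈ ripsChains b D N k Set.univ) (hx0 : contract aug x = 0) :
    ∃ y ∈ ripsChains b D N (k + 1) Set.univ, contract aug y = x := by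
  obtain ⟨F, hF⟩ := exists_finset_mem_ripsChains b hx
  clear hx
  obtain ⟨n, hn⟩ : ∃ n, n = ∑ v ∈ F, D v o := ⟨_, rfl⟩
  induction n using Nat.strong_induction_on generalizing F x with
  | _ n ih =>
  by_cases hclose : ∀ v ∈ F, D v o ≤ N
  · refine ⟨ι ℤ (b o) * x, ι_mul_mem_ripsChains b hD.self hD.comm hclose hF, ?_⟩
    rw [contract_ι_mul, hx0, haug]
    simp
  push Not at hclose
  obtain ⟨v, hv, hvN⟩ := hclose
  obtain ⟨u, huF, humax⟩ := F.exists_max_image (fun v => D v o) ⟨v, hv⟩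
  have huN : N < D u o := hvN.trans_le (humax v hv)
  -- The farthest vertex `u` moves `c + 1` towards `o`. In the four point inequality for `hpush`,
  -- one alternative gives `2 * c + 1`, since `w` is no farther from `o` than `u`; the other gives
  -- `N - 1`, since `u'` is `c + 1` closer to `o`.
  obtain ⟨u', hu'u, hu'o, h1, h2⟩ := hD.exists_between u o (c + 1) (by omega) (by omega)
  have huo : u ≠ o := fun h => by
    rw [h, hD.self] at huN
    omega
  have hpush : ∀ w ∈ F, D w u ≤ N → D w u' ≤ N := by
    intro w hw hwu
    by_cases hwu' : w = u'
    · rw [hwu', hD.self]; exact Nat.zero_le _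
    have h3 := hD.fourPoint u w o u' hwu' huo
    have h4 := humax w hw
    have c₁ := hD.comm o u'
    have c₂ := hD.comm u w
    omega
  obtain ⟨hm₁, hm₂⟩ := push_mem_ripsChains b hD.self hD.comm hpush hF
  have ha0 : contract aug (contract (b.coord u) x) = 0 := by
    rw [contract_comm, hx0, map_zero, neg_zero]
  -- Pushing is a homotopy: the contraction of the cycle `x` along `u` is again a cycle, so this
  -- prism accounts exactly for the difference between `x` and the pushed chain.
  have hbd : contract aug (ι ℤ (b u') * (ι ℤ (b u) * contract (b.coord u) x)) =
      -(ι ℤ (b u' - b u) * contract (b.coord u) x) := by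
    rw [contract_ι_mul, contract_ι_mul, ha0, haug, haug, map_sub, sub_mul]
    simp
  -- The total distance of the supporting vertices to `o` decreases, even if `u'` was already among
  -- them.
  have hlt : ∑ v ∈ insert u' (F.erase u), D v o < n := by
    have h3 : ∑ v ∈ insert u' (F.erase u), D v o ≤ D u' o + ∑ v ∈ F.erase u, D v o := by
      by_cases h : u' ∈ F.erase u
      · rw [Finset.insert_eq_of_mem h]; omega
      · rw [Finset.sum_insert h]
    have h4 := Finset.add_sum_erase F (fun v => D v o) huF
    omega
  obtain ⟨y, hy, hxy⟩ := ih _ hlt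
    (x := x + ι ℤ (b u' - b u) * contract (b.coord u) x) (by
      have := congrArg (contract aug) hbd
      rw [contract_contract, map_neg] at this
      rw [map_add, hx0, zero_add]
      exact (neg_eq_zero.1 this.symm)) _ hm₁ rfl
  refine ⟨y + ι ℤ (b u') * (ι ℤ (b u) * contract (b.coord u) x), add_mem hy hm₂, ?_⟩
  rw [map_add, hxy, hbd, add_neg_cancel_right]

end Exterior
end RelHyp
end

noncomputable section
namespace RelHyp

/-! ### Free and cofinite action on simplices, and freeness of the chain modules. -/

section Rips

open scoped Pointwise Classical

variable {G : Type u} [Group G] {V : Type u} [MulAction G V] {D : V → V → ℕ} {c : ℕ}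

/-! ### The action on the simplices of the Rips complex -/

/-- The simplices of the Rips complex with `k` vertices. -/
def ripsSimplices (D : V → V → ℕ) (N k : ℕ) : Set (Finset V) :=
  {s | s.card = k ∧ ∀ v ∈ s, ∀ w ∈ s, D v w ≤ N}

namespace IsProperHyperbolic

lemma smul_mem_ripsSimplices (hD : IsProperHyperbolic G D c) {N k : ℕ} (g : G) {s : Finset V}
    (hs : s ∈ ripsSimplices D N k) : g • s ∈ ripsSimplices D N k := by
  refine ⟨by rw [Finset.card_smul_finset]; exact hs.1, fun v hv w hw => ?_⟩
  obtain ⟨v, hv', rfl⟩ := Finset.mem_smul_finset.1 hv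
  obtain ⟨w, hw', rfl⟩ := Finset.mem_smul_finset.1 hw
  rw [hD.smul]
  exact hs.2 v hv' w hw'

lemma exists_finite_simplices (hD : IsProperHyperbolic G D c) (N : ℕ) :
    ∃ T : Set (Finset V), T.Finite ∧ ∀ k, 2 ≤ k → ∀ s ∈ ripsSimplices D N k,
      ∃ g : G, g • s ∈ T := by
  obtain ⟨T, hT, hcof⟩ := hD.cofinite N
  refine ⟨⋃ p ∈ T ∩ {p | p.1 ≠ p.2}, {t | (t : Set V) ⊆ {v | D p.1 v ≤ N ∧ D p.2 v ≤ N}}, ?_, ?_⟩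
  · refine (hT.inter_of_left _).biUnion fun p hp => ?_
    have hfin := hD.finite_inter p.1 p.2 N hp.2
    refine hfin.toFinset.powerset.finite_toSet.subset fun t ht => ?_
    rw [Finset.mem_coe, Finset.mem_powerset]
    intro v hv
    exact hfin.mem_toFinset.2 (ht hv)
  · intro k hk s hs
    obtain ⟨v, hv, w, hw, hvw⟩ := Finset.one_lt_card.1 (hk.trans_eq hs.1.symm)
    obtain ⟨g, hg⟩ := hcof v w (hs.2 v hv w hw)
    refine ⟨g, Set.mem_biUnion (x := (g • v, g • w)) ⟨hg, fun h => hvw (smul_left_cancel g h)⟩ ?_⟩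
    intro x hx
    obtain ⟨x, hx', rfl⟩ := Finset.mem_smul_finset.1 hx
    exact ⟨(hD.smul g v x).trans_le (hs.2 v hv x hx'),
      (hD.smul g w x).trans_le (hs.2 w hw x hx')⟩

/-- In a torsion-free group the stabilizers of simplices of positive dimension are trivial. -/
lemma eq_one_of_smul_eq (hD : IsProperHyperbolic G D c) (hG : ∀ g : G, IsOfFinOrder g → g = 1)
    {s : Finset V} (hs : 2 ≤ s.card) {g : G} (hg : g • s = s) : g = 1 := by
  refine hG g ?_
  by_contra hinf
  have hinj : Function.Injective fun n : ℕ => g ^ n :=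
    injective_pow_iff_not_isOfFinOrder.2 hinf
  obtain ⟨v, hv, w, hw, hvw⟩ := Finset.one_lt_card.1 hs
  have hpow : ∀ (n : ℕ), ∀ x ∈ s, g ^ n • x ∈ s := by
    intro n
    induction n with
    | zero => simp
    | succ n ih =>
      intro x hx
      rw [pow_succ', mul_smul, ← hg]
      exact Finset.smul_mem_smul_finset (ih x hx)
  -- Two powers with the same effect on `v` and `w` differ by an element of their finite common
  -- stabilizer. The powers permute a finite set, so infinitely many distinct ones cannot fit.
  have hfib : ∀ x y : V, {n : ℕ | g ^ n • v = x ∧ g ^ n • w = y}.Finite := by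
    intro x y
    rcases Set.eq_empty_or_nonempty {n : ℕ | g ^ n • v = x ∧ g ^ n • w = y} with h | ⟨m, hm₁, hm₂⟩
    · rw [h]; exact Set.finite_empty
    refine ((hD.finite_stabilizer v w hvw).preimage
      (f := fun n : ℕ => (g ^ m)⁻¹ * g ^ n) ?_).subset ?_
    · exact fun a _ a' _ h => hinj (mul_left_cancel h)
    · rintro n ⟨h1, h2⟩
      change ((g ^ m)⁻¹ * g ^ n) • v = v ∧ ((g ^ m)⁻¹ * g ^ n) • w = w
      rw [mul_smul, mul_smul, h1, h2, ← hm₁, ← hm₂, inv_smul_smul, inv_smul_smul]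
      exact ⟨rfl, rfl⟩
  refine Set.infinite_univ (α := ℕ) (((s ×ˢ s).finite_toSet.biUnion
    fun p _ => hfib p.1 p.2).subset fun n _ => ?_)
  exact Set.mem_biUnion (x := (g ^ n • v, g ^ n • w))
    (by simp [hpow n v hv, hpow n w hw]) ⟨rfl, rfl⟩

end IsProperHyperbolic

/-- A set of representatives for the orbits of simplices. -/
def ripsReps (G : Type u) [Group G] {V : Type u} [MulAction G V] (D : V → V → ℕ) (N k : ℕ) :
    Set (Finset V) :=
  {s ∈ ripsSimplices D N k | (Quotient.mk (MulAction.orbitRel G (Finset V)) s).out = s}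

lemma eq_of_mem_ripsReps {N k : ℕ} {s t : Finset V} (hs : s ∈ ripsReps G D N k)
    (ht : t ∈ ripsReps G D N k) {g : G} (h : g • s = t) : s = t := by
  rw [← hs.2, ← ht.2]
  congr 1
  refine Quotient.sound ?_
  change s ∈ MulAction.orbit G t
  exact ⟨g⁻¹, by simp [← h]⟩

lemma out_mem_ripsReps (hD : IsProperHyperbolic G D c) {N k : ℕ} {s : Finset V}
    (hs : s ∈ ripsSimplices D N k) :
    ∃ g : G, g • (Quotient.mk (MulAction.orbitRel G (Finset V)) s).out = s ∧
      (Quotient.mk (MulAction.orbitRel G (Finset V)) s).out ∈ ripsReps G D N k := by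
  have h : (MulAction.orbitRel G (Finset V)) (Quotient.mk _ s).out s := Quotient.mk_out s
  obtain ⟨g, hg⟩ := h
  refine ⟨g⁻¹, by rw [← hg]; simp, ?_, by rw [Quotient.out_eq]⟩
  rw [← hg]
  exact hD.smul_mem_ripsSimplices g hs

lemma finite_ripsReps (hD : IsProperHyperbolic G D c) {N k : ℕ} (hk : 2 ≤ k) :
    (ripsReps G D N k).Finite := by
  obtain ⟨T, hT, h⟩ := hD.exists_finite_simplices N
  refine (hT.image fun t => (Quotient.mk (MulAction.orbitRel G (Finset V)) t).out).subset ?_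
  intro s hs
  obtain ⟨g, hg⟩ := h k hk s hs.1
  refine ⟨g • s, hg, ?_⟩
  rw [← hs.2]
  simp only
  congr 1
  rw [hs.2]
  exact Quotient.sound ⟨g, rfl⟩

/-! ### The chain modules -/

open ExteriorAlgebra

variable {M : Type u} [AddCommGroup M]

/-- The representation on the exterior algebra that is induced by a representation. -/
def extRep (ρ : Representation ℤ G M) : Representation ℤ G (ExteriorAlgebra ℤ M) where
  toFun g := (ExteriorAlgebra.map (ρ g)).toLinearMap
  map_one' := by
    rw [map_one]
    change (ExteriorAlgebra.map LinearMap.id).toLinearMap = _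
    rw [ExteriorAlgebra.map_id]
    rfl
  map_mul' g h := by
    rw [map_mul]
    change (ExteriorAlgebra.map (ρ g ∘ₗ ρ h)).toLinearMap = _
    rw [← ExteriorAlgebra.map_comp_map]
    rfl

lemma extRep_apply (ρ : Representation ℤ G M) (g : G) (x : ExteriorAlgebra ℤ M) :
    extRep ρ g x = ExteriorAlgebra.map (ρ g) x := rfl

variable {ρ : Representation ℤ G M} {b : Module.Basis V ℤ M}

lemma extRep_wedge (hρ : ∀ g v, ρ g (b v) = b (g • v)) (g : G) (l : List V) :
    extRep ρ g (wedge b l) = wedge b (l.map (g • ·)) := by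
  rw [extRep_apply, wedge, map_list_prod, wedge, List.map_map, List.map_map]
  simp [Function.comp_def, hρ]

/-- An invariant subspace of a representation, as a module over the group ring. -/
def invariantSubmodule {W : Type u} [AddCommGroup W] (σ : Representation ℤ G W)
    (p : Submodule ℤ W) (hp : ∀ g, ∀ x ∈ p, σ g x ∈ p) :
    Submodule (MonoidAlgebra ℤ G) σ.asModule where
  carrier := {x | σ.asModuleEquiv x ∈ p}
  add_mem' hx hy := p.add_mem hx hy
  zero_mem' := p.zero_mem
  smul_mem' a x hx := by
    induction a using MonoidAlgebra.induction_linear with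
    | zero => rw [zero_smul]; exact p.zero_mem
    | add a a' ha ha' => rw [add_smul]; exact p.add_mem ha ha'
    | single g n =>
      rw [Representation.single_smul]
      exact p.smul_mem n (hp g _ hx)

lemma extRep_mem_ripsChains (hD : IsProperHyperbolic G D c) (hρ : ∀ g v, ρ g (b v) = b (g • v))
    (N k : ℕ) (g : G) : ∀ x ∈ ripsChains b D N k Set.univ,
      extRep ρ g x ∈ ripsChains b D N k Set.univ := by
  have h : ripsChains b D N k Set.univ ≤ (ripsChains b D N k Set.univ).comap (extRep ρ g) := by
    refine Submodule.span_le.2 ?_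
    rintro _ ⟨l, h1, -, h3, rfl⟩
    refine Submodule.subset_span ⟨l.map (g • ·), by simp [h1], by simp, ?_, ?_⟩
    · intro v hv w hw
      obtain ⟨v, hv', rfl⟩ := List.mem_map.1 hv
      obtain ⟨w, hw', rfl⟩ := List.mem_map.1 hw
      rw [hD.smul]
      exact h3 v hv' w hw'
    · rw [extRep_wedge hρ]
  exact fun x hx => h hx

/-- The chains of the Rips complex on `k` vertices, as a module over the group ring. -/
def ripsModule (hD : IsProperHyperbolic G D c) (hρ : ∀ g v, ρ g (b v) = b (g • v)) (N k : ℕ) :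
    Submodule (MonoidAlgebra ℤ G) (extRep ρ).asModule :=
  invariantSubmodule (extRep ρ) (ripsChains b D N k Set.univ) (extRep_mem_ripsChains hD hρ N k)

/-- The element of the module that is given by a monomial. -/
def wedgeElem (ρ : Representation ℤ G M) (b : Module.Basis V ℤ M) (s : Finset V) :
    (extRep ρ).asModule :=
  (extRep ρ).asModuleEquiv.symm (wedge b s.toList)

/-- The functional dual to the translate by `g` of `s` reads off the coefficient at `g`. Free action
is essential: a nontrivial stabilizer would add several coefficients with orientation signs. -/
lemma wedgeCoord_smul_wedgeElem (hD : IsProperHyperbolic G D c)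
    (hG : ∀ g : G, IsOfFinOrder g → g = 1) (hρ : ∀ g v, ρ g (b v) = b (g • v)) {N k : ℕ}
    (hk : 2 ≤ k) (g : G) (s t : ripsReps G D N k) (a : MonoidAlgebra ℤ G) :
    wedgeCoord b ((s : Finset V).toList.map (g • ·))
      ((extRep ρ).asModuleEquiv (a • wedgeElem ρ b (t : Finset V))) =
        if t = s then a.coeff g else 0 := by
  induction a using MonoidAlgebra.induction_linear with
  | zero => simp
  | add a a' ha ha' =>
    rw [add_smul, map_add, map_add, ha, ha']
    split_ifs <;> simp
  | single h n =>
    have h1 : (extRep ρ).asModuleEquiv (MonoidAlgebra.single h n • wedgeElem ρ b (t : Finset V)) =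
        n • wedge b ((t : Finset V).toList.map (h • ·)) := by
      rw [Representation.single_smul, ← extRep_wedge hρ]
      rfl
    rw [h1, map_zsmul]
    by_cases hst : g • (s : Finset V) = h • (t : Finset V)
    · have h2 : s = t := Subtype.ext (eq_of_mem_ripsReps s.2 t.2 (g := h⁻¹ * g) (by
        rw [mul_smul, hst, inv_smul_smul]))
      subst h2
      have h3 : h⁻¹ * g = 1 := hD.eq_one_of_smul_eq hG (hk.trans_eq s.2.1.1.symm) (by
        rw [mul_smul, hst, inv_smul_smul])
      have h4 : h = g := inv_mul_eq_one.1 h3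
      subst h4
      rw [wedgeCoord_self]
      · simp
      · exact (Finset.nodup_toList _).map (MulAction.injective h)
    · have h2 : ∃ u ∈ g • (s : Finset V), u ∉ h • (t : Finset V) := by
        by_contra hcon
        push Not at hcon
        refine hst (Finset.eq_of_subset_of_card_le hcon ?_)
        rw [Finset.card_smul_finset, Finset.card_smul_finset, s.2.1.1, t.2.1.1]
      obtain ⟨u, hu, hu'⟩ := h2
      rw [wedgeCoord_eq_zero b (u := u), smul_zero]
      · split_ifs with h3
        · subst h3
          rw [MonoidAlgebra.coeff_single, Finsupp.single_apply, if_neg]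
          rintro rfl
          exact hst rfl
        · rfl
      · simpa [Finset.mem_smul_finset] using hu
      · simpa [Finset.mem_smul_finset] using hu'

lemma linearIndependent_wedgeElem (hD : IsProperHyperbolic G D c)
    (hG : ∀ g : G, IsOfFinOrder g → g = 1) (hρ : ∀ g v, ρ g (b v) = b (g • v)) {N k : ℕ}
    (hk : 2 ≤ k) : LinearIndependent (MonoidAlgebra ℤ G)
      fun s : ripsReps G D N k => wedgeElem ρ b (s : Finset V) := by
  rw [linearIndependent_iff']
  intro F a h s hs
  ext g
  have h1 := congrArg (fun x => wedgeCoord b ((s : Finset V).toList.map (g • ·))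
    ((extRep ρ).asModuleEquiv x)) h
  simp only [map_sum, map_zero, wedgeCoord_smul_wedgeElem hD hG hρ hk] at h1
  rw [Finset.sum_ite_eq' F s, if_pos hs] at h1
  simpa using h1

lemma ripsModule_eq_span (hD : IsProperHyperbolic G D c) (hρ : ∀ g v, ρ g (b v) = b (g • v))
    (N k : ℕ) : ripsModule hD hρ N k = Submodule.span (MonoidAlgebra ℤ G)
      (Set.range fun s : ripsReps G D N k => wedgeElem ρ b (s : Finset V)) := by
  refine le_antisymm ?_ (Submodule.span_le.2 ?_)
  · intro x hx
    change (extRep ρ).asModuleEquiv x ∈ ripsChains b D N k Set.univ at hx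
    obtain ⟨y, rfl⟩ := (extRep ρ).asModuleEquiv.symm.surjective x
    rw [LinearEquiv.apply_symm_apply] at hx
    induction hx using Submodule.span_induction with
    | mem x hx =>
      obtain ⟨l, h1, -, h3, rfl⟩ := hx
      by_cases hl : l.Nodup
      swap
      · rw [wedge_of_not_nodup b hl, map_zero]
        exact zero_mem _
      have hs : l.toFinset ∈ ripsSimplices D N k :=
        ⟨by rw [List.toFinset_card_of_nodup hl, h1], by simpa using h3⟩
      obtain ⟨g, hg, hmem⟩ := out_mem_ripsReps hD hs
      set t := (Quotient.mk (MulAction.orbitRel G (Finset V)) l.toFinset).out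
      have hperm : l.Perm (t.toList.map (g • ·)) := by
        rw [List.perm_ext_iff_of_nodup hl ((Finset.nodup_toList _).map (MulAction.injective g))]
        intro v
        rw [← List.mem_toFinset, ← hg]
        simp [Finset.mem_smul_finset]
      have h4 : (extRep ρ).asModuleEquiv.symm (wedge b (t.toList.map (g • ·))) ∈
          Submodule.span (MonoidAlgebra ℤ G)
            (Set.range fun s : ripsReps G D N k => wedgeElem ρ b (s : Finset V)) := by
        have h5 : (extRep ρ).asModuleEquiv.symm (wedge b (t.toList.map (g • ·))) =
            MonoidAlgebra.single g (1 : ℤ) • wedgeElem ρ b t := by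
          rw [Representation.single_smul, ← extRep_wedge hρ, one_smul]
          rfl
        rw [h5]
        exact Submodule.smul_mem _ _ (Submodule.subset_span ⟨⟨t, hmem⟩, rfl⟩)
      -- The list and the translated representative enumerate the same simplex, so their monomials
      -- agree up to orientation.
      rcases wedge_perm b hperm with h5 | h5 <;> rw [h5]
      · exact h4
      · rw [map_neg]
        exact neg_mem h4
    | zero => rw [map_zero]; exact zero_mem _
    | add x y _ _ hx hy => rw [map_add]; exact add_mem hx hy
    | smul r x _ hx =>
      rw [map_zsmul]
      exact zsmul_mem hx r
  · rintro _ ⟨s, rfl⟩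
    change wedge b (s : Finset V).toList ∈ ripsChains b D N k Set.univ
    refine Submodule.subset_span ⟨_, ?_, by simp, ?_, rfl⟩
    · rw [Finset.length_toList, s.2.1.1]
    · simpa using s.2.1.2

lemma free_ripsModule (hD : IsProperHyperbolic G D c) (hG : ∀ g : G, IsOfFinOrder g → g = 1)
    (hρ : ∀ g v, ρ g (b v) = b (g • v)) {N k : ℕ} (hk : 2 ≤ k) :
    Module.Free (MonoidAlgebra ℤ G) (ripsModule hD hρ N k) ∧
      Module.Finite (MonoidAlgebra ℤ G) (ripsModule hD hρ N k) := by
  rw [ripsModule_eq_span]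
  refine ⟨Module.Free.of_basis (Module.Basis.span (linearIndependent_wedgeElem hD hG hρ hk)), ?_⟩
  have := (finite_ripsReps hD (N := N) hk).to_subtype
  exact Module.Finite.span_of_finite _ (Set.finite_range _)

lemma exists_subsingleton_ripsModule (hD : IsProperHyperbolic G D c)
    (hρ : ∀ g v, ρ g (b v) = b (g • v)) (N : ℕ) :
    ∃ n, ∀ k, n < k → Subsingleton (ripsModule hD hρ N k) := by
  obtain ⟨T, hT, h⟩ := hD.exists_finite_simplices N
  obtain ⟨m, hm⟩ := (hT.image Finset.card).bddAbove
  -- Representatives of simplices with at least two vertices have at most `m` vertices; adding `2`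
  -- guarantees `k ≥ 2`, where the finiteness applies.
  refine ⟨m + 2, fun k hk => ?_⟩
  rw [ripsModule_eq_span, Submodule.subsingleton_iff_eq_bot, Submodule.span_eq_bot]
  rintro _ ⟨s, rfl⟩
  obtain ⟨g, hg⟩ := h k (by omega) s s.2.1
  have h1 := hm ⟨_, hg, rfl⟩
  rw [Finset.card_smul_finset, s.2.1.1] at h1
  omega

end Rips
end RelHyp
end

noncomputable section
namespace RelHyp

/-! ### The truncated Rips complex as a resolution. -/

section Resolution

open ExteriorAlgebra

variable {G : Type u} [Group G] {H : Subgroup G}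

/-- The cosets form a basis of `ℤ[G/H]`. -/
def cosetBasis (H : Subgroup G) : Module.Basis (G ⧸ H) ℤ (MonoidAlgebra ℤ (G ⧸ H)) :=
  Module.Basis.ofRepr (MonoidAlgebra.coeffLinearEquiv ℤ)

lemma cosetBasis_apply (v : G ⧸ H) : cosetBasis H v = MonoidAlgebra.single v 1 := rfl

lemma ofMulAction_cosetBasis (g : G) (v : G ⧸ H) :
    Representation.ofMulAction ℤ G (G ⧸ H) g (cosetBasis H v) = cosetBasis H (g • v) := by
  rw [cosetBasis_apply, cosetBasis_apply, Representation.ofMulAction_single]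

lemma coeffSum_cosetBasis (v : G ⧸ H) : coeffSum H (cosetBasis H v) = 1 := by
  simp [coeffSum, cosetBasis_apply]

lemma coeffSum_comp_ofMulAction (g : G) :
    coeffSum H ∘ₗ Representation.ofMulAction ℤ G (G ⧸ H) g = coeffSum H := by
  refine (cosetBasis H).ext fun v => ?_
  rw [LinearMap.comp_apply, ofMulAction_cosetBasis, coeffSum_cosetBasis, coeffSum_cosetBasis]

/-- The boundary map of the Rips complex. -/
def ripsBoundary (H : Subgroup G) :
    (extRep (Representation.ofMulAction ℤ G (G ⧸ H))).asModule →ₗ[MonoidAlgebra ℤ G]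
      (extRep (Representation.ofMulAction ℤ G (G ⧸ H))).asModule :=
  Representation.IntertwiningMap.equivLinearMapAsModule _ _
    { toLinearMap := contract (coeffSum H)
      isIntertwining' := fun g => LinearMap.ext fun x => by
        rw [LinearMap.comp_apply, LinearMap.comp_apply, extRep_apply, extRep_apply, contract_map,
          coeffSum_comp_ofMulAction] }

lemma ripsBoundary_apply (x : (extRep (Representation.ofMulAction ℤ G (G ⧸ H))).asModule) :
    (extRep _).asModuleEquiv (ripsBoundary H x) =
      contract (coeffSum H) ((extRep _).asModuleEquiv x) := rfl

/-- The inclusion of `ℤ[G/H]` into its exterior algebra. -/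
def ripsInclusion (H : Subgroup G) : CosetModule H →ₗ[MonoidAlgebra ℤ G]
      (extRep (Representation.ofMulAction ℤ G (G ⧸ H))).asModule :=
  Representation.IntertwiningMap.equivLinearMapAsModule _ _
    { toLinearMap := ι ℤ
      isIntertwining' := fun g => LinearMap.ext fun x => by
        rw [LinearMap.comp_apply, LinearMap.comp_apply, extRep_apply, map_apply_ι] }

lemma ripsInclusion_apply (x : CosetModule H) :
    (extRep _).asModuleEquiv (ripsInclusion H x) =
      ι ℤ ((Representation.ofMulAction ℤ G (G ⧸ H)).asModuleEquiv x) := rfl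

lemma ripsInclusion_injective (H : Subgroup G) : Function.Injective (ripsInclusion H) :=
  ι_leftInverse.injective

lemma ripsBoundary_ripsInclusion (x : CosetModule H) :
    ripsBoundary H (ripsInclusion H x) = 0 ↔ x ∈ Delta H := by
  have h : (extRep _).asModuleEquiv (ripsBoundary H (ripsInclusion H x)) =
      algebraMap ℤ _ (coeffSum H ((Representation.ofMulAction ℤ G (G ⧸ H)).asModuleEquiv x)) := by
    rw [ripsBoundary_apply, ripsInclusion_apply]
    exact CliffordAlgebra.contractLeft_ι (0 : QuadraticForm ℤ (MonoidAlgebra ℤ (G ⧸ H)))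
      (coeffSum H) _
  rw [← (extRep (Representation.ofMulAction ℤ G (G ⧸ H))).asModuleEquiv.map_eq_zero_iff, h,
    map_eq_zero_iff _ (algebraMap_leftInverse (R := ℤ) (MonoidAlgebra ℤ (G ⧸ H))).injective,
    LinearMap.mem_ker]
  rfl

variable {D : G ⧸ H → G ⧸ H → ℕ} {c : ℕ}

/-- The chain modules of the Rips complex on the set of cosets. -/
abbrev cosetRips (hD : IsProperHyperbolic G D c) (k : ℕ) :=
  ripsModule hD (ofMulAction_cosetBasis (H := H)) (2 * c + 2) k

lemma ripsBoundary_mem (hD : IsProperHyperbolic G D c) {k : ℕ} :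
    ∀ x ∈ cosetRips hD (k + 1), ripsBoundary H x ∈ cosetRips hD k :=
  fun _ hx => contract_mem_ripsChains (cosetBasis H) _ hx

lemma ripsBoundary_ripsBoundary (x : (extRep (Representation.ofMulAction ℤ G (G ⧸ H))).asModule) :
    ripsBoundary H (ripsBoundary H x) = 0 :=
  contract_contract _ _

lemma exists_ripsBoundary_eq (hD : IsProperHyperbolic G D c) {k : ℕ}
    {x : (extRep (Representation.ofMulAction ℤ G (G ⧸ H))).asModule} (hx : x ∈ cosetRips hD k)
    (hx0 : ripsBoundary H x = 0) : ∃ y ∈ cosetRips hD (k + 1), ripsBoundary H y = x :=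
  exists_contract_eq (cosetBasis H) hD rfl coeffSum_cosetBasis ((1 : G) : G ⧸ H) hx hx0

/-- The bottom of the complex is `ℤ[G/H]` itself, which need not be free; the resolution therefore
starts with two vertices. -/
lemma cosetRips_one (hD : IsProperHyperbolic G D c) :
    cosetRips hD 1 = LinearMap.range (ripsInclusion H) := by
  refine le_antisymm ?_ ?_
  · intro x hx
    have h : ripsChains (cosetBasis H) D (2 * c + 2) 1 Set.univ ≤ LinearMap.range (ι ℤ) := by
      refine Submodule.span_le.2 ?_
      rintro _ ⟨l, h1, -, -, rfl⟩
      obtain ⟨v, rfl⟩ := List.length_eq_one_iff.1 h1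
      exact ⟨cosetBasis H v, by simp [wedge]⟩
    obtain ⟨y, hy⟩ := h hx
    exact ⟨y, hy⟩
  · rintro _ ⟨x, rfl⟩
    have h : (⊤ : Submodule ℤ (MonoidAlgebra ℤ (G ⧸ H))) ≤
        (ripsChains (cosetBasis H) D (2 * c + 2) 1 Set.univ).comap (ι ℤ) := by
      rw [← (cosetBasis H).span_eq, Submodule.span_le]
      rintro _ ⟨v, rfl⟩
      exact Submodule.subset_span ⟨[v], rfl, by simp, by simp [hD.self], by simp [wedge]⟩
    exact h (Submodule.mem_top (x := x))

/-- The augmentation of the Rips complex, with values in `ℤ[G/H]`. -/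
def ripsAugmentation (hD : IsProperHyperbolic G D c) :
    cosetRips hD 2 →ₗ[MonoidAlgebra ℤ G] CosetModule H :=
  (LinearEquiv.ofInjective (ripsInclusion H) (ripsInclusion_injective H)).symm.toLinearMap ∘ₗ
    ((ripsBoundary H) ∘ₗ (cosetRips hD 2).subtype).codRestrict _ fun x => by
      rw [← cosetRips_one hD]
      exact ripsBoundary_mem hD _ x.2

lemma ripsInclusion_ripsAugmentation (hD : IsProperHyperbolic G D c) (x : cosetRips hD 2) :
    ripsInclusion H (ripsAugmentation hD x) = ripsBoundary H x := by
  have h := (LinearEquiv.ofInjective (ripsInclusion H) (ripsInclusion_injective H)).apply_symm_apply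
    (((ripsBoundary H) ∘ₗ (cosetRips hD 2).subtype).codRestrict (LinearMap.range (ripsInclusion H))
      (fun x => by
        rw [← cosetRips_one hD]
        exact ripsBoundary_mem hD _ x.2) x)
  exact congrArg Subtype.val h

/-- The Rips complex is a finite free resolution of `Δ`. -/
theorem hasFiniteFreeResolution_delta (hG : ∀ g : G, IsOfFinOrder g → g = 1)
    (hD : IsProperHyperbolic G D c) :
    HasFiniteFreeResolution (MonoidAlgebra ℤ G) (Delta H) := by
  obtain ⟨n, hn⟩ := exists_subsingleton_ripsModule hD (ofMulAction_cosetBasis (H := H)) (2 * c + 2)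
  -- The shift by two discards the chains on at most one vertex. Acyclicity at `k = 1` gives
  -- surjectivity onto `Δ`, and acyclicity for `k ≥ 2` gives the remaining exactness.
  refine ⟨n, fun i => ModuleCat.of _ (cosetRips hD (i + 2)),
    fun i => (ripsBoundary H).restrict (ripsBoundary_mem hD (k := i + 2)),
    (ripsAugmentation hD).codRestrict (Delta H) fun x => ?_, fun i => ?_, fun i hi => ?_, ?_, ?_,
    fun i => ?_⟩
  · rw [← ripsBoundary_ripsInclusion, ripsInclusion_ripsAugmentation, ripsBoundary_ripsBoundary]
  · exact free_ripsModule hD hG _ (by omega)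
  · exact hn (i + 2) (by omega)
  · rintro ⟨x, hx⟩
    obtain ⟨y, hy, hxy⟩ := exists_ripsBoundary_eq hD (k := 1) (x := ripsInclusion H x)
      (by rw [cosetRips_one]; exact ⟨x, rfl⟩) ((ripsBoundary_ripsInclusion x).2 hx)
    refine ⟨⟨y, hy⟩, Subtype.ext (ripsInclusion_injective H ?_)⟩
    exact (ripsInclusion_ripsAugmentation hD ⟨y, hy⟩).trans hxy
  · intro x
    have h0 : (ripsAugmentation hD).codRestrict (Delta H) (fun x => by
        rw [← ripsBoundary_ripsInclusion, ripsInclusion_ripsAugmentation,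
          ripsBoundary_ripsBoundary]) x = 0 ↔ ripsBoundary H x = 0 := by
      rw [← ripsInclusion_ripsAugmentation, map_eq_zero_iff _ (ripsInclusion_injective H),
        ← Subtype.coe_inj]
      rfl
    rw [h0]
    constructor
    · intro hx
      obtain ⟨y, hy, hxy⟩ := exists_ripsBoundary_eq hD x.2 hx
      exact ⟨⟨y, hy⟩, Subtype.ext hxy⟩
    · rintro ⟨y, rfl⟩
      exact ripsBoundary_ripsBoundary _
  · intro x
    constructor
    · intro hx
      obtain ⟨y, hy, hxy⟩ := exists_ripsBoundary_eq hD x.2 (congrArg Subtype.val hx)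
      exact ⟨⟨y, hy⟩, Subtype.ext hxy⟩
    · rintro ⟨y, rfl⟩
      exact Subtype.ext (ripsBoundary_ripsBoundary _)

end Resolution

/-! ### Projective dimension and relative cohomological dimension. -/

section Cohomology

open CategoryTheory

lemma HasFiniteFreeResolution.isTypeFP {R : Type u} [Ring R] {M : Type u} [AddCommGroup M]
    [Module R M] (h : HasFiniteFreeResolution R M) : IsTypeFP R M := by
  obtain ⟨n, F, d, ε, h1, h2⟩ := h
  refine ⟨n, F, d, ε, fun i => ⟨?_, (h1 i).2⟩, h2⟩
  have := (h1 i).1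
  exact Module.Projective.of_free

/-- Dimension shifting: the shifted complex resolves the kernel of `ε`, which has projective
dimension one less. For `n = 0` the complex is zero and surjectivity forces `M = 0`. -/
lemma hasProjectiveDimensionLT_of_exact {R : Type u} [Ring R] (n : ℕ) {M : Type u}
    [AddCommGroup M] [Module R M] (P : ℕ → ModuleCat.{u} R) (d : ∀ i, P (i + 1) →ₗ[R] P i)
    (ε : P 0 →ₗ[R] M) (hP : ∀ i, Module.Projective R (P i)) (hn : ∀ i, n ≤ i → Subsingleton (P i))
    (hε : Function.Surjective ε) (h0 : Function.Exact (d 0) ε)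
    (hd : ∀ i, Function.Exact (d (i + 1)) (d i)) :
    HasProjectiveDimensionLT (ModuleCat.of R M) n := by
  induction n generalizing M P with
  | zero =>
    have := hn 0 le_rfl
    have : Subsingleton (ModuleCat.of R M) := hε.subsingleton
    exact (ModuleCat.isZero_of_subsingleton _).hasProjectiveDimensionLT_zero
  | succ n ih =>
    let S : ShortComplex (ModuleCat.{u} R) :=
      { X₁ := ModuleCat.of R (LinearMap.ker ε)
        X₂ := P 0
        X₃ := ModuleCat.of R M
        f := ModuleCat.ofHom (LinearMap.ker ε).subtype
        g := ModuleCat.ofHom ε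
        zero := by ext x; exact x.2 }
    have hS : S.ShortExact :=
      { exact := by
          rw [ShortComplex.ShortExact.moduleCat_exact_iff_function_exact]
          exact LinearMap.exact_subtype_ker_map ε
        mono_f := (ModuleCat.mono_iff_injective _).2 Subtype.val_injective
        epi_g := (ModuleCat.epi_iff_surjective _).2 hε }
    refine hS.hasProjectiveDimensionLT_X₃ n ?_ ?_
    · refine ih (fun i => P (i + 1)) (fun i => d (i + 1))
        ((d 0).codRestrict (LinearMap.ker ε) fun x => h0.apply_apply_eq_zero x) (fun i => hP _)
        (fun i hi => hn _ (by omega)) ?_ ?_ fun i => hd _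
      · rintro ⟨x, hx⟩
        obtain ⟨y, rfl⟩ := (h0 x).1 hx
        exact ⟨y, rfl⟩
      · intro x
        rw [← hd 0 x, ← Subtype.coe_inj]
        rfl
    · have := hP 0
      exact hasProjectiveDimensionLT_of_ge (P 0) 1 (n + 1) (by omega)

lemma relCohomologicalDimension_lt_top {G : Type u} [Group G] {H : Subgroup G}
    (h : IsTypeFP (MonoidAlgebra ℤ G) (Delta H)) : relCohomologicalDimension H < ⊤ := by
  obtain ⟨n, P, d, ε, h1, h2, h3, h4, h5⟩ := h
  have hpd := hasProjectiveDimensionLT_of_exact (M := Delta H) (n + 1) P d ε (fun i => (h1 i).1)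
    (fun i hi => h2 i (by omega)) h3 h4 h5
  -- `Ext` vanishes from degree `n + 1` on, and relative cohomology is shifted by one, so nonzero
  -- groups occur only in degrees up to `n + 1`.
  refine lt_of_le_of_lt (b := ((n + 1 : ℕ) : WithBot ℕ∞)) (sSup_le ?_) ?_
  · rintro _ ⟨i, rfl, M, hM⟩
    cases i with
    | zero => exact (not_nontrivial PUnit hM).elim
    | succ i =>
      by_contra hlt
      have hi : n + 1 ≤ i := by
        by_contra hi
        exact hlt (by exact_mod_cast (by omega : i + 1 ≤ n + 1))
      have : Subsingleton (RelCohomology H M (i + 1)) := HasProjectiveDimensionLT.subsingleton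
        (ModuleCat.of (MonoidAlgebra ℤ G) (Delta H)) (n + 1) i hi M
      exact not_nontrivial _ hM
  · exact WithBot.coe_lt_coe.2 (WithTop.coe_lt_top _)

end Cohomology

end RelHyp
end

theorem mainTheorem1 (G : Type u) [Group G] (hG : ∀ g : G, IsOfFinOrder g → g = 1)
    (H : Subgroup G) (hGH : RelHyp.IsHyperbolicRelativeTo G H) :
    RelHyp.HasFiniteFreeResolution (MonoidAlgebra ℤ G) (RelHyp.Delta H) ∧
    RelHyp.IsTypeFP (MonoidAlgebra ℤ G) (RelHyp.Delta H) ∧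
    RelHyp.relCohomologicalDimension H < ⊤ := by
  obtain ⟨S, hfin, hS, hH, hyp, bcp⟩ := hGH
  obtain ⟨K, hK⟩ := RelHyp.exists_fourPoint hS hyp
  obtain ⟨κ, hκ⟩ := RelHyp.exists_proj_bound hS hH bcp hK
  obtain ⟨δ, hδ⟩ := RelHyp.IsFineHyperbolic.exists_cusped_fourPoint ⟨hS, hK, hκ⟩
  have hD := RelHyp.isProperHyperbolic_cosetDist hS hfin hδ
  have h := RelHyp.hasFiniteFreeResolution_delta hG hD
  exact ⟨h, h.isTypeFP, RelHyp.relCohomologicalDimension_lt_top h.isTypeFP⟩
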